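/- Conventions. Locally compact abelian (LCA) groups are Hausdorff; $\hat G$ denotes the Pontryagin dual of $G$, and $\hat\varphi:\hat H\to\hat G$, $\hat\varphi(\chi)=\chi\circ\varphi$, the dual of a continuous homomorphism $\varphi:G\to H$. Haar measures on $G$ and $\hat H$ are fixed. The group $G$ acts on $C_0(H)$ by $(\alpha_g a)(h)=a(\varphi(g)^{-1}h)$, and $G\ltimes C_0(H)$ is the crossed product C*-algebra, that is, the completion of $C_c(G,C_0(H))$ for the norm $\|x\|=\sup\|\int_G\pi(x(g))U(g)\,dg\|$, the supremum being over all covariant representations $(\pi,U)$ (with $\pi$ a nondegenerate $*$-representation of $C_0(H)$ and $U$ a strongly continuous unitary representation of $G$ on the same Hilbert space, $U(g)\pi(a)U(g)^*=\pi(\alpha_g a)$). Similarly $\hat H\ltimes C_0(\hat G)$ is the crossed product defined by $\hat\varphi$. When $G$ is discrete, $C_0(H)$ maps canonically to $G\ltimes C_0(H)$. A closed abelian $*$-subalgebra $B$ of a C*-algebra $A$ is a Cartan subalgebra if it contains an approximate unit of $A$, is maximal abelian, is regular (its normalizer $\{n\in A: nBn^*\subset B,\ n^*Bn\subset B\}$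 generates $A$ as a C*-algebra), and there is a faithful conditional expectation of $A$ onto $B$. It is a diagonal if, moreover, every pure state of $B$ extends uniquely to a pure state of $A$. Theorem. (1) Let $\varphi:G\to H$ be a continuous homomorphism of LCA groups. The Fourier transform gives a $*$-isomorphism $F: G\ltimes C_0(H)\to\hat H\ltimes C_0(\hat G)$: for every $f\in C_c(G\times\hat H)$, the formulas $$x(g)(h)=\int_{\hat H} f(g,\chi)\,\chi(h)\,d\chi,\qquad y(\chi)(\psi)=\int_G f(g,\chi)\,\chi(\varphi(g))\,\overline{\psi(g)}\,dg$$ define $x\in C_c(G,C_0(H))$ and $y\in C_c(\hat H,C_0(\hat G))$, and $F(x)=y$. For this $F$: (a) if $G$ is discrete and $\varphi$ is one-to-one, then $C_0(H)$ embeds in $G\ltimes C_0(H)$ as a diagonal; (b) if $\hat H$ is discrete and $\hat\varphi$ is one-to-one, then $C_0(\hat G)$ embeds in $\hat H\ltimes C_0(\hat G)$, and its image under $F^{-1}$ is a diagonal of $G\ltimes C_0(H)$; (c) if $G$ is discrete, $H$ is compact, and $\varphi$ is one-to-one and has dense range, then $\hat\varphi$ is one-to-one and $C_0(H)$ and $F^{-1}(C_0(\hat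 G))$ are both diagonals of $G\ltimes C_0(H)$. (2) Let $\alpha,\beta$ be real numbers such that $1,\alpha,\beta$ are linearly independent over $\mathbf Q$, and let $G=\mathbf Z^2$, $H=\mathbf R/\mathbf Z$, $\varphi(m,n)=\alpha m+\beta n+\mathbf Z$. Then, with $F$ as in (1), $C_0(H)$ and $F^{-1}(C_0(\hat G))$ are diagonals of the same C*-algebra $G\ltimes C_0(H)$; the first is $*$-isomorphic to $C(\mathbf T)$, the second to $C(\mathbf T^2)$, and they are not isomorphic, even as complex algebras. -/

import Mathlib

open scoped ZeroAtInfty CompactlySupported ENNReal ComplexConjugate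
open MeasureTheory

universe u v

noncomputable section

namespace CartanExamples

section Subalgebras

/-- A state of a (possibly non-unital) C*-algebra: a positive functional of norm one. -/
def IsState {A : Type*} [NonUnitalNormedRing A] [StarRing A] [NormedSpace ℂ A]
    (ω : A →L[ℂ] ℂ) : Prop :=
  (∀ a : A, 0 ≤ (ω (star a * a)).re ∧ (ω (star a * a)).im = 0) ∧ ‖ω‖ = 1

/-- A pure state: an extreme point of the convex set of states. -/
def IsPureState {A : Type*} [NonUnitalNormedRing A] [StarRing A] [NormedSpace ℂ A]
    (ω : A →L[ℂ] ℂ) : Prop :=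
  ω ∈ Set.extremePoints ℝ {ω' : A →L[ℂ] ℂ | IsState ω'}

variable {A : Type*} [NonUnitalCStarAlgebra A]

/-- The subalgebra `B` contains an approximate unit of `A` (consisting, as usual, of positive
elements of norm at most one). -/
def ContainsApproximateUnit (B : NonUnitalStarSubalgebra ℂ A) : Prop :=
  ∃ l : Filter A, l.IsApproximateUnit ∧
    ∀ᶠ e in l, e ∈ B ∧ ‖e‖ ≤ 1 ∧ ∃ c : A, e = star c * c

/-- `B` is commutative, and no larger *-subalgebra is. -/
def IsMaximalAbelian (B : NonUnitalStarSubalgebra ℂ A) : Prop :=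
  (∀ x ∈ B, ∀ y ∈ B, x * y = y * x) ∧
    ∀ C : NonUnitalStarSubalgebra ℂ A, B ≤ C → (∀ x ∈ C, ∀ y ∈ C, x * y = y * x) → C = B

/-- The normalizer of `B` in `A`. -/
def normalizerSet (B : NonUnitalStarSubalgebra ℂ A) : Set A :=
  {n | ∀ b ∈ B, n * b * star n ∈ B ∧ star n * b * n ∈ B}

/-- `B` is regular: its normalizer generates `A` as a C*-algebra. -/
def IsRegularSubalgebra (B : NonUnitalStarSubalgebra ℂ A) : Prop :=
  (NonUnitalStarAlgebra.adjoin ℂ (normalizerSet B)).topologicalClosure = ⊤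

/-- `P` is a faithful conditional expectation of `A` onto `B`. -/
structure IsFaithfulConditionalExpectation (B : NonUnitalStarSubalgebra ℂ A)
    (P : A →L[ℂ] A) : Prop where
  mem : ∀ a, P a ∈ B
  apply_of_mem : ∀ b ∈ B, P b = b
  norm_le : ∀ a, ‖P a‖ ≤ ‖a‖
  positive : ∀ a, ∃ c : A, P (star a * a) = star c * c
  map_mul_left : ∀ b ∈ B, ∀ a, P (b * a) = b * P a
  map_mul_right : ∀ b ∈ B, ∀ a, P (a * b) = P a * b
  faithful : ∀ a, P (star a * a) = 0 → a = 0

/-- Cartan subalgebras of a C*-algebra. -/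
structure IsCartanSubalgebra (B : NonUnitalStarSubalgebra ℂ A) : Prop where
  isClosed : IsClosed (B : Set A)
  approximateUnit : ContainsApproximateUnit B
  maximalAbelian : IsMaximalAbelian B
  regular : IsRegularSubalgebra B
  expectation : ∃ P : A →L[ℂ] A, IsFaithfulConditionalExpectation B P

/-- The unique extension property: every pure state of `B` extends uniquely to a pure state
of `A`. -/
def HasUniqueExtensionProperty (B : NonUnitalStarSubalgebra ℂ A) : Prop :=
  ∀ ω : B →L[ℂ] ℂ, IsPureState ω →
    ∃! ω' : A →L[ℂ] ℂ, IsPureState ω' ∧ ∀ b : B, ω' (b : A) = ω b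

/-- Diagonals: Cartan subalgebras with the unique extension property. -/
structure IsDiagonal (B : NonUnitalStarSubalgebra ℂ A) : Prop where
  cartan : IsCartanSubalgebra B
  uniqueExtension : HasUniqueExtensionProperty B

end Subalgebras

section Haar

variable {G : Type*} [TopologicalSpace G] [Group G] [IsTopologicalGroup G] [LocallyCompactSpace G]

/-- Integration against the (fixed) Haar measure on the Borel sets of `G`. -/
def haarIntegral {E : Type*} [NormedAddCommGroup E] [NormedSpace ℝ E] (f : G → E) : E :=
  letI : MeasurableSpace G := borel G
  haveI : BorelSpace G := ⟨rfl⟩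
  ∫ g, f g ∂(Measure.haar : Measure G)

end Haar

set_option linter.unusedSectionVars false
set_option linter.style.haveILetI false

instance {X : Type*} [TopologicalSpace X] : NonUnitalCStarAlgebra C₀(X, ℂ) where

section CrossedProduct

variable {G : Type u} {H : Type v}
  [TopologicalSpace G] [CommGroup G] [IsTopologicalGroup G] [LocallyCompactSpace G] [T2Space G]
  [TopologicalSpace H] [CommGroup H] [IsTopologicalGroup H] [LocallyCompactSpace H] [T2Space H]

/-- The translate `h ↦ a (x⁻¹ h)` of `a ∈ C₀(H)` by `x ∈ H`. -/
def translate (x : H) (a : C₀(H, ℂ)) : C₀(H, ℂ) :=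
  a.comp (Homeomorph.mulLeft x⁻¹).toCocompactMap

/-- A (nondegenerate) covariant representation, on a Hilbert space, of `C₀(H)` with the action
of `G` by translations through the homomorphism `φ`. The universe of the Hilbert space contains a
copy of every cyclic covariant representation. -/
structure CovariantRep (φ : G →ₜ* H) where
  /-- the Hilbert space -/
  E : Type (max u v)
  [normed : NormedAddCommGroup E]
  [inner : InnerProductSpace ℂ E]
  [complete : CompleteSpace E]
  /-- the representation of `C₀(H)` -/
  π : C₀(H, ℂ) →⋆ₙₐ[ℂ] (E →L[ℂ] E)
  /-- the unitary representation of `G` -/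
  U : G →* unitary (E →L[ℂ] E)
  nondegenerate :
    (Submodule.span ℂ {y : E | ∃ (a : C₀(H, ℂ)) (x : E), y = π a x}).topologicalClosure = ⊤
  continuous_U : ∀ x : E, Continuous fun g : G => (U g : E →L[ℂ] E) x
  covariant : ∀ (g : G) (a : C₀(H, ℂ)),
    (U g : E →L[ℂ] E) * π a * star (U g : E →L[ℂ] E) = π (translate (φ g) a)

attribute [instance] CovariantRep.normed CovariantRep.inner CovariantRep.complete

variable {φ : G →ₜ* H}

theorem CovariantRep.norm_π_le (ρ : CovariantRep φ) (a : C₀(H, ℂ)) : ‖ρ.π a‖ ≤ ‖a‖ :=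
  NonUnitalStarAlgHom.norm_apply_le ρ.π a

theorem CovariantRep.continuous_integrand (ρ : CovariantRep φ) (f : C_c(G, C₀(H, ℂ))) (x : ρ.E) :
    Continuous fun g : G => ρ.π (f g) ((ρ.U g : ρ.E →L[ℂ] ρ.E) x) := by
  have h1 : Continuous fun a : C₀(H, ℂ) => ρ.π a :=
    AddMonoidHomClass.continuous_of_bound ρ.π 1 (by simpa using ρ.norm_π_le)
  exact (h1.comp f.continuous).clm_apply (ρ.continuous_U x)

/-- The integrated form `∫ π(f(g)) U(g) dg` of a covariant representation. -/
def CovariantRep.integratedForm (ρ : CovariantRep φ) (f : C_c(G, C₀(H, ℂ))) :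
    ρ.E →L[ℂ] ρ.E :=
  LinearMap.mkContinuous
    { toFun := fun x => haarIntegral fun g : G => ρ.π (f g) ((ρ.U g : ρ.E →L[ℂ] ρ.E) x)
      map_add' := fun x y => by
        letI : MeasurableSpace G := borel G
        haveI : BorelSpace G := ⟨rfl⟩
        simp only [map_add]
        exact integral_add
          ((ρ.continuous_integrand f x).integrable_of_hasCompactSupport
            (f.hasCompactSupport.mono fun g hg h0 => hg (by simp [h0])))
          ((ρ.continuous_integrand f y).integrable_of_hasCompactSupport
            (f.hasCompactSupport.mono fun g hg h0 => hg (by simp [h0])))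
      map_smul' := fun c x => by
        letI : MeasurableSpace G := borel G
        haveI : BorelSpace G := ⟨rfl⟩
        simp only [map_smul, RingHom.id_apply]
        exact integral_smul c _ }
    (haarIntegral fun g : G => ‖f g‖) <| fun x => by
      letI : MeasurableSpace G := borel G
      haveI : BorelSpace G := ⟨rfl⟩
      have hf : Integrable (fun g : G => ‖f g‖) (Measure.haar : Measure G) :=
        f.continuous.norm.integrable_of_hasCompactSupport f.hasCompactSupport.norm
      have : ‖∫ g : G, ρ.π (f g) ((ρ.U g : ρ.E →L[ℂ] ρ.E) x) ∂(Measure.haar : Measure G)‖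
          ≤ ∫ g : G, ‖f g‖ * ‖x‖ ∂(Measure.haar : Measure G) := by
        refine norm_integral_le_of_norm_le (hf.mul_const _) (Filter.Eventually.of_forall fun g => ?_)
        refine (ContinuousLinearMap.le_opNorm _ _).trans ?_
        rw [Unitary.norm_map]
        exact mul_le_mul_of_nonneg_right (ρ.norm_π_le _) (norm_nonneg _)
      rw [integral_mul_const] at this
      exact this

theorem CovariantRep.integratedForm_apply (ρ : CovariantRep φ) (f : C_c(G, C₀(H, ℂ))) (x : ρ.E) :
    ρ.integratedForm f x =
      haarIntegral fun g : G => ρ.π (f g) ((ρ.U g : ρ.E →L[ℂ] ρ.E) x) := rfl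

theorem CovariantRep.norm_integratedForm_le (ρ : CovariantRep φ) (f : C_c(G, C₀(H, ℂ))) :
    ‖ρ.integratedForm f‖ ≤ haarIntegral fun g : G => ‖f g‖ :=
  LinearMap.mkContinuous_norm_le _ (by
    letI : MeasurableSpace G := borel G
    haveI : BorelSpace G := ⟨rfl⟩
    exact integral_nonneg fun g => norm_nonneg _) _

variable (φ)

/-- The C*-algebra of bounded families of operators on the spaces of all covariant
representations. -/
def RepProduct : Type (max u v + 1) := lp (fun ρ : CovariantRep φ => ρ.E →L[ℂ] ρ.E) ∞

instance : NonUnitalCStarAlgebra (RepProduct φ) :=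
  inferInstanceAs (NonUnitalCStarAlgebra (lp (fun ρ : CovariantRep φ => ρ.E →L[ℂ] ρ.E) ∞))

variable {φ} in
/-- The component of a bounded family of operators at a covariant representation. -/
def RepProduct.component (T : RepProduct φ) (ρ : CovariantRep φ) : ρ.E →L[ℂ] ρ.E :=
  (show lp (fun ρ : CovariantRep φ => ρ.E →L[ℂ] ρ.E) ∞ from T) ρ

variable {φ} in
theorem RepProduct.ext {S T : RepProduct φ} (h : ∀ ρ, S.component ρ = T.component ρ) : S = T :=
  lp.ext (funext h)

/-- The universal representation of `C_c(G, C₀(H))`: the family of all integrated forms. Its norm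
is the universal norm of the crossed product. -/
def universalForm (f : C_c(G, C₀(H, ℂ))) : RepProduct φ :=
  ⟨fun ρ => ρ.integratedForm f, memℓp_infty ⟨haarIntegral fun g : G => ‖f g‖, by
    rintro _ ⟨ρ, rfl⟩
    exact ρ.norm_integratedForm_le f⟩⟩

/-- The crossed product C*-algebra `G ⋉ C₀(H)`: the C*-algebra generated by `C_c(G, C₀(H))` in the
universal representation, that is, its completion for the universal norm. -/
def crossedProductSubalgebra : NonUnitalStarSubalgebra ℂ (RepProduct φ) :=
  (NonUnitalStarAlgebra.adjoin ℂ (Set.range (universalForm φ))).topologicalClosure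

instance : IsClosed (crossedProductSubalgebra φ : Set (RepProduct φ)) :=
  NonUnitalStarSubalgebra.isClosed_topologicalClosure _

/-- The crossed product `G ⋉ C₀(H)` as a type. -/
def CrossedProduct : Type (max u v + 1) := crossedProductSubalgebra φ

instance : NonUnitalCStarAlgebra (CrossedProduct φ) :=
  inferInstanceAs (NonUnitalCStarAlgebra (crossedProductSubalgebra φ))

/-- The element of `G ⋉ C₀(H)` given by a compactly supported function. -/
def CrossedProduct.ofFunction (f : C_c(G, C₀(H, ℂ))) : CrossedProduct φ :=
  ⟨universalForm φ f, NonUnitalStarSubalgebra.le_topologicalClosure _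
    (NonUnitalStarAlgebra.subset_adjoin ℂ _ ⟨f, rfl⟩)⟩

/-- The representation of `C₀(H)` in the universal representation. -/
def universalCoeff : C₀(H, ℂ) →⋆ₙₐ[ℂ] RepProduct φ where
  toFun a := ⟨fun ρ => ρ.π a, memℓp_infty ⟨‖a‖, by
    rintro _ ⟨ρ, rfl⟩
    exact ρ.norm_π_le a⟩⟩
  map_smul' c a := RepProduct.ext fun ρ => map_smul ρ.π c a
  map_zero' := RepProduct.ext fun ρ => map_zero ρ.π
  map_add' a b := RepProduct.ext fun ρ => map_add ρ.π a b
  map_mul' a b := RepProduct.ext fun ρ => map_mul ρ.π a b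
  map_star' a := RepProduct.ext fun ρ => map_star ρ.π a

open Classical in
/-- For discrete `G`, the function on `G` with value `a` at `1` and `0` elsewhere. -/
def deltaFunction [DiscreteTopology G] (a : C₀(H, ℂ)) : C_c(G, C₀(H, ℂ)) where
  toFun g := if g = 1 then a else 0
  continuous_toFun := continuous_of_discreteTopology
  hasCompactSupport' := HasCompactSupport.of_support_subset_isCompact
    (isCompact_singleton (x := (1 : G))) fun g hg => by
      by_contra h
      exact hg (if_neg h)

theorem universalCoeff_mem [DiscreteTopology G] (a : C₀(H, ℂ)) :
    universalCoeff φ a ∈ crossedProductSubalgebra φ := by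
  letI : MeasurableSpace G := borel G
  haveI : BorelSpace G := ⟨rfl⟩
  set c : ℝ := (Measure.haar : Measure G).real {1} with hc
  have hc0 : c ≠ 0 := by
    have h1 : (Measure.haar : Measure G) {1} ≠ 0 :=
      (isOpen_discrete _).measure_ne_zero _ (Set.singleton_nonempty _)
    have h2 : (Measure.haar : Measure G) {1} ≠ ⊤ :=
      (isCompact_singleton (x := (1 : G))).measure_ne_top
    exact ENNReal.toReal_ne_zero.2 ⟨h1, h2⟩
  have key : universalForm φ (deltaFunction (G := G) a) = (c : ℂ) • universalCoeff φ a := by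
    refine RepProduct.ext fun ρ => ContinuousLinearMap.ext fun x => ?_
    change (∫ g : G, ρ.π (deltaFunction (G := G) a g) ((ρ.U g : ρ.E →L[ℂ] ρ.E) x)
      ∂(Measure.haar : Measure G)) = (c : ℂ) • ρ.π a x
    rw [← setIntegral_eq_integral_of_forall_compl_eq_zero (s := {(1 : G)}),
      integral_singleton, ← hc]
    · simp [deltaFunction]
    · intro g hg
      have : deltaFunction (G := G) a g = 0 := if_neg hg
      simp [this]
  have : universalCoeff φ a =
      (c : ℂ)⁻¹ • universalForm φ (deltaFunction (G := G) a) := by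
    rw [key, smul_smul, inv_mul_cancel₀ (by exact_mod_cast hc0), one_smul]
  rw [this]
  exact SMulMemClass.smul_mem _ (CrossedProduct.ofFunction φ _).2

/-- For discrete `G`, the canonical homomorphism of `C₀(H)` into `G ⋉ C₀(H)`. -/
def coeffHom [DiscreteTopology G] : C₀(H, ℂ) →⋆ₙₐ[ℂ] CrossedProduct φ where
  toFun a := ⟨universalCoeff φ a, universalCoeff_mem φ a⟩
  map_smul' c a := Subtype.ext (map_smul (universalCoeff φ) c a)
  map_zero' := Subtype.ext (map_zero (universalCoeff φ))
  map_add' a b := Subtype.ext (map_add (universalCoeff φ) a b)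
  map_mul' a b := Subtype.ext (map_mul (universalCoeff φ) a b)
  map_star' a := Subtype.ext (map_star (universalCoeff φ) a)

/-- For discrete `G`, the subalgebra `C₀(H)` of `G ⋉ C₀(H)`. -/
def coeffSubalgebra [DiscreteTopology G] : NonUnitalStarSubalgebra ℂ (CrossedProduct φ) :=
  NonUnitalStarAlgHom.range (coeffHom φ)

/-- The crossed product `Ĥ ⋉ C₀(Ĝ)` of the dual homomorphism `φ̂ : Ĥ → Ĝ`. -/
abbrev DualCrossedProduct : Type (max u v + 1) := CrossedProduct (PontryaginDual.map φ)

/-- `F : G ⋉ C₀(H) → Ĥ ⋉ C₀(Ĝ)` is given by the Fourier transform: every compactly supported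
function `f` on `G × Ĥ` has partial Fourier transforms
`x(g)(h) = ∫ f(g, χ) χ(h) dχ` in `C_c(G, C₀(H))` and
`y(χ)(ψ) = ∫ f(g, χ) φ̂(χ)(g) conj(ψ(g)) dg` in `C_c(Ĥ, C₀(Ĝ))`, and `F` maps `x` to `y`. -/
def IsFourierTransform (F : CrossedProduct φ ≃⋆ₐ[ℂ] DualCrossedProduct φ) : Prop :=
  ∀ f : C_c(G × PontryaginDual H, ℂ),
    ∃ (x : C_c(G, C₀(H, ℂ))) (y : C_c(PontryaginDual H, C₀(PontryaginDual G, ℂ))),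
      (∀ g h, x g h = haarIntegral fun χ : PontryaginDual H => f (g, χ) * (χ h : ℂ)) ∧
      (∀ χ ψ, y χ ψ = haarIntegral fun g : G =>
        f (g, χ) * (PontryaginDual.map φ χ g : ℂ) * conj (ψ g : ℂ)) ∧
      F (CrossedProduct.ofFunction φ x) =
        CrossedProduct.ofFunction (PontryaginDual.map φ) y

variable {φ} in
/-- For discrete `Ĥ`, the subalgebra of `G ⋉ C₀(H)` which an isomorphism `F` onto `Ĥ ⋉ C₀(Ĝ)`
identifies with `C₀(Ĝ)`. -/
def dualCoeffSubalgebra [DiscreteTopology (PontryaginDual H)]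
    (F : CrossedProduct φ ≃⋆ₐ[ℂ] DualCrossedProduct φ) :
    NonUnitalStarSubalgebra ℂ (CrossedProduct φ) :=
  (coeffSubalgebra (PontryaginDual.map φ)).map F.symm

end CrossedProduct

/-- The homomorphism `(m, n) ↦ α m + β n + ℤ` from `ℤ²` to `ℝ/ℤ`. -/
def rotationHom (α β : ℝ) :
    Multiplicative (ℤ × ℤ) →ₜ* Multiplicative UnitAddCircle where
  toMonoidHom := AddMonoidHom.toMultiplicative
    { toFun := fun p : ℤ × ℤ => ((α * p.1 + β * p.2 : ℝ) : UnitAddCircle)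
      map_zero' := by simp
      map_add' := fun p q => by
        rw [← AddCircle.coe_add]
        congr 1
        push_cast [Prod.fst_add, Prod.snd_add]
        ring }
  continuous_toFun := continuous_of_discreteTopology

end CartanExamples

end

noncomputable section

namespace CartanExamples

open Filter Topology

set_option linter.unusedSectionVars false

/-! ### Haar integrals of compactly supported functions -/

section HaarIntegral

variable {G : Type*} [TopologicalSpace G] [Group G] [IsTopologicalGroup G] [LocallyCompactSpace G]
  {E : Type*} [NormedAddCommGroup E] [NormedSpace ℝ E]
  {F : Type*} [NormedAddCommGroup F] [NormedSpace ℝ F]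

/-! The Fourier isomorphism comes from reading a covariant representation symmetrically. A
nondegenerate representation of `C₀(H)` extends to the characters of `H`, viewed as multipliers, and
so amounts to a strongly continuous unitary representation V of Ĥ. In these terms covariance with U
is the Weyl relation V(χ)U(g) = χ(φ(g)) U(g)V(χ), which is symmetric in G and Ĥ up to an inverse.
The same pair (V, U) is therefore a covariant representation for φ̂ (`IsFourierData.transport`).
Fubini and the Weyl relation show that both integrated forms equal ∬ f(g, χ) V(χ)U(g)
(`IsFourierData.integratedForm_transport`). Since the universal representation runs over all
covariant representations, reindexing along this correspondence gives mutually inverse maps of the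
crossed products; it suffices to check them on partial Fourier transforms, whose images generate
(`crossedProductSubalgebra_le`).

The passage between representations of `C₀(X)` and unitary representations of K only needs a pairing
X → K^ which is injective, proper and norm-determining (`IsDualPairing`). Given that, k ↦ ∫ k(κ)U(κ)
dκ is bounded by the sup norm of the Fourier transform of k over X, by Gelfand theory in a
commutative C*-algebra (`norm_unitaryIntegral_le_of_forall_character`), and extends to `C₀(X)` by
density. For X = K^ the conditions are easy. For H paired with Ĥ they are the needed part of
Pontryagin duality, and follow from the regular representation on L²(H): translations separate
points, they tend weakly to zero at infinity, and the Weyl relation turns multiplication of k by a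
character of Ĥ into unitary conjugation. Surjectivity onto the double dual is never needed.

For G discrete, averaging the dual action of the compact group Ĝ extracts the coefficients of an
element of the crossed product. The coefficient at 1 is the conditional expectation, and it is
positive and faithful because it averages squared norms (`inner_rep_spectral`). If φ is injective, G
acts freely on H. Hence an element commuting with `C₀(H)` has no coefficient off 1
(`mem_coeffSubalgebra_of_commute`), and a state extending evaluation at h kills every a u_g with g ≠
1 (`IsState.apply_monomial_eq_zero`). As pure states of `C₀(H)` are evaluations, this gives
maximality and unique extension. The statements about `C₀(Ĝ)` are the same ones for φ̂, pulled back
along the isomorphism.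

In the example, rational independence makes φ injective with dense range. An algebra isomorphism
between C(𝕋) and C(𝕋²) would embed the torus in the circle, which the intermediate value theorem
forbids. -/

theorem haarIntegral_eq [MeasurableSpace G] [BorelSpace G] (f : G → E) :
    haarIntegral f = ∫ g, f g ∂(Measure.haar : Measure G) := by
  borelize G
  rfl

theorem haarIntegral_zero : haarIntegral (fun _ : G => (0 : E)) = 0 := by
  borelize G
  simp [haarIntegral_eq]

theorem haarIntegral_add {f f' : G → E} (hf : Continuous f) (hc : HasCompactSupport f)
    (hf' : Continuous f') (hc' : HasCompactSupport f') :
    haarIntegral (fun g => f g + f' g) = haarIntegral f + haarIntegral f' := by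
  borelize G
  simp only [haarIntegral_eq]
  exact integral_add (hf.integrable_of_hasCompactSupport hc)
    (hf'.integrable_of_hasCompactSupport hc')

theorem haarIntegral_sub {f f' : G → E} (hf : Continuous f) (hc : HasCompactSupport f)
    (hf' : Continuous f') (hc' : HasCompactSupport f') :
    haarIntegral (fun g => f g - f' g) = haarIntegral f - haarIntegral f' := by
  borelize G
  simp only [haarIntegral_eq]
  exact integral_sub (hf.integrable_of_hasCompactSupport hc)
    (hf'.integrable_of_hasCompactSupport hc')

theorem haarIntegral_smul {𝕜 : Type*} [NormedField 𝕜] [NormedSpace 𝕜 E] [SMulCommClass ℝ 𝕜 E]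
    (c : 𝕜) (f : G → E) : haarIntegral (fun g => c • f g) = c • haarIntegral f := by
  borelize G
  simp only [haarIntegral_eq]
  exact integral_smul c f

theorem haarIntegral_const_mul (c : ℂ) (f : G → ℂ) :
    haarIntegral (fun g => c * f g) = c * haarIntegral f :=
  haarIntegral_smul c f

theorem haarIntegral_mul_const (c : ℂ) (f : G → ℂ) :
    haarIntegral (fun g => f g * c) = haarIntegral f * c := by
  simp only [mul_comm _ c]
  exact haarIntegral_smul c f

theorem haarIntegral_real_mul_const (c : ℝ) (f : G → ℝ) :
    haarIntegral (fun g => f g * c) = haarIntegral f * c := by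
  simp only [mul_comm _ c]
  exact haarIntegral_smul c f

theorem haarIntegral_conj (f : G → ℂ) :
    haarIntegral (fun g => conj (f g)) = conj (haarIntegral f) := by
  borelize G
  simp only [haarIntegral_eq]
  exact integral_conj

theorem _root_.ContinuousLinearMap.haarIntegral_comp_comm {𝕜 : Type*} [RCLike 𝕜] [NormedSpace 𝕜 E]
    [NormedSpace 𝕜 F] [CompleteSpace E] [CompleteSpace F] (L : E →L[𝕜] F) {f : G → E}
    (hf : Continuous f) (hc : HasCompactSupport f) :
    haarIntegral (fun g => L (f g)) = L (haarIntegral f) := by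
  borelize G
  simp only [haarIntegral_eq]
  exact L.integral_comp_comm (hf.integrable_of_hasCompactSupport hc)

theorem haarIntegral_mul_left (f : G → E) (g : G) :
    haarIntegral (fun x => f (g * x)) = haarIntegral f := by
  borelize G
  simp only [haarIntegral_eq]
  exact integral_mul_left_eq_self f g

theorem norm_haarIntegral_le (f : G → E) :
    ‖haarIntegral f‖ ≤ haarIntegral fun g => ‖f g‖ := by
  borelize G
  simp only [haarIntegral_eq]
  exact norm_integral_le_integral_norm f

theorem haarIntegral_mono {f f' : G → ℝ} (hf : Continuous f) (hc : HasCompactSupport f)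
    (hf' : Continuous f') (hc' : HasCompactSupport f') (h : ∀ g, f g ≤ f' g) :
    haarIntegral f ≤ haarIntegral f' := by
  borelize G
  simp only [haarIntegral_eq]
  exact integral_mono (hf.integrable_of_hasCompactSupport hc)
    (hf'.integrable_of_hasCompactSupport hc') h

theorem haarIntegral_nonneg {f : G → ℝ} (h : ∀ g, 0 ≤ f g) : 0 ≤ haarIntegral f := by
  borelize G
  simp only [haarIntegral_eq]
  exact integral_nonneg h

theorem haarIntegral_ofReal (f : G → ℝ) :
    haarIntegral (fun g => (f g : ℂ)) = ((haarIntegral f : ℝ) : ℂ) := by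
  borelize G
  simp only [haarIntegral_eq]
  exact integral_ofReal

/-- A nonnegative continuous function of compact support with zero integral vanishes. -/
theorem eq_zero_of_haarIntegral_eq_zero {f : G → ℝ} (hf : Continuous f) (hc : HasCompactSupport f)
    (h : ∀ g, 0 ≤ f g) (h0 : haarIntegral f = 0) (g : G) : f g = 0 := by
  borelize G
  by_contra hg
  rw [haarIntegral_eq] at h0
  exact (hf.integral_pos_of_hasCompactSupport_nonneg_nonzero hc h hg).ne' h0

theorem haarIntegral_swap {G' : Type*} [TopologicalSpace G'] [Group G'] [IsTopologicalGroup G']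
    [LocallyCompactSpace G'] {f : G → G' → E} (hf : Continuous f.uncurry)
    (hc : HasCompactSupport f.uncurry) :
    haarIntegral (fun x => haarIntegral fun y => f x y) =
      haarIntegral fun y => haarIntegral fun x => f x y := by
  borelize G G'
  simp only [haarIntegral_eq]
  exact integral_integral_swap_of_hasCompactSupport hf hc

/-- Integrals depend continuously on a parameter, for integrands supported in a fixed compact. -/
theorem continuousOn_haarIntegral {X : Type*} [TopologicalSpace X] {f : X → G → E} {s : Set X}
    {k : Set G} (hk : IsCompact k) (hf : ContinuousOn f.uncurry (s ×ˢ Set.univ))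
    (h : ∀ p x, p ∈ s → x ∉ k → f p x = 0) : ContinuousOn (fun x => haarIntegral (f x)) s := by
  borelize G
  simp only [haarIntegral_eq]
  exact continuousOn_integral_of_compact_support hk hf h

/-- If `f p x` vanishes for `x` outside a compact set, locally uniformly in `p`, then its integral
depends continuously on `p`. -/
theorem continuous_haarIntegral {X : Type*} [TopologicalSpace X] {f : X → G → E}
    (hf : Continuous f.uncurry)
    (h : ∀ p, ∃ s ∈ 𝓝 p, ∃ k : Set G, IsCompact k ∧ ∀ q ∈ s, ∀ x ∉ k, f q x = 0) :
    Continuous fun x => haarIntegral (f x) := by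
  refine continuous_iff_continuousAt.2 fun p => ?_
  obtain ⟨s, hs, k, hk, h⟩ := h p
  exact (continuousOn_haarIntegral hk hf.continuousOn fun p x hp hx => h p hp x hx).continuousAt hs

end HaarIntegral

theorem haarIntegral_inv {G : Type*} [TopologicalSpace G] [CommGroup G] [IsTopologicalGroup G]
    [LocallyCompactSpace G] {E : Type*} [NormedAddCommGroup E] [NormedSpace ℝ E] (f : G → E) :
    haarIntegral (fun g => f g⁻¹) = haarIntegral f := by
  borelize G
  simp only [haarIntegral_eq]
  have : (Measure.haar : Measure G).IsInvInvariant :=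
    Measure.IsHaarMeasure.isInvInvariant_of_regular _
  exact integral_inv_eq_self f _

/-! ### Translations and the L¹ modulus of continuity -/

section Translation

variable {K : Type*} [TopologicalSpace K] [Group K] [IsTopologicalGroup K] [LocallyCompactSpace K]
  {E : Type*} [NormedAddCommGroup E] [NormedSpace ℝ E]

/-- Left translate of a compactly supported function. -/
def leftTranslate {E : Type*} [TopologicalSpace E] [Zero E] (g : K) (k : C_c(K, E)) : C_c(K, E) where
  toFun x := k (g⁻¹ * x)
  continuous_toFun := k.continuous.comp (continuous_const_mul g⁻¹)
  hasCompactSupport' := k.hasCompactSupport.comp_homeomorph (Homeomorph.mulLeft g⁻¹)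

@[simp]
theorem leftTranslate_apply {E : Type*} [TopologicalSpace E] [Zero E] (g : K) (k : C_c(K, E))
    (x : K) : leftTranslate g k x = k (g⁻¹ * x) := rfl

/-- The `L¹`-distance between a compactly supported function and its translate. -/
def translationModulus (k : C_c(K, E)) (g : K) : ℝ :=
  haarIntegral fun x => ‖k (g⁻¹ * x) - k x‖

-- For g in a compact neighbourhood s, the integrand is supported in the fixed compact set s · supp
-- k ∪ supp k, so continuity under the integral applies.
open scoped Pointwise in
theorem continuous_haarIntegral_translate
    (k : C_c(K, E)) {F : Type*} [NormedAddCommGroup F] [NormedSpace ℝ F] (f : K → K → F)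
    (hf : Continuous f.uncurry) (h : ∀ g x, k (g⁻¹ * x) = 0 → k x = 0 → f g x = 0) :
    Continuous fun g => haarIntegral (f g) := by
  refine continuous_haarIntegral hf fun g => ?_
  obtain ⟨s, hs, hsg⟩ := exists_compact_mem_nhds g
  refine ⟨s, hsg, (s * tsupport k) ∪ tsupport k,
    (hs.mul k.hasCompactSupport).union k.hasCompactSupport, fun q hq x hx => h q x ?_ ?_⟩
  · by_contra h0
    exact hx (Or.inl ⟨q, hq, q⁻¹ * x, subset_tsupport _ h0, by simp⟩)
  · by_contra h0
    exact hx (Or.inr (subset_tsupport _ h0))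

theorem continuous_translationModulus (k : C_c(K, E)) : Continuous (translationModulus k) := by
  refine continuous_haarIntegral_translate k (fun g x => ‖k (g⁻¹ * x) - k x‖) ?_ ?_
  · have := k.continuous
    simp only [Function.uncurry_def]
    fun_prop
  · intro g x h1 h2
    simp [h1, h2]

theorem translationModulus_one (k : C_c(K, E)) : translationModulus k 1 = 0 := by
  simp [translationModulus, haarIntegral_zero]

end Translation

/-! ### The algebra `C₀(X)` and Stone–Weierstrass -/

section ZeroAtInfinity

variable {X : Type*} [TopologicalSpace X]

theorem norm_le_iff {C : ℝ} (hC : 0 ≤ C) (a : C₀(X, ℂ)) : ‖a‖ ≤ C ↔ ∀ x, ‖a x‖ ≤ C := by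
  rw [← ZeroAtInftyContinuousMap.norm_toBCF_eq_norm, BoundedContinuousFunction.norm_le hC]
  rfl

theorem norm_apply_le (a : C₀(X, ℂ)) (x : X) : ‖a x‖ ≤ ‖a‖ :=
  (norm_le_iff (norm_nonneg a) a).1 le_rfl x

theorem tendsto_cocompact_zero_iff {f : X → ℂ} :
    Tendsto f (cocompact X) (𝓝 0) ↔ ∀ ε > 0, ∃ k : Set X, IsCompact k ∧ ∀ x ∉ k, ‖f x‖ < ε := by
  rw [Metric.tendsto_nhds]
  refine forall₂_congr fun ε _ => ?_
  rw [Filter.Eventually, mem_cocompact]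
  simp only [Set.subset_def, dist_zero_right, Set.mem_compl_iff, Set.mem_ofPred_eq]

/-- Evaluation at a point, as a continuous linear functional on `C₀(X)`. -/
def evalCLM (x : X) : C₀(X, ℂ) →L[ℂ] ℂ :=
  LinearMap.mkContinuous
    { toFun := fun a => a x, map_add' := fun _ _ => rfl, map_smul' := fun _ _ => rfl } 1
    fun a => by simpa using norm_apply_le a x

@[simp]
theorem evalCLM_apply (x : X) (a : C₀(X, ℂ)) : evalCLM x a = a x := rfl

/-- A compactly supported function as a function vanishing at infinity. -/
def zeroAtInftyOfCompact (f : X → ℂ) (hf : Continuous f) (hc : HasCompactSupport f) :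
    C₀(X, ℂ) where
  toFun := f
  continuous_toFun := hf
  zero_at_infty' := hc.is_zero_at_infty

@[simp]
theorem zeroAtInftyOfCompact_apply (f : X → ℂ) (hf : Continuous f) (hc : HasCompactSupport f)
    (x : X) : zeroAtInftyOfCompact f hf hc x = f x := rfl

theorem exists_bump [T2Space X] [LocallyCompactSpace X] (x : X) {s : Set X} (hs : s ∈ 𝓝 x) :
    ∃ f : X → ℝ, Continuous f ∧ HasCompactSupport f ∧ f x = 1 ∧ (∀ y, 0 ≤ f y) ∧ (∀ y, f y ≤ 1) ∧
      ∀ y ∉ s, f y = 0 := by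
  obtain ⟨f, h1, h2, h3, h4⟩ := exists_continuous_one_zero_of_isCompact (X := X)
    (isCompact_singleton (x := x)) (isClosed_compl_iff.2 (isOpen_interior (s := s)))
    (by
      rw [Set.disjoint_singleton_left, Set.mem_compl_iff, not_not]
      exact mem_interior_iff_mem_nhds.2 hs)
  exact ⟨f, f.continuous, h3, h1 rfl, fun y => (h4 y).1, fun y => (h4 y).2,
    fun y hy => h2 fun h => hy (interior_subset h)⟩

/-- The spectral order is used only inside the proof: writing positivity as `star c * c` keeps any
order on `A` out of the statement. -/
theorem exists_approximateUnit (A : Type*) [NonUnitalCStarAlgebra A] :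
    ∃ l : Filter A, l.IsApproximateUnit ∧ ∀ᶠ e in l, ‖e‖ ≤ 1 ∧ ∃ c : A, e = star c * c := by
  let _ := CStarAlgebra.spectralOrder A
  have := CStarAlgebra.spectralOrderedRing A
  refine ⟨CStarAlgebra.approximateUnit A,
    (CStarAlgebra.increasingApproximateUnit A).toIsApproximateUnit, ?_⟩
  filter_upwards [(CStarAlgebra.increasingApproximateUnit A).eventually_norm,
    (CStarAlgebra.increasingApproximateUnit A).eventually_nonneg] with e h1 h2
  exact ⟨h1, CStarAlgebra.nonneg_iff_eq_star_mul_self.1 h2⟩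

/-- The restriction to `X` of `F - F ∞`, for `F` continuous on the one-point compactification. -/
def onePointRestrict (F : C(OnePoint X, ℂ)) : C₀(X, ℂ) where
  toFun x := F x - F OnePoint.infty
  continuous_toFun := (F.continuous.comp OnePoint.continuous_coe).sub continuous_const
  zero_at_infty' := by
    have h1 : Tendsto (fun x : X => (x : OnePoint X)) (cocompact X) (𝓝 OnePoint.infty) :=
      (OnePoint.tendsto_coe_infty (X := X)).mono_left cocompact_le_coclosedCompact
    have h2 := (F.continuous.tendsto OnePoint.infty).comp h1
    simpa using h2.sub_const (F OnePoint.infty)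

/-- The extension to the one-point compactification of a function vanishing at infinity. -/
def onePointExtend [T2Space X] (a : C₀(X, ℂ)) : C(OnePoint X, ℂ) :=
  OnePoint.continuousMapMk a.toContinuousMap 0 (by
    rw [coclosedCompact_eq_cocompact]
    exact a.zero_at_infty')

theorem onePointRestrict_extend [T2Space X] (a : C₀(X, ℂ)) :
    onePointRestrict (onePointExtend a) = a := by
  ext x
  change a x - 0 = a x
  simp

theorem continuous_onePointRestrict : Continuous (onePointRestrict (X := X)) := by
  refine Metric.continuous_iff.2 fun F ε hε => ⟨ε / 3, by positivity, fun F' h => ?_⟩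
  rw [dist_eq_norm]
  refine lt_of_le_of_lt ((norm_le_iff (C := 2 * (ε / 3)) (by positivity) _).2 fun x => ?_)
    (by linarith)
  have h1 : ∀ y, ‖F' y - F y‖ ≤ ε / 3 := fun y => by
    rw [← dist_eq_norm]
    exact (ContinuousMap.dist_apply_le_dist y).trans h.le
  calc ‖(F' x - F' OnePoint.infty) - (F x - F OnePoint.infty)‖
      = ‖(F' x - F x) - (F' OnePoint.infty - F OnePoint.infty)‖ := by congr 1; ring
    _ ≤ ‖F' x - F x‖ + ‖F' OnePoint.infty - F OnePoint.infty‖ := norm_sub_le _ _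
    _ ≤ 2 * (ε / 3) := by linarith [h1 x, h1 OnePoint.infty]

/-- The Stone-Weierstrass theorem for `C₀(X)`. -/
theorem eq_top_of_separatesPoints [T2Space X] [LocallyCompactSpace X]
    (D : NonUnitalStarSubalgebra ℂ C₀(X, ℂ)) (hD : IsClosed (D : Set C₀(X, ℂ)))
    (h0 : ∀ x, ∃ a ∈ D, a x ≠ 0) (hs : ∀ x y, x ≠ y → ∃ a ∈ D, a x ≠ a y) (a : C₀(X, ℂ)) :
    a ∈ D := by
  -- The functions on the one-point compactification which lie in `D` up to a constant form a unital
  -- algebra. It separates ∞ from finite points by `h0`, and finite points from each other by `hs`,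
  -- so the compact theorem applies.
  let A : StarSubalgebra ℂ C(OnePoint X, ℂ) :=
    { carrier := {F | onePointRestrict F ∈ D}
      mul_mem' := fun {F F'} hF hF' => by
        have : onePointRestrict (F * F') = onePointRestrict F * onePointRestrict F' +
            F OnePoint.infty • onePointRestrict F' + F' OnePoint.infty • onePointRestrict F := by
          ext x
          simp only [onePointRestrict, ZeroAtInftyContinuousMap.coe_mk, ContinuousMap.mul_apply,
            ZeroAtInftyContinuousMap.add_apply, ZeroAtInftyContinuousMap.mul_apply,
            ZeroAtInftyContinuousMap.smul_apply, smul_eq_mul]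
          ring
        rw [Set.mem_ofPred_eq, this]
        exact add_mem (add_mem (mul_mem hF hF') (SMulMemClass.smul_mem _ hF'))
          (SMulMemClass.smul_mem _ hF)
      add_mem' := fun {F F'} hF hF' => by
        have : onePointRestrict (F + F') = onePointRestrict F + onePointRestrict F' := by
          ext x
          simp only [onePointRestrict, ZeroAtInftyContinuousMap.coe_mk, ContinuousMap.add_apply,
            ZeroAtInftyContinuousMap.add_apply]
          ring
        rw [Set.mem_ofPred_eq, this]
        exact add_mem hF hF'
      algebraMap_mem' := fun c => by
        have : onePointRestrict (algebraMap ℂ C(OnePoint X, ℂ) c) = 0 := by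
          ext x
          simp [onePointRestrict]
        rw [Set.mem_ofPred_eq, this]
        exact zero_mem D
      star_mem' := fun {F} hF => by
        have : onePointRestrict (star F) = star (onePointRestrict F) := by
          ext x
          simp [onePointRestrict]
        rw [Set.mem_ofPred_eq, this]
        exact star_mem hF }
  have hext : ∀ b ∈ D, onePointExtend b ∈ A := fun b hb => by
    change onePointRestrict (onePointExtend b) ∈ D
    rwa [onePointRestrict_extend]
  have hA : A.topologicalClosure = ⊤ := by
    refine ContinuousMap.starSubalgebra_topologicalClosure_eq_top_of_separatesPoints A ?_
    intro x y hxy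
    induction x using OnePoint.rec with
    | infty =>
      induction y using OnePoint.rec with
      | infty => exact absurd rfl hxy
      | coe y =>
        obtain ⟨b, hb, hby⟩ := h0 y
        exact ⟨_, ⟨_, hext b hb, rfl⟩, fun h => hby h.symm⟩
    | coe x =>
      induction y using OnePoint.rec with
      | infty =>
        obtain ⟨b, hb, hby⟩ := h0 x
        exact ⟨_, ⟨_, hext b hb, rfl⟩, fun h => hby h⟩
      | coe y =>
        obtain ⟨b, hb, hby⟩ := hs x y fun h => hxy (congrArg _ h)
        exact ⟨_, ⟨_, hext b hb, rfl⟩, fun h => hby h⟩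
  have hcl : IsClosed (A : Set C(OnePoint X, ℂ)) := hD.preimage continuous_onePointRestrict
  have : onePointExtend a ∈ A := by
    have h : onePointExtend a ∈ A.topologicalClosure := hA ▸ StarSubalgebra.mem_top
    exact hcl.closure_subset h
  change onePointRestrict (onePointExtend a) ∈ D at this
  rwa [onePointRestrict_extend] at this

end ZeroAtInfinity

theorem continuous_circle_coe : Continuous fun z : Circle => (z : ℂ) := continuous_subtype_val

/-! ### Characters as multipliers of `C₀(X)` -/

section Characters

variable {X : Type*} [TopologicalSpace X] [Group X] [IsTopologicalGroup X]

/-- The product of a character and a function vanishing at infinity. -/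
def charMul (θ : PontryaginDual X) (a : C₀(X, ℂ)) : C₀(X, ℂ) where
  toFun x := (θ x : ℂ) * a x
  continuous_toFun := (continuous_circle_coe.comp (map_continuous θ)).mul a.continuous
  zero_at_infty' := by
    have := a.zero_at_infty'
    rw [tendsto_zero_iff_norm_tendsto_zero] at this ⊢
    simpa [Circle.norm_coe] using this

@[simp]
theorem charMul_apply (θ : PontryaginDual X) (a : C₀(X, ℂ)) (x : X) :
    charMul θ a x = (θ x : ℂ) * a x := rfl

theorem charMul_add (θ : PontryaginDual X) (a b : C₀(X, ℂ)) :
    charMul θ (a + b) = charMul θ a + charMul θ b := by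
  ext x; simp [mul_add]

theorem charMul_smul (θ : PontryaginDual X) (c : ℂ) (a : C₀(X, ℂ)) :
    charMul θ (c • a) = c • charMul θ a := by
  ext x; simp; ring

theorem dual_mul_apply (θ θ' : PontryaginDual X) (x : X) : (θ * θ') x = θ x * θ' x := rfl

theorem dual_inv_apply (θ : PontryaginDual X) (x : X) : θ⁻¹ x = (θ x)⁻¹ := rfl

theorem charMul_one (a : C₀(X, ℂ)) : charMul 1 a = a := by
  ext x; simp

theorem charMul_charMul (θ θ' : PontryaginDual X) (a : C₀(X, ℂ)) :
    charMul θ (charMul θ' a) = charMul (θ * θ') a := by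
  ext x; simp [dual_mul_apply, mul_assoc]

theorem charMul_mul (θ : PontryaginDual X) (a b : C₀(X, ℂ)) :
    charMul θ a * b = charMul θ (a * b) := by
  ext x; simp [mul_assoc]

theorem norm_charMul (θ : PontryaginDual X) (a : C₀(X, ℂ)) : ‖charMul θ a‖ = ‖a‖ := by
  apply le_antisymm <;> refine (norm_le_iff (norm_nonneg _) _).2 fun x => ?_
  · simpa [Circle.norm_coe] using norm_apply_le a x
  · simpa [Circle.norm_coe] using norm_apply_le (charMul θ a) x

theorem continuous_charMul_right (θ : PontryaginDual X) :
    Continuous fun a : C₀(X, ℂ) => charMul θ a :=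
  (LinearMap.mkContinuous (𝕜 := ℂ) (σ := RingHom.id ℂ)
    { toFun := fun a : C₀(X, ℂ) => charMul θ a
      map_add' := charMul_add θ
      map_smul' := charMul_smul θ } 1 fun a => by
    rw [one_mul]
    exact (norm_charMul θ a).le).continuous

theorem continuous_dual_eval [LocallyCompactSpace X] :
    Continuous fun p : PontryaginDual X × X => p.1 p.2 := by
  have h : Continuous fun θ : PontryaginDual X => (ContinuousMonoidHom.toContinuousMap θ) :=
    (ContinuousMonoidHom.isInducing_toContinuousMap X Circle).continuous
  have h' : Continuous fun p : C(X, Circle) × X => p.1 p.2 := continuous_eval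
  exact h'.comp ((h.comp continuous_fst).prodMk continuous_snd)

/-- Convergence in the dual is uniform on compact sets, and off a compact set `a` is small while two
characters differ by at most 2; hence the tolerance ε/4 there. -/
theorem continuous_charMul [LocallyCompactSpace X] (a : C₀(X, ℂ)) :
    Continuous fun θ : PontryaginDual X => charMul θ a := by
  refine continuous_iff_continuousAt.2 fun θ₀ => Metric.tendsto_nhds.2 fun ε hε => ?_
  obtain ⟨k, hk, hka⟩ := tendsto_cocompact_zero_iff.1 a.zero_at_infty' (ε / 4) (by positivity)
  have hopen : ∀ᶠ θ : PontryaginDual X in 𝓝 θ₀,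
      ∀ x ∈ k, ‖((θ x : ℂ) - θ₀ x) * a x‖ < ε / 2 := by
    refine hk.eventually_forall_of_forall_eventually fun x hx => ?_
    have hc : Continuous fun p : PontryaginDual X × X =>
        ‖((p.1 p.2 : ℂ) - θ₀ p.2) * a p.2‖ :=
      (((continuous_circle_coe.comp continuous_dual_eval).sub
        (continuous_circle_coe.comp ((map_continuous θ₀).comp continuous_snd))).mul
        (a.continuous.comp continuous_snd)).norm
    have := hc.tendsto (θ₀, x)
    rw [sub_self, zero_mul, norm_zero] at this
    exact this.eventually (gt_mem_nhds (by positivity))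
  filter_upwards [hopen] with θ hθ
  rw [dist_eq_norm]
  refine lt_of_le_of_lt ((norm_le_iff (C := ε / 2) (by positivity) _).2 fun x => ?_) (by linarith)
  have he : (charMul θ a - charMul θ₀ a) x = ((θ x : ℂ) - θ₀ x) * a x := by simp [sub_mul]
  rw [he]
  by_cases hx : x ∈ k
  · exact (hθ x hx).le
  · have h1 : ‖(θ x : ℂ) - θ₀ x‖ ≤ 2 := (norm_sub_le _ _).trans (by norm_num [Circle.norm_coe])
    have h2 : ‖a x‖ < ε / 4 := hka x hx
    rw [norm_mul]
    nlinarith [norm_nonneg (a x)]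

end Characters

section Translate

variable {H : Type v} [TopologicalSpace H] [CommGroup H] [IsTopologicalGroup H]
  [LocallyCompactSpace H] [T2Space H]

@[simp]
theorem translate_apply (x : H) (a : C₀(H, ℂ)) (h : H) : translate x a h = a (x⁻¹ * h) := rfl

theorem translate_charMul (x : H) (θ : PontryaginDual H) (a : C₀(H, ℂ)) :
    translate x (charMul θ a) = conj (θ x : ℂ) • charMul θ (translate x a) := by
  ext h
  simp [map_mul, ← Circle.coe_inv_eq_conj, mul_assoc]

end Translate

/-! ### Extending representations of `C₀(X)` to characters -/

section Multiplier

variable {X : Type*} [TopologicalSpace X] [CommGroup X] [IsTopologicalGroup X]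
  [LocallyCompactSpace X]
  {E : Type*} [NormedAddCommGroup E] [InnerProductSpace ℂ E] [CompleteSpace E]

/-- A representation of `C₀(X)` is nondegenerate if its range generates a dense subspace. -/
def Nondegenerate {X : Type*} [TopologicalSpace X] (π : C₀(X, ℂ) →⋆ₙₐ[ℂ] (E →L[ℂ] E)) : Prop :=
  (Submodule.span ℂ {y : E | ∃ (a : C₀(X, ℂ)) (x : E), y = π a x}).topologicalClosure = ⊤

variable (π : C₀(X, ℂ) →⋆ₙₐ[ℂ] (E →L[ℂ] E))

theorem norm_rep_le {X : Type*} [TopologicalSpace X] (π : C₀(X, ℂ) →⋆ₙₐ[ℂ] (E →L[ℂ] E))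
    (a : C₀(X, ℂ)) : ‖π a‖ ≤ ‖a‖ :=
  NonUnitalStarAlgHom.norm_apply_le π a

/-- A representation of `C₀(X)` as a continuous linear map. -/
def repCLM {X : Type*} [TopologicalSpace X] (π : C₀(X, ℂ) →⋆ₙₐ[ℂ] (E →L[ℂ] E)) :
    C₀(X, ℂ) →L[ℂ] (E →L[ℂ] E) :=
  LinearMap.mkContinuous (π : C₀(X, ℂ) →ₗ[ℂ] (E →L[ℂ] E)) 1 (by simpa using norm_rep_le π)

@[simp]
theorem repCLM_apply {X : Type*} [TopologicalSpace X] (π : C₀(X, ℂ) →⋆ₙₐ[ℂ] (E →L[ℂ] E))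
    (a : C₀(X, ℂ)) : repCLM π a = π a := rfl

/-- Formal sums of the vectors `π(a) x`. -/
def spanMap (θ : PontryaginDual X) : (C₀(X, ℂ) × E →₀ ℂ) →ₗ[ℂ] E :=
  Finsupp.linearCombination ℂ fun p : C₀(X, ℂ) × E => π (charMul θ p.1) p.2

@[simp]
theorem spanMap_single (θ : PontryaginDual X) (p : C₀(X, ℂ) × E) (c : ℂ) :
    spanMap π θ (Finsupp.single p c) = c • π (charMul θ p.1) p.2 := by
  simp [spanMap]

variable {π}

theorem Nondegenerate.denseRange_spanMap (hπ : Nondegenerate π) : DenseRange (spanMap π 1) := by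
  have h : Set.range (fun p : C₀(X, ℂ) × E => π (charMul 1 p.1) p.2) =
      {y : E | ∃ (a : C₀(X, ℂ)) (x : E), y = π a x} := by
    ext y
    simp [charMul_one, eq_comm]
  have h2 : Set.range (spanMap π 1) =
      (Submodule.span ℂ {y : E | ∃ (a : C₀(X, ℂ)) (x : E), y = π a x} : Set E) := by
    rw [← h, ← Finsupp.range_linearCombination]
    rfl
  rw [DenseRange, h2]
  exact Submodule.dense_iff_topologicalClosure_eq_top.2 hπ

theorem Nondegenerate.ext (hπ : Nondegenerate π) {S T : E →L[ℂ] E}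
    (h : ∀ a, S * π a = T * π a) : S = T := by
  have : Set.EqOn S T (closure (Submodule.span ℂ {y : E | ∃ (a : C₀(X, ℂ)) (x : E), y = π a x})) := by
    refine Set.EqOn.closure (fun x hx => ?_) S.continuous T.continuous
    induction hx using Submodule.span_induction with
    | mem x hx =>
      obtain ⟨a, y, rfl⟩ := hx
      exact DFunLike.congr_fun (h a) y
    | zero => simp
    | add x y _ _ hx hy => simp [hx, hy]
    | smul c x _ hx => simp [hx]
  ext x
  refine this ?_
  rw [← Submodule.topologicalClosure_coe]
  rw [Nondegenerate] at hπ
  rw [hπ]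
  trivial

/-- For an approximate unit e, the character can be moved onto e, so the vector for θ is the limit
of π(θe) applied to the vector for the trivial character, and ‖θe‖ ≤ 1. This makes the multiplier
well defined and contractive, without choosing representatives of vectors in the span. -/
theorem norm_spanMap_le (θ : PontryaginDual X) (w : C₀(X, ℂ) × E →₀ ℂ) :
    ‖spanMap π θ w‖ ≤ 1 * ‖spanMap π 1 w‖ := by
  obtain ⟨l, hl, hle⟩ := exists_approximateUnit C₀(X, ℂ)
  have := hl.neBot
  have key : Tendsto (fun e => π (charMul θ e) (spanMap π 1 w)) l (𝓝 (spanMap π θ w)) := by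
    induction w using Finsupp.induction_linear with
    | zero => simp
    | add w w' h h' => simpa only [map_add] using h.add h'
    | single p c =>
      simp only [spanMap_single, map_smul, charMul_one]
      refine Tendsto.const_smul ?_ c
      have h1 : Tendsto (fun e => charMul θ p.1 * e) l (𝓝 (charMul θ p.1)) :=
        hl.tendsto_mul_left _
      have h2 : Continuous fun a => π a p.2 := (repCLM π).continuous.clm_apply continuous_const
      refine ((h2.tendsto _).comp h1).congr fun e => ?_
      simp only [Function.comp]
      rw [charMul_mul, mul_comm, ← charMul_mul, map_mul]
      rfl
  refine le_of_tendsto key.norm ?_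
  filter_upwards [hle] with e he
  refine ((π (charMul θ e)).le_opNorm _).trans ?_
  gcongr
  exact (norm_rep_le π _).trans ((norm_charMul θ e).trans_le he.1)

variable (π)

/-- The extension of a nondegenerate representation of `C₀(X)` to the multiplier `θ`. -/
def multiplier (θ : PontryaginDual X) : E →L[ℂ] E :=
  (spanMap π θ).extendOfNorm (spanMap π 1)

variable {π} (hπ : Nondegenerate π)

include hπ

theorem multiplier_mul (θ : PontryaginDual X) (a : C₀(X, ℂ)) :
    multiplier π θ * π a = π (charMul θ a) := by
  ext x
  have := LinearMap.extendOfNorm_eq (f := spanMap π θ) hπ.denseRange_spanMap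
    ⟨1, norm_spanMap_le θ⟩ (Finsupp.single (a, x) 1)
  simpa [charMul_one, multiplier] using this

theorem multiplier_one : multiplier π 1 = 1 :=
  hπ.ext fun a => by rw [multiplier_mul hπ, charMul_one, one_mul]

theorem multiplier_mul_multiplier (θ θ' : PontryaginDual X) :
    multiplier π (θ * θ') = multiplier π θ * multiplier π θ' :=
  hπ.ext fun a => by
    rw [multiplier_mul hπ, mul_assoc, multiplier_mul hπ, multiplier_mul hπ, charMul_charMul]

theorem norm_multiplier_apply_le (θ : PontryaginDual X) (x : E) : ‖multiplier π θ x‖ ≤ ‖x‖ := by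
  simpa [multiplier] using LinearMap.norm_extendOfNorm_apply_le hπ.denseRange_spanMap 1
    (norm_spanMap_le (π := π) θ) x

/-- The multipliers of θ and θ⁻¹ are mutually inverse contractions, so each is a surjective
isometry. -/
theorem multiplier_mem_unitary (θ : PontryaginDual X) :
    multiplier π θ ∈ unitary (E →L[ℂ] E) := by
  have h1 : multiplier π θ⁻¹ * multiplier π θ = 1 := by
    rw [← multiplier_mul_multiplier hπ, inv_mul_cancel, multiplier_one hπ]
  have h2 : multiplier π θ * multiplier π θ⁻¹ = 1 := by
    rw [← multiplier_mul_multiplier hπ, mul_inv_cancel, multiplier_one hπ]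
  have hn : ∀ x, ‖multiplier π θ x‖ = ‖x‖ := fun x => by
    refine le_antisymm (norm_multiplier_apply_le hπ θ x) ?_
    calc ‖x‖ = ‖multiplier π θ⁻¹ (multiplier π θ x)‖ := by
          rw [← mul_apply_eq_comp, h1]; rfl
      _ ≤ _ := norm_multiplier_apply_le hπ _ _
  have h3 : star (multiplier π θ) * multiplier π θ = 1 := by
    rw [ContinuousLinearMap.star_eq_adjoint]
    exact (ContinuousLinearMap.norm_map_iff_adjoint_comp_self _).1 hn
  refine Unitary.mem_iff.2 ⟨h3, ?_⟩
  have : star (multiplier π θ) = multiplier π θ⁻¹ := by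
    rw [← mul_one (star _), ← h2, ← mul_assoc, h3, one_mul]
  rw [this, h2]

/-- The unitary representation of the dual group of `X` given by a nondegenerate representation
of `C₀(X)`. -/
def multiplierRep : PontryaginDual X →* unitary (E →L[ℂ] E) where
  toFun θ := ⟨multiplier π θ, multiplier_mem_unitary hπ θ⟩
  map_one' := Subtype.ext (multiplier_one hπ)
  map_mul' θ θ' := Subtype.ext (multiplier_mul_multiplier hπ θ θ')

@[simp]
theorem coe_multiplierRep (θ : PontryaginDual X) :
    (multiplierRep hπ θ : E →L[ℂ] E) = multiplier π θ := rfl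

/-- On vectors π(a)y this is the norm continuity of θ ↦ θa; these span a dense subspace, and the
multipliers are uniformly contractive. -/
theorem continuous_multiplier (x : E) : Continuous fun θ => multiplier π θ x := by
  have hd : Dense (Set.range (spanMap π 1)) := hπ.denseRange_spanMap
  refine continuous_iff_continuousAt.2 fun θ₀ => Metric.tendsto_nhds.2 fun ε hε => ?_
  obtain ⟨_, hw, ⟨w, rfl⟩⟩ := Metric.dense_iff.1 hd x (ε / 3) (by positivity)
  have hcont : ∀ w, Continuous fun θ => multiplier π θ (spanMap π 1 w) := fun w => by
    induction w using Finsupp.induction_linear with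
    | zero => simpa using continuous_const
    | add w w' h h' =>
      simp only [map_add]
      exact h.add h'
    | single p c =>
      simp only [spanMap_single, map_smul, charMul_one]
      refine Continuous.const_smul ?_ c
      have h : ∀ θ, multiplier π θ (π p.1 p.2) = repCLM π (charMul θ p.1) p.2 := fun θ => by
        rw [repCLM_apply, ← multiplier_mul hπ]; rfl
      simp only [h]
      exact ((repCLM π).continuous.comp (continuous_charMul p.1)).clm_apply continuous_const
  filter_upwards [Metric.tendsto_nhds.1 ((hcont w).tendsto θ₀) (ε / 3) (by positivity)] with θ hθ
  have hm : ∀ θ, dist (multiplier π θ x) (multiplier π θ (spanMap π 1 w)) < ε / 3 := fun θ => by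
    rw [dist_eq_norm, ← map_sub]
    refine (norm_multiplier_apply_le hπ θ _).trans_lt ?_
    rwa [← dist_eq_norm, dist_comm, ← Metric.mem_ball]
  have h1 := hm θ
  have h2 := hm θ₀
  rw [dist_comm] at h2
  calc _ ≤ _ + _ + _ := dist_triangle4 _ (multiplier π θ (spanMap π 1 w))
        (multiplier π θ₀ (spanMap π 1 w)) _
    _ < ε := by linarith

end Multiplier

/-! ### Compact sets of characters -/

section CompactSets

/-- A closed equicontinuous set of characters is compact. -/
theorem isCompact_setOf_norm_sub_one_le {K : Type*} [TopologicalSpace K] [Group K]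
    [IsTopologicalGroup K] {ω : K → ℝ} (hω : Tendsto ω (𝓝 1) (𝓝 0)) :
    IsCompact {ψ : PontryaginDual K | ∀ κ, ‖(ψ κ : ℂ) - 1‖ ≤ ω κ} := by
  have hcirc : ∀ z w : Circle, dist z w = ‖(z : ℂ) - w‖ := fun z w => dist_eq_norm (z : ℂ) w
  let S1 : Set (K →* Circle) := {f | ∀ κ, ‖(f κ : ℂ) - 1‖ ≤ ω κ}
  have heq : Equicontinuous ((↑) : S1 → K → Circle) := by
    have h1 : EquicontinuousAt (fun f : S1 => ((f : K →* Circle) : K → Circle)) 1 := by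
      refine Metric.equicontinuousAt_iff_right.2 fun ε hε => ?_
      filter_upwards [hω.eventually (gt_mem_nhds hε)] with κ hκ f
      rw [hcirc, map_one, norm_sub_rev]
      exact (f.2 κ).trans_lt hκ
    exact equicontinuous_of_equicontinuousAt_one _ h1
  let S3 : Set C(K, Circle) :=
    ContinuousMonoidHom.toContinuousMap '' {ψ : K →ₜ* Circle | ∀ κ, ‖(ψ κ : ℂ) - 1‖ ≤ ω κ}
  let S4 : Set (K → Circle) := ContinuousMap.toFun '' S3
  -- Equicontinuity makes abstract homomorphisms with this modulus continuous. Hence the set is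
  -- already described by pointwise conditions, is closed in the product `K → Circle`, and is
  -- compact by Ascoli.
  have hS4 : S4 = (↑) '' S1 := by
    ext f
    constructor
    · rintro ⟨_, ⟨ψ, hψ, rfl⟩, rfl⟩
      exact ⟨ψ, hψ, rfl⟩
    · rintro ⟨ψ, hψ, rfl⟩
      exact ⟨⟨ψ, heq.continuous ⟨ψ, hψ⟩⟩, ⟨⟨ψ, heq.continuous ⟨ψ, hψ⟩⟩, hψ, rfl⟩, rfl⟩
  have heq3 : Equicontinuous ((↑) : S3 → K → Circle) := by
    rw [equicontinuous_iff_range, ← Set.image_eq_range] at heq ⊢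
    rw [← hS4] at heq
    exact heq
  have hcl : IsClosed S4 := by
    have : S4 = {f | ∀ κ, ‖(f κ : ℂ) - 1‖ ≤ ω κ} ∩ Set.range ((↑) : (K →* Circle) → (K → Circle)) := by
      rw [hS4]
      ext f
      exact ⟨fun ⟨g, hg, hf⟩ => hf ▸ ⟨hg, g, rfl⟩, fun ⟨hg, g, hf⟩ => ⟨g, by subst hf; exact hg, hf⟩⟩
    rw [this]
    refine IsClosed.inter ?_ (MonoidHom.isClosed_range_coe K Circle)
    simp only [Set.ofPred_forall]
    refine isClosed_iInter fun κ => isClosed_le ?_ continuous_const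
    exact ((continuous_circle_coe.comp (continuous_apply κ)).sub continuous_const).norm
  exact (ContinuousMonoidHom.isInducing_toContinuousMap K Circle).isCompact_iff.2
    (ArzelaAscoli.isCompact_of_equicontinuous S3 hcl.isCompact heq3)

end CompactSets

/-- The closed subspace is itself a Banach space, so the integral can be formed there and then
included. -/
theorem haarIntegral_mem {G : Type*} [TopologicalSpace G] [Group G] [IsTopologicalGroup G]
    [LocallyCompactSpace G] {E : Type*} [NormedAddCommGroup E] [NormedSpace ℂ E] [CompleteSpace E]
    (S : Submodule ℂ E) (hS : IsClosed (S : Set E)) {f : G → E} (hf : Continuous f)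
    (hc : HasCompactSupport f) (h : ∀ g, f g ∈ S) : haarIntegral f ∈ S := by
  have : CompleteSpace S := hS.completeSpace_coe
  have h1 : Continuous fun g => (⟨f g, h g⟩ : S) := hf.subtype_mk h
  have h2 : HasCompactSupport fun g => (⟨f g, h g⟩ : S) :=
    hc.mono fun g hg h0 => hg (Subtype.ext h0)
  have := S.subtypeL.haarIntegral_comp_comm h1 h2
  exact this ▸ (haarIntegral fun g => (⟨f g, h g⟩ : S)).2

/-! ### Integrated forms of unitary representations -/

section UnitaryIntegral

variable {K : Type*} [TopologicalSpace K] [CommGroup K] [IsTopologicalGroup K]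
  [LocallyCompactSpace K]
  {E : Type*} [NormedAddCommGroup E] [InnerProductSpace ℂ E] [CompleteSpace E]

theorem hasCompactSupport_smul {F : Type*} [NormedAddCommGroup F] [NormedSpace ℂ F]
    (k : C_c(K, ℂ)) (f : K → F) : HasCompactSupport fun κ => k κ • f κ :=
  k.hasCompactSupport.smul_right

theorem continuous_smul_fun {F : Type*} [NormedAddCommGroup F] [NormedSpace ℂ F]
    (k : C_c(K, ℂ)) {f : K → F} (hf : Continuous f) : Continuous fun κ => k κ • f κ :=
  k.continuous.smul hf

variable {U : K →* unitary (E →L[ℂ] E)} (hU : ∀ x : E, Continuous fun κ => (U κ : E →L[ℂ] E) x)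

theorem norm_unitary_apply (u : unitary (E →L[ℂ] E)) (x : E) : ‖(u : E →L[ℂ] E) x‖ = ‖x‖ :=
  Unitary.norm_map u x

include hU in
theorem continuous_smul_unitary (k : C_c(K, ℂ)) (x : E) :
    Continuous fun κ => k κ • (U κ : E →L[ℂ] E) x :=
  k.continuous.smul (hU x)

theorem norm_unitaryIntegral_apply_le (k : C_c(K, ℂ)) (x : E) :
    ‖haarIntegral fun κ => k κ • (U κ : E →L[ℂ] E) x‖ ≤ (haarIntegral fun κ => ‖k κ‖) * ‖x‖ := by
  refine (norm_haarIntegral_le _).trans_eq ?_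
  simp only [norm_smul, norm_unitary_apply]
  exact haarIntegral_real_mul_const _ _

/-- The operator `∫ k(κ) U(κ) dκ`, for a unitary representation `U` and `k ∈ C_c(K)`. -/
def unitaryIntegral (k : C_c(K, ℂ)) : E →L[ℂ] E :=
  LinearMap.mkContinuous
    { toFun := fun x => haarIntegral fun κ => k κ • (U κ : E →L[ℂ] E) x
      map_add' := fun x y => by
        simp only [map_add, smul_add]
        exact haarIntegral_add (continuous_smul_unitary hU k x) (hasCompactSupport_smul k _)
          (continuous_smul_unitary hU k y) (hasCompactSupport_smul k _)
      map_smul' := fun c x => by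
        simp only [map_smul, smul_comm _ c, RingHom.id_apply]
        exact haarIntegral_smul c _ }
    (haarIntegral fun κ => ‖k κ‖) (norm_unitaryIntegral_apply_le k)

theorem unitaryIntegral_apply (k : C_c(K, ℂ)) (x : E) :
    unitaryIntegral hU k x = haarIntegral fun κ => k κ • (U κ : E →L[ℂ] E) x := rfl

theorem norm_unitaryIntegral_le (k : C_c(K, ℂ)) :
    ‖unitaryIntegral hU k‖ ≤ haarIntegral fun κ => ‖k κ‖ :=
  LinearMap.mkContinuous_norm_le _ (haarIntegral_nonneg fun _ => norm_nonneg _) _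

/-- `k ↦ ∫ k(κ) U(κ) dκ` as a linear map. -/
def unitaryIntegralₗ : C_c(K, ℂ) →ₗ[ℂ] (E →L[ℂ] E) where
  toFun := unitaryIntegral hU
  map_add' k k' := by
    ext x
    simp only [unitaryIntegral_apply, CompactlySupportedContinuousMap.add_apply, add_smul,
      add_apply]
    exact haarIntegral_add (continuous_smul_unitary hU k x) (hasCompactSupport_smul k _)
      (continuous_smul_unitary hU k' x) (hasCompactSupport_smul k' _)
  map_smul' c k := by
    ext x
    simp only [unitaryIntegral_apply, CompactlySupportedContinuousMap.smul_apply, smul_assoc,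
      smul_apply, RingHom.id_apply]
    exact haarIntegral_smul c _

@[simp]
theorem unitaryIntegralₗ_apply (k : C_c(K, ℂ)) :
    unitaryIntegralₗ hU k = unitaryIntegral hU k := rfl

theorem unitary_mul_unitaryIntegral (κ : K) (k : C_c(K, ℂ)) :
    (U κ : E →L[ℂ] E) * unitaryIntegral hU k = unitaryIntegral hU (leftTranslate κ k) := by
  ext x
  rw [mul_apply_eq_comp, unitaryIntegral_apply, unitaryIntegral_apply,
    ← ContinuousLinearMap.haarIntegral_comp_comm _ (continuous_smul_unitary hU k x)
      (hasCompactSupport_smul k _),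
    ← haarIntegral_mul_left (fun κ' => leftTranslate κ k κ' • (U κ' : E →L[ℂ] E) x) κ]
  simp

theorem unitaryIntegral_commute (T : E →L[ℂ] E) (h : ∀ κ, T * U κ = U κ * T) (k : C_c(K, ℂ)) :
    T * unitaryIntegral hU k = unitaryIntegral hU k * T := by
  ext x
  rw [mul_apply_eq_comp, mul_apply_eq_comp, unitaryIntegral_apply, unitaryIntegral_apply,
    ← ContinuousLinearMap.haarIntegral_comp_comm _ (continuous_smul_unitary hU k x)
      (hasCompactSupport_smul k _)]
  congr 1
  ext κ
  rw [map_smul, ← mul_apply_eq_comp, h, mul_apply_eq_comp]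

theorem norm_unitary_mul (u : unitary (E →L[ℂ] E)) (T : E →L[ℂ] E) :
    ‖(u : E →L[ℂ] E) * T‖ = ‖T‖ :=
  CStarRing.norm_coe_unitary_mul u T

/-- Although U is only strongly continuous, integration makes it norm continuous: the difference at
κ and κ₀ is, up to a unitary factor, the integrated form of a translate of k minus k, bounded by the
L¹ modulus. -/
theorem continuous_unitary_mul_unitaryIntegral (k : C_c(K, ℂ)) :
    Continuous fun κ => (U κ : E →L[ℂ] E) * unitaryIntegral hU k := by
  have key : ∀ κ κ₀, ‖(U κ : E →L[ℂ] E) * unitaryIntegral hU k - U κ₀ * unitaryIntegral hU k‖ ≤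
      translationModulus k (κ₀⁻¹ * κ) := fun κ κ₀ => by
    have h1 : (U κ : E →L[ℂ] E) = U κ₀ * U (κ₀⁻¹ * κ) := by
      rw [← Submonoid.coe_mul, ← map_mul, mul_inv_cancel_left]
    rw [h1, mul_assoc, ← mul_sub, norm_unitary_mul, unitary_mul_unitaryIntegral]
    have h2 := map_sub (unitaryIntegralₗ hU) (leftTranslate (κ₀⁻¹ * κ) k) k
    simp only [unitaryIntegralₗ_apply] at h2
    rw [← h2]
    exact norm_unitaryIntegral_le hU _
  refine continuous_iff_continuousAt.2 fun κ₀ => ?_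
  rw [ContinuousAt, tendsto_iff_norm_sub_tendsto_zero]
  refine squeeze_zero (fun _ => norm_nonneg _) (fun κ => key κ κ₀) ?_
  have := ((continuous_translationModulus k).comp (continuous_const_mul κ₀⁻¹)).tendsto κ₀
  simpa [translationModulus_one, Function.comp_def] using this

/-- After multiplication by a suitable T the strong integral becomes a Bochner integral of
operators, to which bounded linear maps such as characters may be applied. -/
theorem unitaryIntegral_mul_eq_haarIntegral (k : C_c(K, ℂ)) {T : E →L[ℂ] E}
    (hT : Continuous fun κ => (U κ : E →L[ℂ] E) * T) :
    unitaryIntegral hU k * T = haarIntegral fun κ => k κ • ((U κ : E →L[ℂ] E) * T) := by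
  ext x
  rw [mul_apply_eq_comp, unitaryIntegral_apply]
  exact (ContinuousLinearMap.apply ℂ E x).haarIntegral_comp_comm (k.continuous.smul hT)
    (hasCompactSupport_smul k _)

/-- Approximate identities in `C_c(K)`. -/
theorem exists_norm_haarIntegral_smul_sub_le {F : Type*} [NormedAddCommGroup F] [NormedSpace ℂ F]
    [CompleteSpace F] {f : K → F} [T2Space K] (hf : Continuous f) {ε : ℝ} (hε : 0 < ε) :
    ∃ k : C_c(K, ℂ), ‖(haarIntegral fun κ => k κ • f κ) - f 1‖ ≤ ε := by
  have hn : ∀ᶠ κ in 𝓝 (1 : K), ‖f κ - f 1‖ < ε := by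
    have h1 : Continuous fun κ => ‖f κ - f 1‖ := (hf.sub continuous_const).norm
    have := h1.tendsto 1
    rw [sub_self, norm_zero] at this
    exact this.eventually (gt_mem_nhds hε)
  obtain ⟨b, hb, hbc, hb1, hb0, -, hbs⟩ := exists_bump 1 hn
  set c := haarIntegral b with hc
  have hc0 : 0 < c := by
    refine (haarIntegral_nonneg hb0).lt_of_ne fun h => ?_
    have := eq_zero_of_haarIntegral_eq_zero hb hbc hb0 h.symm 1
    rw [hb1] at this
    exact one_ne_zero this
  let k : C_c(K, ℂ) :=
    { toFun := fun κ => ((b κ / c : ℝ) : ℂ)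
      continuous_toFun := Complex.continuous_ofReal.comp (hb.div_const c)
      hasCompactSupport' := hbc.mono fun κ hκ h0 => hκ (by simp [h0]) }
  have hk : ∀ κ, k κ = ((b κ / c : ℝ) : ℂ) := fun _ => rfl
  have hk1 : haarIntegral k = 1 := by
    change haarIntegral (fun κ => ((b κ / c : ℝ) : ℂ)) = 1
    rw [haarIntegral_ofReal]
    simp only [div_eq_mul_inv]
    rw [haarIntegral_real_mul_const, ← hc, mul_inv_cancel₀ hc0.ne', Complex.ofReal_one]
  have hconst : (haarIntegral fun κ => k κ • f 1) = f 1 := by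
    have := (ContinuousLinearMap.toSpanSingleton ℂ (f 1)).haarIntegral_comp_comm k.continuous
      k.hasCompactSupport
    simpa [hk1] using this
  refine ⟨k, ?_⟩
  have hdiff : (haarIntegral fun κ => k κ • f κ) - f 1 =
      (haarIntegral fun κ => k κ • f κ) - haarIntegral fun κ => k κ • f 1 := by rw [hconst]
  rw [hdiff, ← haarIntegral_sub (continuous_smul_fun k hf) (hasCompactSupport_smul k _)
    (continuous_smul_fun k continuous_const) (hasCompactSupport_smul k _)]
  refine (norm_haarIntegral_le _).trans ?_
  have hle : ∀ κ, ‖k κ • f κ - k κ • f 1‖ ≤ b κ * (c⁻¹ * ε) := fun κ => by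
    rw [← smul_sub, norm_smul, hk, Complex.norm_real, Real.norm_eq_abs, abs_of_nonneg
      (div_nonneg (hb0 κ) hc0.le)]
    by_cases h : κ ∈ {κ | ‖f κ - f 1‖ < ε}
    · have : ‖f κ - f 1‖ < ε := h
      rw [div_eq_mul_inv, mul_assoc]
      have := hb0 κ
      gcongr
    · simp [hbs κ h]
  refine (haarIntegral_mono ?_ ?_ (hb.mul continuous_const) hbc.mul_right hle).trans_eq ?_
  · exact ((continuous_smul_fun k hf).sub (continuous_smul_fun k continuous_const)).norm
  · exact hbc.mono fun κ hκ h0 => hκ (by simp [hk, h0])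
  · rw [show (b * fun _ => c⁻¹ * ε) = fun x => b x * (c⁻¹ * ε) from rfl,
      haarIntegral_real_mul_const, ← hc, mul_inv_cancel_left₀ hc0.ne']

end UnitaryIntegral

/-! ### The Gelfand bound on integrated forms -/

section Gelfand

variable {K : Type*} [TopologicalSpace K] [CommGroup K] [IsTopologicalGroup K]
  [LocallyCompactSpace K]
  {E : Type*} [NormedAddCommGroup E] [InnerProductSpace ℂ E] [CompleteSpace E]
  {U : K →* unitary (E →L[ℂ] E)} (hU : ∀ x : E, Continuous fun κ => (U κ : E →L[ℂ] E) x)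

/-- The double commutant of an abelian group of unitaries. -/
def doubleCommutant (U : K →* unitary (E →L[ℂ] E)) : StarSubalgebra ℂ (E →L[ℂ] E) :=
  StarSubalgebra.centralizer ℂ (StarSubalgebra.centralizer ℂ
    (Set.range fun κ => (U κ : E →L[ℂ] E)) : Set (E →L[ℂ] E))

theorem mem_commutant_iff {T : E →L[ℂ] E} :
    T ∈ StarSubalgebra.centralizer ℂ (Set.range fun κ => (U κ : E →L[ℂ] E)) ↔
      ∀ κ, T * U κ = U κ * T := by
  rw [StarSubalgebra.mem_centralizer_iff]
  constructor
  · intro h κ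
    exact (h _ ⟨κ, rfl⟩).1.symm
  · rintro h _ ⟨κ, rfl⟩
    refine ⟨(h κ).symm, ?_⟩
    have := h κ⁻¹
    rw [map_inv, ← Unitary.star_eq_inv, Unitary.coe_star] at this
    exact this.symm

theorem mem_doubleCommutant_iff {T : E →L[ℂ] E} :
    T ∈ doubleCommutant U ↔ ∀ S : E →L[ℂ] E, (∀ κ, S * U κ = U κ * S) → S * T = T * S := by
  rw [doubleCommutant, StarSubalgebra.mem_centralizer_iff]
  constructor
  · intro h S hS
    exact (h S (mem_commutant_iff.2 hS)).1
  · intro h S hS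
    exact ⟨h S (mem_commutant_iff.1 hS), h _ (mem_commutant_iff.1 (star_mem hS))⟩

theorem unitary_mem_doubleCommutant (κ : K) : (U κ : E →L[ℂ] E) ∈ doubleCommutant U :=
  mem_doubleCommutant_iff.2 fun _ h => h κ

theorem unitaryIntegral_mem_doubleCommutant (k : C_c(K, ℂ)) :
    unitaryIntegral hU k ∈ doubleCommutant U :=
  mem_doubleCommutant_iff.2 fun S h => unitaryIntegral_commute hU S h k

/-- As K is abelian, each U κ lies in the commutant, so the double commutant is contained in the
commutant. -/
theorem doubleCommutant_mul_comm {S T : E →L[ℂ] E} (hS : S ∈ doubleCommutant U)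
    (hT : T ∈ doubleCommutant U) : S * T = T * S := by
  refine mem_doubleCommutant_iff.1 hT S fun κ => ?_
  refine (mem_doubleCommutant_iff.1 hS _ fun κ' => ?_).symm
  rw [← Submonoid.coe_mul, ← Submonoid.coe_mul, ← map_mul, ← map_mul, mul_comm]

theorem isClosed_doubleCommutant : IsClosed (doubleCommutant U : Set (E →L[ℂ] E)) := by
  have : (doubleCommutant U : Set (E →L[ℂ] E)) =
      ⋂ S : E →L[ℂ] E, ⋂ _ : ∀ κ, S * U κ = U κ * S, {T | S * T = T * S} := by
    ext T
    simp [mem_doubleCommutant_iff]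
  rw [this]
  exact isClosed_iInter fun S => isClosed_iInter fun _ =>
    isClosed_eq (continuous_const_mul S) (continuous_mul_const S)

instance : IsClosed (doubleCommutant U : Set (E →L[ℂ] E)) := isClosed_doubleCommutant

/-- Characters of a commutative C*-algebra containing a group of unitaries and its integrated form
are given on the latter by characters of the group. -/
theorem norm_apply_le_of_forall_character {A : Type*} [CommCStarAlgebra A] (V : K →* A)
    (hV : ∀ κ, star (V κ) * V κ = 1) (T : C_c(K, ℂ) → A)
    (hcont : ∀ k, Continuous fun κ => V κ * T k)
    (hprod : ∀ k k₀, T k * T k₀ = haarIntegral fun κ => k κ • (V κ * T k₀))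
    (k : C_c(K, ℂ)) {C : ℝ}
    (hC : ∀ θ : PontryaginDual K, ‖haarIntegral fun κ => k κ * (θ κ : ℂ)‖ ≤ C)
    (γ : WeakDual.characterSpace ℂ A) : ‖γ (T k)‖ ≤ C := by
  -- A character of the algebra may vanish on the whole integrated form; then only `0 ≤ C` is
  -- needed, which the trivial character supplies.
  by_cases h0 : ∀ k, γ (T k) = 0
  · rw [h0, norm_zero]
    exact (norm_nonneg _).trans (hC 1)
  push Not at h0
  obtain ⟨k₀, hk₀⟩ := h0
  have hγ : Continuous γ := map_continuous γ
  have hnV : ∀ κ, ‖γ (V κ)‖ = 1 := fun κ => by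
    have h2 := congrArg γ (hV κ)
    rw [map_mul, map_star, map_one, RCLike.star_def, Complex.conj_mul'] at h2
    have h3 : ‖γ (V κ)‖ ^ 2 = 1 := by exact_mod_cast h2
    nlinarith [norm_nonneg (γ (V κ))]
  let θ : PontryaginDual K :=
    ContinuousMonoidHom.mk
      { toFun := fun κ => ⟨γ (V κ), mem_sphere_zero_iff_norm.2 (hnV κ)⟩
        map_one' := Circle.ext (by simp)
        map_mul' := fun κ κ' => Circle.ext (by
          change γ (V (κ * κ')) = γ (V κ) * γ (V κ')
          rw [map_mul, map_mul]) }
      (by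
        refine Continuous.subtype_mk ?_ _
        -- `V` need not be norm continuous, but `V κ * T k₀` is; dividing by the nonzero number γ(T
        -- k₀) transfers continuity to κ ↦ γ(V κ).
        have : (fun κ => γ (V κ)) = fun κ => γ (V κ * T k₀) / γ (T k₀) := by
          ext κ
          rw [map_mul, mul_div_cancel_right₀ _ hk₀]
        rw [this]
        exact (hγ.comp (hcont k₀)).div_const _)
  have hθ : ∀ κ, (θ κ : ℂ) = γ (V κ) := fun _ => rfl
  have hγint := (WeakDual.CharacterSpace.toCLM γ).haarIntegral_comp_comm
      (continuous_smul_fun k (hcont k₀)) (hasCompactSupport_smul k _)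
  rw [← hprod] at hγint
  have h2 : γ (T k) * γ (T k₀) = (haarIntegral fun κ => k κ * (θ κ : ℂ)) * γ (T k₀) := by
    rw [← map_mul, ← haarIntegral_mul_const]
    refine hγint.symm.trans ?_
    congr 1
    ext κ
    change γ (k κ • (V κ * T k₀)) = _
    rw [map_smul, map_mul, hθ, smul_eq_mul, mul_assoc]
  rw [mul_right_cancel₀ hk₀ h2]
  exact hC θ

theorem norm_le_of_forall_characterSpace {A : Type*} [CommCStarAlgebra A] {a : A} {C : ℝ}
    (hC0 : 0 ≤ C) (hC : ∀ γ : WeakDual.characterSpace ℂ A, ‖γ a‖ ≤ C) : ‖a‖ ≤ C := by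
  rw [← (gelfandTransform_isometry A).norm_map_of_map_zero (map_zero _) a,
    ContinuousMap.norm_le _ hC0]
  exact hC

instance : CommCStarAlgebra (doubleCommutant U) where
  toCompleteSpace := isClosed_doubleCommutant.completeSpace_coe
  norm_mul_self_le x := (CStarRing.norm_star_mul_self (x := (x : E →L[ℂ] E))).symm.le
  mul_comm S T := Subtype.ext (doubleCommutant_mul_comm S.2 T.2)

/-- The inclusion of the double commutant, as a continuous linear map. -/
def doubleCommutantVal (U : K →* unitary (E →L[ℂ] E)) :
    doubleCommutant U →L[ℂ] (E →L[ℂ] E) where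
  toFun := Subtype.val
  map_add' _ _ := rfl
  map_smul' _ _ := rfl
  cont := continuous_subtype_val

/-- The operator norm of `∫ k(κ) U(κ) dκ` is at most the supremum of the Fourier transform of `k`
over all characters of `K`. -/
theorem norm_unitaryIntegral_le_of_forall_character (k : C_c(K, ℂ)) {C : ℝ}
    (hC : ∀ θ : PontryaginDual K, ‖haarIntegral fun κ => k κ * (θ κ : ℂ)‖ ≤ C) :
    ‖unitaryIntegral hU k‖ ≤ C := by
  -- The double commutant is a commutative C*-algebra containing the unitaries and their integrals,
  -- so its characters compute the norm.
  let T : C_c(K, ℂ) → doubleCommutant U := fun k =>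
    ⟨unitaryIntegral hU k, unitaryIntegral_mem_doubleCommutant hU k⟩
  let V : K →* doubleCommutant U :=
    { toFun := fun κ => ⟨U κ, unitary_mem_doubleCommutant κ⟩
      map_one' := Subtype.ext (by simp)
      map_mul' := fun κ κ' => Subtype.ext (by simp) }
  have hcont : ∀ k, Continuous fun κ => V κ * T k := fun k =>
    (continuous_unitary_mul_unitaryIntegral hU k).subtype_mk _
  refine norm_le_of_forall_characterSpace (a := T k) ((norm_nonneg _).trans (hC 1)) fun γ =>
    norm_apply_le_of_forall_character V
      (fun κ => Subtype.ext (Unitary.coe_star_mul_self (U κ))) T hcont (fun k k₀ => ?_) k hC γ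
  apply Subtype.ext
  have h1 := (doubleCommutantVal U).haarIntegral_comp_comm
    (continuous_smul_fun k (hcont k₀)) (hasCompactSupport_smul k _)
  refine Eq.trans ?_ h1
  exact unitaryIntegral_mul_eq_haarIntegral hU k (continuous_unitary_mul_unitaryIntegral hU k₀)

end Gelfand

/-! ### Pairings of groups and the Fourier transform -/

section Pairing

variable {K X : Type*} [TopologicalSpace K] [CommGroup K] [IsTopologicalGroup K]
  [LocallyCompactSpace K] [TopologicalSpace X] [CommGroup X] [IsTopologicalGroup X]
  [LocallyCompactSpace X]

/-- The pairing of `K` and `X` given by `t : X → K^`, as a homomorphism from `K` to `X^`. -/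
def dualTranspose (t : X →ₜ* PontryaginDual K) : K →ₜ* PontryaginDual X where
  toFun κ := ContinuousMonoidHom.mk
    { toFun := fun x => t x κ
      map_one' := by rw [map_one]; rfl
      map_mul' := fun x y => by rw [map_mul]; rfl }
    (continuous_dual_eval.comp ((map_continuous t).prodMk continuous_const))
  map_one' := PontryaginDual.ext fun x => map_one (t x)
  map_mul' κ κ' := PontryaginDual.ext fun x => map_mul (t x) κ κ'
  continuous_toFun := ContinuousMonoidHom.continuous_of_continuous_uncurry _
    (continuous_dual_eval.comp (((map_continuous t).comp continuous_snd).prodMk continuous_fst))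

@[simp]
theorem dualTranspose_apply (t : X →ₜ* PontryaginDual K) (κ : K) (x : X) :
    dualTranspose t κ x = t x κ := rfl

variable (t : X →ₜ* PontryaginDual K)

/-- The Fourier transform of `k ∈ C_c(K)`, as a function on `X`. -/
def fourierFun (k : C_c(K, ℂ)) (x : X) : ℂ :=
  haarIntegral fun κ => k κ * (t x κ : ℂ)

theorem continuous_pairing : Continuous fun p : X × K => (t p.1 p.2 : ℂ) :=
  continuous_circle_coe.comp (continuous_dual_eval.comp
    (((map_continuous t).comp continuous_fst).prodMk continuous_snd))

theorem continuous_mul_pairing (k : C_c(K, ℂ)) :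
    Continuous fun p : X × K => k p.2 * (t p.1 p.2 : ℂ) :=
  (k.continuous.comp continuous_snd).mul (continuous_pairing t)

theorem continuous_mul_character (k : C_c(K, ℂ)) (θ : PontryaginDual K) :
    Continuous fun κ => k κ * (θ κ : ℂ) :=
  k.continuous.mul (continuous_circle_coe.comp (map_continuous θ))

theorem hasCompactSupport_mul (k : C_c(K, ℂ)) (f : K → ℂ) :
    HasCompactSupport fun κ => k κ * f κ :=
  k.hasCompactSupport.mul_right

theorem continuous_fourierFun (k : C_c(K, ℂ)) : Continuous (fourierFun t k) :=
  continuous_haarIntegral (continuous_mul_pairing t k) fun p =>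
    ⟨Set.univ, univ_mem, tsupport k, k.hasCompactSupport, fun q _ κ hκ => by
      rw [image_eq_zero_of_notMem_tsupport hκ, zero_mul]⟩

theorem norm_fourierFun_le (k : C_c(K, ℂ)) (x : X) :
    ‖fourierFun t k x‖ ≤ haarIntegral fun κ => ‖k κ‖ := by
  refine (norm_haarIntegral_le _).trans_eq ?_
  simp [Circle.norm_coe]

theorem fourierFun_leftTranslate (k : C_c(K, ℂ)) (κ : K) (x : X) :
    fourierFun t (leftTranslate κ k) x = (t x κ : ℂ) * fourierFun t k x := by
  rw [fourierFun, fourierFun, ← haarIntegral_mul_left _ κ, ← haarIntegral_const_mul]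
  congr 1
  ext κ'
  rw [leftTranslate_apply, inv_mul_cancel_left, map_mul, Circle.coe_mul]
  ring

theorem fourierFun_add (k k' : C_c(K, ℂ)) (x : X) :
    fourierFun t (k + k') x = fourierFun t k x + fourierFun t k' x := by
  simp only [fourierFun, CompactlySupportedContinuousMap.add_apply, add_mul]
  exact haarIntegral_add (continuous_mul_character k _) (hasCompactSupport_mul k _)
    (continuous_mul_character k' _) (hasCompactSupport_mul k' _)

theorem fourierFun_smul (c : ℂ) (k : C_c(K, ℂ)) (x : X) :
    fourierFun t (c • k) x = c * fourierFun t k x := by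
  simp only [fourierFun, CompactlySupportedContinuousMap.smul_apply, smul_eq_mul, mul_assoc]
  exact haarIntegral_const_mul _ _

theorem fourierFun_sub (k k' : C_c(K, ℂ)) (x : X) :
    fourierFun t (k - k') x = fourierFun t k x - fourierFun t k' x := by
  simp only [fourierFun, CompactlySupportedContinuousMap.sub_apply, sub_mul]
  exact haarIntegral_sub (continuous_mul_character k _) (hasCompactSupport_mul k _)
    (continuous_mul_character k' _) (hasCompactSupport_mul k' _)

/-- Translating k by κ multiplies its transform at x by t(x)(κ), so the left side is the transform
of a translate of k minus k. -/
theorem norm_sub_one_mul_fourierFun_le (k : C_c(K, ℂ)) (κ : K) (x : X) :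
    ‖(t x κ : ℂ) - 1‖ * ‖fourierFun t k x‖ ≤ translationModulus k κ := by
  rw [← norm_mul, sub_mul, one_mul, ← fourierFun_leftTranslate, ← fourierFun_sub]
  exact norm_fourierFun_le t _ x

/-- The Riemann-Lebesgue lemma: Fourier transforms vanish at infinity. -/
theorem tendsto_fourierFun (ht : Tendsto t (cocompact X) (cocompact (PontryaginDual K)))
    (k : C_c(K, ℂ)) : Tendsto (fourierFun t k) (cocompact X) (𝓝 0) := by
  rw [Metric.tendsto_nhds]
  intro ε hε
  have hω : Tendsto (fun κ => translationModulus k κ / ε) (𝓝 1) (𝓝 0) := by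
    have := ((continuous_translationModulus k).div_const ε).tendsto 1
    simpa [translationModulus_one] using this
  -- Where the transform has modulus at least ε, the character `t x` has modulus of continuity at
  -- most `translationModulus k / ε`, so it lies in a compact set of characters; properness of `t`
  -- confines x.
  filter_upwards [ht (isCompact_setOf_norm_sub_one_le hω).compl_mem_cocompact] with x hx
  rw [dist_zero_right]
  by_contra! hlt
  refine hx fun κ => ?_
  rw [le_div_iff₀ hε]
  exact (mul_le_mul_of_nonneg_left hlt (norm_nonneg _)).trans
    (norm_sub_one_mul_fourierFun_le t k κ x)

/-- A homomorphism `t : X → K^` which identifies `X` with the dual of `K`: it is one-to-one,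
proper, and Fourier transforms of `k ∈ C_c(K)` are bounded on `K^` by their supremum over `X`. -/
structure IsDualPairing : Prop where
  injective : Function.Injective t
  tendsto_cocompact : Tendsto t (cocompact X) (cocompact (PontryaginDual K))
  norm_le : ∀ (k : C_c(K, ℂ)) (C : ℝ), (∀ x, ‖fourierFun t k x‖ ≤ C) →
    ∀ θ : PontryaginDual K, ‖haarIntegral fun κ => k κ * (θ κ : ℂ)‖ ≤ C

variable {t}

/-- The Fourier transform `C_c(K) → C₀(X)`. -/
def fourier (ht : Tendsto t (cocompact X) (cocompact (PontryaginDual K))) :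
    C_c(K, ℂ) →ₗ[ℂ] C₀(X, ℂ) where
  toFun k :=
    { toFun := fourierFun t k
      continuous_toFun := continuous_fourierFun t k
      zero_at_infty' := tendsto_fourierFun t ht k }
  map_add' k k' := by ext x; exact fourierFun_add t k k' x
  map_smul' c k := by ext x; exact fourierFun_smul t c k x

variable (ht : Tendsto t (cocompact X) (cocompact (PontryaginDual K)))

theorem fourier_apply (k : C_c(K, ℂ)) (x : X) : fourier ht k x = fourierFun t k x := rfl

theorem norm_fourier_le (k : C_c(K, ℂ)) : ‖fourier ht k‖ ≤ haarIntegral fun κ => ‖k κ‖ :=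
  (norm_le_iff (haarIntegral_nonneg fun _ => norm_nonneg _) _).2 (norm_fourierFun_le t k)

theorem fourier_leftTranslate (k : C_c(K, ℂ)) (κ : K) :
    fourier ht (leftTranslate κ k) = charMul (dualTranspose t κ) (fourier ht k) := by
  ext x
  exact fourierFun_leftTranslate t k κ x

/-- The function `κ ↦ conj k(κ⁻¹)`. -/
def involution (k : C_c(K, ℂ)) : C_c(K, ℂ) where
  toFun κ := conj (k κ⁻¹)
  continuous_toFun := Complex.continuous_conj.comp (k.continuous.comp continuous_inv)
  hasCompactSupport' := (k.hasCompactSupport.comp_homeomorph (Homeomorph.inv K)).comp_left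
    (g := conj) (map_zero _)

@[simp]
theorem involution_apply (k : C_c(K, ℂ)) (κ : K) : involution k κ = conj (k κ⁻¹) := rfl

theorem fourier_involution (k : C_c(K, ℂ)) : fourier ht (involution k) = star (fourier ht k) := by
  ext x
  rw [ZeroAtInftyContinuousMap.star_apply, fourier_apply, fourier_apply, fourierFun, fourierFun,
    RCLike.star_def, ← haarIntegral_conj, ← haarIntegral_inv]
  congr 1
  ext κ
  rw [involution_apply, inv_inv, map_inv, Circle.coe_inv_eq_conj, map_mul]

theorem continuous_charMul_dualTranspose (a : C₀(X, ℂ)) :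
    Continuous fun κ => charMul (dualTranspose t κ) a :=
  (continuous_charMul a).comp (map_continuous (dualTranspose t))

/-- This plays the role of convolution: multiplication by a transform becomes an average of
multiplications by characters, which translations of `C_c(K)` realise. -/
theorem fourier_mul (k : C_c(K, ℂ)) (a : C₀(X, ℂ)) :
    fourier ht k * a = haarIntegral fun κ => k κ • charMul (dualTranspose t κ) a := by
  ext x
  have := (evalCLM x).haarIntegral_comp_comm
    (continuous_smul_fun k (continuous_charMul_dualTranspose (t := t) a))
    (hasCompactSupport_smul k _)
  rw [evalCLM_apply] at this
  rw [← this, ZeroAtInftyContinuousMap.mul_apply, fourier_apply, fourierFun,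
    ← haarIntegral_mul_const]
  congr 1
  ext κ
  simp [mul_assoc]

/-- The closure of the space of Fourier transforms. -/
def fourierClosure : NonUnitalStarSubalgebra ℂ C₀(X, ℂ) where
  __ := (LinearMap.range (fourier ht)).topologicalClosure
  mul_mem' := fun {a b} ha hb => by
    have hchar : ∀ κ, charMul (dualTranspose t κ) b ∈
        (LinearMap.range (fourier ht)).topologicalClosure := fun κ => by
      refine map_mem_closure (continuous_charMul_right _) hb ?_
      rintro _ ⟨k, rfl⟩
      exact ⟨_, fourier_leftTranslate ht k κ⟩
    have hcl : IsClosed {a | a * b ∈ (LinearMap.range (fourier ht)).topologicalClosure} :=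
      (Submodule.isClosed_topologicalClosure _).preimage (continuous_mul_const b)
    refine hcl.closure_subset_iff.2 ?_ ha
    rintro _ ⟨k, rfl⟩
    change fourier ht k * b ∈ (LinearMap.range (fourier ht)).topologicalClosure
    rw [fourier_mul]
    exact haarIntegral_mem _ (Submodule.isClosed_topologicalClosure _)
      (continuous_smul_fun k (continuous_charMul_dualTranspose b)) (hasCompactSupport_smul k _)
      fun κ => Submodule.smul_mem _ _ (hchar κ)
  star_mem' := fun {a} ha => by
    refine map_mem_closure continuous_star ha ?_
    rintro _ ⟨k, rfl⟩
    exact ⟨_, fourier_involution ht k⟩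

/-- A continuous function on `K` orthogonal to `C_c(K)` vanishes. -/
theorem eq_zero_of_forall_haarIntegral_mul [T2Space K] {f : K → ℂ} (hf : Continuous f)
    (h : ∀ k : C_c(K, ℂ), haarIntegral (fun κ => k κ * f κ) = 0) (κ : K) : f κ = 0 := by
  obtain ⟨b, hb, hbc, hb1, hb0, -⟩ := exists_bump κ univ_mem
  -- Testing against a bump times the conjugate of f leaves the integral of b|f|².
  have hk : Continuous fun κ => (b κ : ℂ) * conj (f κ) :=
    (Complex.continuous_ofReal.comp hb).mul (Complex.continuous_conj.comp hf)
  have hkc : HasCompactSupport fun κ => (b κ : ℂ) * conj (f κ) :=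
    hbc.mono fun κ hκ h0 => hκ (by simp [h0])
  let k : C_c(K, ℂ) := { toFun := _, continuous_toFun := hk, hasCompactSupport' := hkc }
  have hint : ∀ κ, k κ * f κ = ((b κ * ‖f κ‖ ^ 2 : ℝ) : ℂ) := fun κ => by
    change (b κ : ℂ) * conj (f κ) * f κ = _
    rw [mul_assoc, Complex.conj_mul', Complex.ofReal_mul, Complex.ofReal_pow]
  have h1 := h k
  simp only [hint] at h1
  rw [haarIntegral_ofReal, Complex.ofReal_eq_zero] at h1
  have hc : Continuous fun κ => b κ * ‖f κ‖ ^ 2 := hb.mul (hf.norm.pow 2)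
  have hcc : HasCompactSupport fun κ => b κ * ‖f κ‖ ^ 2 :=
    hbc.mono fun κ hκ h0 => hκ (by simp [h0])
  have h3 := eq_zero_of_haarIntegral_eq_zero hc hcc
    (fun κ => mul_nonneg (hb0 κ) (sq_nonneg _)) h1 κ
  simpa [hb1] using h3

theorem exists_fourier_ne_zero [T2Space K] (x : X) : ∃ k, fourier ht k x ≠ 0 := by
  by_contra! h
  exact Circle.coe_ne_zero _ (eq_zero_of_forall_haarIntegral_mul
    (continuous_circle_coe.comp (map_continuous (t x))) h 1)

theorem exists_fourier_ne [T2Space K] (hinj : Function.Injective t) {x y : X} (hxy : x ≠ y) :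
    ∃ k, fourier ht k x ≠ fourier ht k y := by
  by_contra! h
  refine hxy (hinj (PontryaginDual.ext fun κ => Circle.ext (sub_eq_zero.1
    (eq_zero_of_forall_haarIntegral_mul (f := fun κ => (t x κ : ℂ) - t y κ)
      ((continuous_circle_coe.comp (map_continuous (t x))).sub
        (continuous_circle_coe.comp (map_continuous (t y)))) (fun k => ?_) κ))))
  simp only [mul_sub]
  rw [haarIntegral_sub (continuous_mul_character k _) (hasCompactSupport_mul k _)
    (continuous_mul_character k _) (hasCompactSupport_mul k _), sub_eq_zero]
  exact h k

/-- By Stone–Weierstrass: characters vanish nowhere, and distinct points of X give distinct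
characters of K, which some k ∈ `C_c(K)` tells apart. -/
theorem denseRange_fourier [T2Space X] [T2Space K] (hinj : Function.Injective t) :
    DenseRange (fourier ht) := by
  have hmem : ∀ k, fourier ht k ∈ fourierClosure ht := fun k => subset_closure ⟨k, rfl⟩
  have hcl : IsClosed (fourierClosure ht : Set C₀(X, ℂ)) := isClosed_closure
  intro a
  refine eq_top_of_separatesPoints (fourierClosure ht) hcl (fun x => ?_) (fun x y hxy => ?_) a
  · obtain ⟨k, hk⟩ := exists_fourier_ne_zero ht x
    exact ⟨_, hmem k, hk⟩
  · obtain ⟨k, hk⟩ := exists_fourier_ne ht hinj hxy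
    exact ⟨_, hmem k, hk⟩

end Pairing

/-! ### Representations of `C₀(X)` and unitary representations of K -/

section Correspondence

variable {K X : Type*} [TopologicalSpace K] [CommGroup K] [IsTopologicalGroup K]
  [LocallyCompactSpace K] [T2Space K] [TopologicalSpace X] [CommGroup X] [IsTopologicalGroup X]
  [LocallyCompactSpace X] [T2Space X] {t : X →ₜ* PontryaginDual K}
  {E : Type*} [NormedAddCommGroup E] [InnerProductSpace ℂ E] [CompleteSpace E]

/-- The unitary representation of `K` given by a nondegenerate representation of `C₀(X)`, when `X`
is paired with `K`. -/
def dualRep (t : X →ₜ* PontryaginDual K) {π : C₀(X, ℂ) →⋆ₙₐ[ℂ] (E →L[ℂ] E)}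
    (hπ : Nondegenerate π) : K →* unitary (E →L[ℂ] E) :=
  (multiplierRep hπ).comp (dualTranspose t : K →* PontryaginDual X)

theorem coe_dualRep {π : C₀(X, ℂ) →⋆ₙₐ[ℂ] (E →L[ℂ] E)} (hπ : Nondegenerate π) (κ : K) :
    (dualRep t hπ κ : E →L[ℂ] E) = multiplier π (dualTranspose t κ) := rfl

theorem continuous_dualRep {π : C₀(X, ℂ) →⋆ₙₐ[ℂ] (E →L[ℂ] E)} (hπ : Nondegenerate π) (x : E) :
    Continuous fun κ => (dualRep t hπ κ : E →L[ℂ] E) x :=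
  (continuous_multiplier hπ x).comp (map_continuous (dualTranspose t))

/-- By nondegeneracy it suffices to compare after right multiplication by π(a); there both sides are
the norm-convergent integral of k(κ) times π applied to the character of κ times a. -/
theorem rep_fourier_eq (ht : Tendsto t (cocompact X) (cocompact (PontryaginDual K)))
    {π : C₀(X, ℂ) →⋆ₙₐ[ℂ] (E →L[ℂ] E)} (hπ : Nondegenerate π) (k : C_c(K, ℂ)) :
    π (fourier ht k) = unitaryIntegral (continuous_dualRep (t := t) hπ) k := by
  refine hπ.ext fun a => ?_
  have h : ∀ κ, (dualRep t hπ κ : E →L[ℂ] E) * π a = π (charMul (dualTranspose t κ) a) := fun κ =>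
    multiplier_mul hπ _ a
  have hc : Continuous fun κ => (dualRep t hπ κ : E →L[ℂ] E) * π a := by
    simp only [h]
    exact (repCLM π).continuous.comp (continuous_charMul_dualTranspose a)
  rw [← map_mul, fourier_mul, unitaryIntegral_mul_eq_haarIntegral _ k hc, ← repCLM_apply,
    ← (repCLM π).haarIntegral_comp_comm
      (continuous_smul_fun k (continuous_charMul_dualTranspose a)) (hasCompactSupport_smul k _)]
  congr 1
  ext1 κ
  rw [map_smul, h, repCLM_apply]

variable (ht : IsDualPairing t) {U : K →* unitary (E →L[ℂ] E)}
  (hU : ∀ x : E, Continuous fun κ => (U κ : E →L[ℂ] E) x)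

include ht in
theorem IsDualPairing.denseRange : DenseRange (fourier ht.tendsto_cocompact) :=
  denseRange_fourier _ ht.injective

/-- The Gelfand bound gives the supremum over all characters of K, and the pairing reduces it to
those coming from X. This is what lets the integrated form extend to `C₀(X)`. -/
theorem IsDualPairing.norm_unitaryIntegral_le (k : C_c(K, ℂ)) :
    ‖unitaryIntegralₗ hU k‖ ≤ 1 * ‖fourier ht.tendsto_cocompact k‖ := by
  rw [one_mul]
  exact norm_unitaryIntegral_le_of_forall_character hU k
    (ht.norm_le k _ (norm_apply_le (fourier ht.tendsto_cocompact k)))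

/-- The representation of `C₀(X)` given by a unitary representation of `K`, as a continuous linear
map. -/
def dualRepCLM : C₀(X, ℂ) →L[ℂ] (E →L[ℂ] E) :=
  (unitaryIntegralₗ hU).extendOfNorm (fourier ht.tendsto_cocompact)

theorem dualRepCLM_fourier (k : C_c(K, ℂ)) :
    dualRepCLM ht hU (fourier ht.tendsto_cocompact k) = unitaryIntegral hU k :=
  LinearMap.extendOfNorm_eq ht.denseRange ⟨1, ht.norm_unitaryIntegral_le hU⟩ k

theorem dualRepCLM_charMul (κ : K) (a : C₀(X, ℂ)) :
    dualRepCLM ht hU (charMul (dualTranspose t κ) a) = U κ * dualRepCLM ht hU a := by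
  refine ht.denseRange.induction_on (p := fun a => dualRepCLM ht hU (charMul (dualTranspose t κ) a)
    = U κ * dualRepCLM ht hU a) a ?_ fun k => ?_
  · exact isClosed_eq ((dualRepCLM ht hU).continuous.comp (continuous_charMul_right _))
      ((continuous_const_mul _).comp (dualRepCLM ht hU).continuous)
  · rw [← fourier_leftTranslate, dualRepCLM_fourier, dualRepCLM_fourier,
      unitary_mul_unitaryIntegral]

theorem dualRepCLM_mul (a b : C₀(X, ℂ)) :
    dualRepCLM ht hU (a * b) = dualRepCLM ht hU a * dualRepCLM ht hU b := by
  refine ht.denseRange.induction_on (p := fun a => dualRepCLM ht hU (a * b) =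
    dualRepCLM ht hU a * dualRepCLM ht hU b) a ?_ fun k => ?_
  · exact isClosed_eq ((dualRepCLM ht hU).continuous.comp (continuous_mul_const b))
      ((continuous_mul_const _).comp (dualRepCLM ht hU).continuous)
  · have hc : Continuous fun κ => (U κ : E →L[ℂ] E) * dualRepCLM ht hU b := by
      simp only [← dualRepCLM_charMul]
      exact (dualRepCLM ht hU).continuous.comp (continuous_charMul_dualTranspose b)
    rw [fourier_mul, dualRepCLM_fourier, unitaryIntegral_mul_eq_haarIntegral hU k hc,
      ← (dualRepCLM ht hU).haarIntegral_comp_comm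
        (continuous_smul_fun k (continuous_charMul_dualTranspose b)) (hasCompactSupport_smul k _)]
    congr 1
    ext1 κ
    rw [map_smul, dualRepCLM_charMul]

theorem star_unitaryIntegral (k : C_c(K, ℂ)) :
    star (unitaryIntegral hU k) = unitaryIntegral hU (involution k) := by
  rw [ContinuousLinearMap.star_eq_adjoint, eq_comm, ContinuousLinearMap.eq_adjoint_iff]
  intro x y
  have h1 := (innerSL ℂ x).haarIntegral_comp_comm (continuous_smul_unitary hU k y)
    (hasCompactSupport_smul k _)
  have h2 := (innerSL ℂ y).haarIntegral_comp_comm (continuous_smul_unitary hU (involution k) x)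
    (hasCompactSupport_smul (involution k) _)
  simp only [innerSL_apply_apply] at h1 h2
  rw [unitaryIntegral_apply, unitaryIntegral_apply, ← h1, ← inner_conj_symm, ← h2,
    ← haarIntegral_conj, ← haarIntegral_inv]
  congr 1
  ext κ
  rw [inner_conj_symm, involution_apply, inv_inv, inner_smul_left, inner_smul_right, Complex.conj_conj,
    map_inv, ← Unitary.star_eq_inv, Unitary.coe_star, ContinuousLinearMap.star_eq_adjoint,
    ContinuousLinearMap.adjoint_inner_left]

/-- The representation of `C₀(X)` given by a unitary representation of `K`. -/
def dualStarRep : C₀(X, ℂ) →⋆ₙₐ[ℂ] (E →L[ℂ] E) where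
  toFun := dualRepCLM ht hU
  map_smul' := map_smul _
  map_zero' := map_zero _
  map_add' := map_add _
  map_mul' := dualRepCLM_mul ht hU
  map_star' a := by
    refine ht.denseRange.induction_on (p := fun a => dualRepCLM ht hU (star a) =
      star (dualRepCLM ht hU a)) a ?_ fun k => ?_
    · exact isClosed_eq ((dualRepCLM ht hU).continuous.comp continuous_star)
        (continuous_star.comp (dualRepCLM ht hU).continuous)
    · rw [← fourier_involution, dualRepCLM_fourier, dualRepCLM_fourier, star_unitaryIntegral]

theorem dualStarRep_fourier (k : C_c(K, ℂ)) :
    dualStarRep ht hU (fourier ht.tendsto_cocompact k) = unitaryIntegral hU k :=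
  dualRepCLM_fourier ht hU k

theorem dualStarRep_charMul (κ : K) (a : C₀(X, ℂ)) :
    dualStarRep ht hU (charMul (dualTranspose t κ) a) = U κ * dualStarRep ht hU a :=
  dualRepCLM_charMul ht hU κ a

/-- Approximate identities in `C_c(K)` recover each vector x as a limit of integrals ∫ k(κ) U(κ)x
dκ. -/
theorem nondegenerate_dualStarRep : Nondegenerate (dualStarRep ht hU) := by
  rw [Nondegenerate, ← Submodule.dense_iff_topologicalClosure_eq_top]
  refine Metric.dense_iff.2 fun x ε hε => ?_
  obtain ⟨k, hk⟩ := exists_norm_haarIntegral_smul_sub_le (hU x) (half_pos hε)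
  refine ⟨unitaryIntegral hU k x, ?_, ?_⟩
  · rw [Metric.mem_ball, dist_eq_norm]
    rw [map_one] at hk
    exact lt_of_le_of_lt hk (half_lt_self hε)
  · exact Submodule.subset_span ⟨_, x, by rw [← dualStarRep_fourier ht hU k]⟩

/-- The unitary representation is recovered from the representation of `C₀(X)`. -/
theorem dualRep_dualStarRep (κ : K) :
    (dualRep t (nondegenerate_dualStarRep ht hU) κ : E →L[ℂ] E) = U κ :=
  (nondegenerate_dualStarRep ht hU).ext fun a => by
    rw [coe_dualRep, multiplier_mul (nondegenerate_dualStarRep ht hU), dualStarRep_charMul]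

end Correspondence

section DualGroup

variable {K : Type*} [TopologicalSpace K] [CommGroup K] [IsTopologicalGroup K]
  [LocallyCompactSpace K]

/-- Inversion on the dual group; it pairs `K` with its dual by `(κ, ψ) ↦ conj ψ(κ)`. -/
def dualInv (K : Type*) [TopologicalSpace K] [CommGroup K] [IsTopologicalGroup K]
    [LocallyCompactSpace K] : PontryaginDual K →ₜ* PontryaginDual K where
  toFun ψ := ψ⁻¹
  map_one' := inv_one
  map_mul' := mul_inv
  continuous_toFun := continuous_inv

@[simp]
theorem dualInv_apply (ψ : PontryaginDual K) : dualInv K ψ = ψ⁻¹ := rfl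

/-- Every character of K is in the range, so the norm condition only undoes an inversion. -/
theorem isDualPairing_dualInv : IsDualPairing (dualInv K) where
  injective := inv_injective
  tendsto_cocompact := (Homeomorph.inv (PontryaginDual K)).isClosedEmbedding.tendsto_cocompact
  norm_le k C h θ := by
    have := h θ⁻¹
    rwa [fourierFun, dualInv_apply, inv_inv] at this

end DualGroup

/-! ### Covariance as the Weyl relation -/

section Weyl

variable {X : Type v} [TopologicalSpace X] [CommGroup X] [IsTopologicalGroup X]
  [LocallyCompactSpace X] [T2Space X]
  {K : Type*} [TopologicalSpace K] [CommGroup K] [IsTopologicalGroup K]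
  [LocallyCompactSpace K] [T2Space K]
  {E : Type*} [NormedAddCommGroup E] [InnerProductSpace ℂ E] [CompleteSpace E]

/-- The Weyl relation: if `T` implements the translation by `x` on `C₀(X)`, it commutes with the
character `θ` up to the factor `conj θ(x)`. -/
theorem mul_multiplier_of_translate {π : C₀(X, ℂ) →⋆ₙₐ[ℂ] (E →L[ℂ] E)} (hπ : Nondegenerate π)
    {T : E →L[ℂ] E} {x : X} (hT : ∀ a, T * π a = π (translate x a) * T) (θ : PontryaginDual X) :
    T * multiplier π θ = conj (θ x : ℂ) • (multiplier π θ * T) :=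
  hπ.ext fun a => by
    rw [mul_assoc, multiplier_mul hπ, hT, translate_charMul, map_smul, ← multiplier_mul hπ,
      smul_mul_assoc, smul_mul_assoc, mul_assoc, mul_assoc, hT]

theorem continuous_translate (x : X) : Continuous fun a : C₀(X, ℂ) => translate x a :=
  (LinearMap.mkContinuous (𝕜 := ℂ) (σ := RingHom.id ℂ)
    { toFun := fun a : C₀(X, ℂ) => translate x a
      map_add' := fun _ _ => rfl
      map_smul' := fun _ _ => rfl } 1 fun a => by
    rw [one_mul]
    exact (norm_le_iff (norm_nonneg _) _).2 fun y => norm_apply_le a _).continuous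

/-- The product of a compactly supported function and a character. -/
def mulCharacter (k : C_c(K, ℂ)) (θ : PontryaginDual K) : C_c(K, ℂ) where
  toFun κ := k κ * (θ κ : ℂ)
  continuous_toFun := continuous_mul_character k θ
  hasCompactSupport' := hasCompactSupport_mul k _

@[simp]
theorem mulCharacter_apply (k : C_c(K, ℂ)) (θ : PontryaginDual K) (κ : K) :
    mulCharacter k θ κ = k κ * (θ κ : ℂ) := rfl

theorem mul_unitaryIntegral_of_smul {U : K →* unitary (E →L[ℂ] E)}
    (hU : ∀ x : E, Continuous fun κ => (U κ : E →L[ℂ] E) x) {T : E →L[ℂ] E} {θ : PontryaginDual K}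
    (hT : ∀ κ, T * U κ = (θ κ : ℂ) • ((U κ : E →L[ℂ] E) * T)) (k : C_c(K, ℂ)) :
    T * unitaryIntegral hU k = unitaryIntegral hU (mulCharacter k θ) * T := by
  ext x
  rw [mul_apply_eq_comp, mul_apply_eq_comp, unitaryIntegral_apply, unitaryIntegral_apply,
    ← T.haarIntegral_comp_comm (continuous_smul_unitary hU k x) (hasCompactSupport_smul k _)]
  congr 1
  ext1 κ
  rw [map_smul, ← mul_apply_eq_comp, hT, mulCharacter_apply, mul_smul]
  rfl

/-- If `T` commutes with a unitary representation of `K` up to the character given by `x ∈ X`, it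
implements the translation by `x` on `C₀(X)`. -/
theorem mul_dualStarRep_of_smul {t : X →ₜ* PontryaginDual K} (ht : IsDualPairing t)
    {U : K →* unitary (E →L[ℂ] E)} (hU : ∀ x : E, Continuous fun κ => (U κ : E →L[ℂ] E) x)
    {T : E →L[ℂ] E} {x : X} (hT : ∀ κ, T * U κ = (t x⁻¹ κ : ℂ) • ((U κ : E →L[ℂ] E) * T))
    (a : C₀(X, ℂ)) :
    T * dualStarRep ht hU a = dualStarRep ht hU (translate x a) * T := by
  have hc : Continuous (dualStarRep ht hU) := (dualRepCLM ht hU).continuous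
  refine ht.denseRange.induction_on (p := fun a => T * dualStarRep ht hU a =
    dualStarRep ht hU (translate x a) * T) a ?_ fun k => ?_
  · exact isClosed_eq (continuous_const.mul hc)
      ((hc.comp (continuous_translate x)).mul continuous_const)
  · have : translate x (fourier ht.tendsto_cocompact k) =
        fourier ht.tendsto_cocompact (mulCharacter k (t x⁻¹)) := by
      ext y
      rw [translate_apply, fourier_apply, fourier_apply, fourierFun, fourierFun]
      congr 1
      ext κ
      rw [mulCharacter_apply, map_mul, dual_mul_apply, Circle.coe_mul, mul_assoc]
    rw [this, dualStarRep_fourier, dualStarRep_fourier]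
    exact mul_unitaryIntegral_of_smul hU hT k

end Weyl

/-- A group of linear isometries as a unitary representation. -/
def unitaryRepOfIsometry {K E : Type*} [Group K] [NormedAddCommGroup E] [InnerProductSpace ℂ E]
    [CompleteSpace E] (V : K → E →L[ℂ] E) (h1 : V 1 = 1) (hmul : ∀ κ κ', V (κ * κ') = V κ * V κ')
    (hn : ∀ κ x, ‖V κ x‖ = ‖x‖) : K →* unitary (E →L[ℂ] E) where
  toFun κ := ⟨V κ, by
    have h3 : star (V κ) * V κ = 1 := (ContinuousLinearMap.norm_map_iff_adjoint_comp_self _).1 (hn κ)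
    have h2 : V κ * V κ⁻¹ = 1 := by rw [← hmul, mul_inv_cancel, h1]
    refine Unitary.mem_iff.2 ⟨h3, ?_⟩
    have : star (V κ) = V κ⁻¹ := by rw [← mul_one (star _), ← h2, ← mul_assoc, h3, one_mul]
    rw [this, h2]⟩
  map_one' := Subtype.ext h1
  map_mul' κ κ' := Subtype.ext (hmul κ κ')

/-! ### Multiplications and translations on L²(H) -/

section RegularRepresentation

variable {H : Type v} [TopologicalSpace H] [CommGroup H] [IsTopologicalGroup H]
  [LocallyCompactSpace H] [T2Space H] [MeasurableSpace H] [BorelSpace H]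

/-- An indicator of a set t of finite measure is squeezed between a compact s ⊆ t and an open V ⊇ s.
A Urysohn function differs from it only on V \ s ∪ t \ s, whose two pieces get half of the allowed
measure each. -/
theorem exists_hasCompactSupport_norm_sub_le {X : Type*} [TopologicalSpace X] [T2Space X]
    [LocallyCompactSpace X] [MeasurableSpace X] [BorelSpace X] {μ : Measure X} [μ.Regular]
    {f : X → ℂ} (hf : MemLp f 2 μ) {ε : ℝ≥0∞} (hε : ε ≠ 0) :
    ∃ g : X → ℂ, eLpNorm (f - g) 2 μ ≤ ε ∧ Continuous g ∧ HasCompactSupport g := by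
  refine hf.induction_dense (by norm_num) (P := fun g => Continuous g ∧ HasCompactSupport g)
    ?_ ?_ ?_ hε
  · intro c t ht htμ ε hε
    obtain ⟨η, hη0, hη⟩ := exists_eLpNorm_indicator_le (p := 2) (μ := μ) (by norm_num) c hε
    have hη2 : ((η : ℝ≥0∞) / 2) ≠ 0 := by simpa using hη0.ne'
    obtain ⟨s, hst, hs, -, hsμ⟩ := ht.exists_isCompact_isClosed_sdiff_lt htμ.ne hη2
    obtain ⟨V, hsV, hV, -, hVμ⟩ := hs.measurableSet.exists_isOpen_sdiff_lt
      (hs.measure_ne_top (μ := μ)) hη2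
    obtain ⟨f, h1, h2, h3, h4⟩ := exists_continuous_one_zero_of_isCompact hs hV.isClosed_compl
      (Set.disjoint_compl_right_iff_subset.2 hsV)
    refine ⟨fun x => f x * c, ?_, (Complex.continuous_ofReal.comp f.continuous).mul
      continuous_const, h3.mono fun x hx h0 => hx (by simp [h0])⟩
    refine (eLpNorm_mono (g := (V \ s ∪ t \ s).indicator fun _ => c) fun x => ?_).trans
      (hη _ ((measure_union_le _ _).trans ?_))
    · by_cases hxs : x ∈ s
      · have h5 : x ∉ V \ s ∪ t \ s := by simp [hxs]
        have h6 : f x = 1 := h1 hxs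
        simp [h5, h6, hst hxs]
      · have h5 := h4 x
        have h7 : ‖(f x : ℂ)‖ ≤ 1 := by
          rw [Complex.norm_real, Real.norm_eq_abs, abs_of_nonneg h5.1]
          exact h5.2
        have h8 : ‖(f x : ℂ) - 1‖ ≤ 1 := by
          rw [← Complex.ofReal_one, ← Complex.ofReal_sub, Complex.norm_real, Real.norm_eq_abs,
            abs_sub_le_iff]
          constructor <;> linarith [h5.1, h5.2]
        by_cases hxt : x ∈ t
        · have h6 : x ∈ V \ s ∪ t \ s := Or.inr ⟨hxt, hxs⟩
          simp only [Pi.sub_apply, Set.indicator_of_mem h6, Set.indicator_of_mem hxt]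
          rw [show (f x : ℂ) * c - c = (f x - 1) * c by ring, norm_mul]
          exact mul_le_of_le_one_left (norm_nonneg _) h8
        · by_cases hxV : x ∈ V
          · have h6 : x ∈ V \ s ∪ t \ s := Or.inl ⟨hxV, hxs⟩
            simp only [Pi.sub_apply, Set.indicator_of_mem h6, Set.indicator_of_notMem hxt]
            rw [sub_zero, norm_mul]
            exact mul_le_of_le_one_left (norm_nonneg _) h7
          · have h6 : f x = 0 := h2 hxV
            simp [h6, hxt]
    · calc μ (V \ s) + μ (t \ s) ≤ η / 2 + η / 2 := add_le_add hVμ.le hsμ.le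
        _ = η := ENNReal.add_halves _
  · rintro f g ⟨hf, hfc⟩ ⟨hg, hgc⟩
    exact ⟨hf.add hg, hfc.add hgc⟩
  · rintro f ⟨hf, hfc⟩
    exact (hf.memLp_of_hasCompactSupport hfc (p := 2) (μ := μ)).aestronglyMeasurable

variable (H) in
/-- The space `L²(H)`. -/
abbrev L2 : Type v := Lp ℂ 2 (Measure.haar : Measure H)

/-- A continuous function of compact support as an element of `L²(H)`. -/
def toL2 (f : C_c(H, ℂ)) : L2 H :=
  (f.continuous.memLp_of_hasCompactSupport f.hasCompactSupport).toLp f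

theorem toL2_ae (f : C_c(H, ℂ)) : toL2 f =ᵐ[Measure.haar] f :=
  MemLp.coeFn_toLp _

theorem denseRange_toL2 : DenseRange (toL2 (H := H)) := by
  intro ξ
  refine Metric.mem_closure_iff.2 fun ε hε => ?_
  obtain ⟨g, hg, hgc, hgs⟩ := exists_hasCompactSupport_norm_sub_le (Lp.memLp ξ)
    (ε := ENNReal.ofReal (ε / 2)) (by simpa using hε)
  refine ⟨_, ⟨⟨⟨g, hgc⟩, hgs⟩, rfl⟩, ?_⟩
  rw [dist_eq_norm, Lp.norm_def]
  have h1 : eLpNorm (ξ - toL2 ⟨⟨g, hgc⟩, hgs⟩ : L2 H) 2 Measure.haar =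
      eLpNorm ((ξ : H → ℂ) - g) 2 Measure.haar := by
    refine eLpNorm_congr_ae ?_
    filter_upwards [Lp.coeFn_sub ξ (toL2 ⟨⟨g, hgc⟩, hgs⟩), toL2_ae ⟨⟨g, hgc⟩, hgs⟩] with x hx hx'
    rw [hx, Pi.sub_apply, Pi.sub_apply, hx']
    rfl
  rw [h1]
  refine (ENNReal.toReal_mono ENNReal.ofReal_ne_top hg).trans_lt ?_
  rw [ENNReal.toReal_ofReal (by positivity)]
  linarith

theorem memLp_mul (a : C₀(H, ℂ)) (ξ : L2 H) : MemLp (fun x => a x * ξ x) 2 Measure.haar :=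
  (Lp.memLp ξ).of_le_mul (c := ‖a‖)
    (a.continuous.measurable.aestronglyMeasurable.mul (Lp.aestronglyMeasurable ξ))
    (Eventually.of_forall fun x => by
      rw [norm_mul]
      exact mul_le_mul_of_nonneg_right (norm_apply_le a x) (norm_nonneg _))

theorem toLp_mul_ae (a : C₀(H, ℂ)) (ξ : L2 H) :
    (memLp_mul a ξ).toLp _ =ᵐ[Measure.haar] fun x => a x * ξ x :=
  MemLp.coeFn_toLp _

/-- Multiplication by `a ∈ C₀(H)` on `L²(H)`. -/
def mulOp (a : C₀(H, ℂ)) : L2 H →L[ℂ] L2 H :=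
  LinearMap.mkContinuous
    { toFun := fun ξ => (memLp_mul a ξ).toLp _
      map_add' := fun ξ η => by
        ext1
        filter_upwards [toLp_mul_ae a (ξ + η), Lp.coeFn_add ((memLp_mul a ξ).toLp _)
          ((memLp_mul a η).toLp _), toLp_mul_ae a ξ, toLp_mul_ae a η, Lp.coeFn_add ξ η]
          with x h1 h2 h3 h4 h5
        rw [h1, h2, Pi.add_apply, h3, h4, h5, Pi.add_apply, mul_add]
      map_smul' := fun c ξ => by
        ext1
        filter_upwards [toLp_mul_ae a (c • ξ), Lp.coeFn_smul c ((memLp_mul a ξ).toLp _),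
          toLp_mul_ae a ξ, Lp.coeFn_smul c ξ] with x h1 h2 h3 h4
        rw [h1, RingHom.id_apply, h2, Pi.smul_apply, h3, h4, Pi.smul_apply, smul_eq_mul,
          smul_eq_mul]
        ring } ‖a‖ fun ξ => by
    refine Lp.norm_le_mul_norm_of_ae_le_mul ?_
    filter_upwards [toLp_mul_ae a ξ] with x hx
    change ‖((memLp_mul a ξ).toLp _ : L2 H) x‖ ≤ _
    rw [hx, norm_mul]
    exact mul_le_mul_of_nonneg_right (norm_apply_le a x) (norm_nonneg _)

theorem mulOp_ae (a : C₀(H, ℂ)) (ξ : L2 H) :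
    mulOp a ξ =ᵐ[Measure.haar] fun x => a x * ξ x :=
  toLp_mul_ae a ξ

variable (H) in
/-- The representation of `C₀(H)` on `L²(H)` by multiplication. -/
def mulRep : C₀(H, ℂ) →⋆ₙₐ[ℂ] (L2 H →L[ℂ] L2 H) where
  toFun := mulOp
  map_smul' c a := by
    ext ξ : 1
    ext1
    filter_upwards [mulOp_ae (c • a) ξ, mulOp_ae a ξ, Lp.coeFn_smul c (mulOp a ξ)] with x h1 h2 h3
    rw [h1]
    refine Eq.trans ?_ h3.symm
    rw [Pi.smul_apply, h2]
    simp [mul_assoc]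
  map_zero' := by
    ext ξ : 1
    ext1
    filter_upwards [mulOp_ae 0 ξ, Lp.coeFn_zero ℂ 2 (Measure.haar : Measure H)] with x h1 h2
    rw [h1]
    refine Eq.trans ?_ h2.symm
    simp
  map_add' a b := by
    ext ξ : 1
    ext1
    filter_upwards [mulOp_ae (a + b) ξ, mulOp_ae a ξ, mulOp_ae b ξ,
      Lp.coeFn_add (mulOp a ξ) (mulOp b ξ)] with x h1 h2 h3 h4
    rw [h1]
    refine Eq.trans ?_ h4.symm
    rw [Pi.add_apply, h2, h3]
    simp [add_mul]
  map_mul' a b := by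
    ext ξ : 1
    ext1
    filter_upwards [mulOp_ae (a * b) ξ, mulOp_ae b ξ, mulOp_ae a (mulOp b ξ)] with x h1 h2 h3
    rw [h1]
    refine Eq.trans ?_ h3.symm
    rw [h2]
    simp [mul_assoc]
  map_star' a := by
    rw [ContinuousLinearMap.star_eq_adjoint, ContinuousLinearMap.eq_adjoint_iff]
    intro ξ η
    rw [L2.inner_def, L2.inner_def]
    refine integral_congr_ae ?_
    filter_upwards [mulOp_ae (star a) ξ, mulOp_ae a η] with x h1 h2
    rw [h1, h2]
    simp [mul_assoc, mul_left_comm]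

theorem mulRep_ae (a : C₀(H, ℂ)) (ξ : L2 H) :
    mulRep H a ξ =ᵐ[Measure.haar] fun x => a x * ξ x :=
  mulOp_ae a ξ

theorem nondegenerate_mulRep : Nondegenerate (mulRep H) := by
  rw [Nondegenerate, ← Submodule.dense_iff_topologicalClosure_eq_top]
  refine denseRange_toL2.mono ?_
  rintro _ ⟨f, rfl⟩
  obtain ⟨b, h1, -, h3, -⟩ := exists_continuous_one_zero_of_isCompact
    (f.hasCompactSupport : IsCompact (tsupport f)) isClosed_empty (Set.disjoint_empty _)
  refine Submodule.subset_span ⟨zeroAtInftyOfCompact (fun x => (b x : ℂ))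
    (Complex.continuous_ofReal.comp b.continuous) (h3.mono fun x hx h0 => hx (by simp [h0])),
    toL2 f, ?_⟩
  ext1
  filter_upwards [mulRep_ae (zeroAtInftyOfCompact (fun x => (b x : ℂ))
    (Complex.continuous_ofReal.comp b.continuous) (h3.mono fun x hx h0 => hx (by simp [h0])))
    (toL2 f), toL2_ae f] with x hx hf
  rw [hx, hf, zeroAtInftyOfCompact_apply]
  by_cases h : x ∈ tsupport f
  · have : b x = 1 := h1 h
    rw [this, Complex.ofReal_one, one_mul]
  · rw [image_eq_zero_of_notMem_tsupport h, mul_zero]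

/-- Haar measure charges nonempty open sets, so `a` times a bump vanishes everywhere as soon as it
vanishes almost everywhere. -/
theorem mulRep_injective : Function.Injective (mulRep H) := by
  refine (injective_iff_map_eq_zero _).2 fun a ha => ?_
  ext x
  obtain ⟨b, hb, hbc, hb1, -⟩ := exists_bump x univ_mem
  let f : C_c(H, ℂ) := ⟨⟨fun x => (b x : ℂ), Complex.continuous_ofReal.comp hb⟩,
    hbc.mono fun x hx h0 => hx (by simp [h0])⟩
  have h : (fun y => a y * f y) =ᵐ[Measure.haar] fun _ => 0 := by
    filter_upwards [mulRep_ae a (toL2 f), toL2_ae f,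
      Lp.coeFn_zero ℂ 2 (Measure.haar : Measure H)] with y h1 h2 h3
    rw [← h2, ← h1, ha]
    exact h3
  have h2 := (Continuous.ae_eq_iff_eq _ (a.continuous.mul f.continuous) continuous_const).1 h
  have h3 := congrFun h2 x
  have h4 : f x = 1 := by
    change (b x : ℂ) = 1
    rw [hb1, Complex.ofReal_one]
  simpa [h4] using h3

theorem fact_two_ne_top : Fact ((2 : ℝ≥0∞) ≠ ∞) := ⟨by norm_num⟩

attribute [local instance] fact_two_ne_top in
/-- The translation by `h` on `L²(H)`. -/
def translationOp (h : H) : L2 H →L[ℂ] L2 H where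
  toFun ξ := DomMulAct.mk h⁻¹ • ξ
  map_add' ξ η := smul_add _ ξ η
  map_smul' c ξ := smul_comm _ c ξ
  cont := continuous_const_smul _

theorem translationOp_ae (h : H) (ξ : L2 H) :
    translationOp h ξ =ᵐ[Measure.haar] fun x => ξ (h⁻¹ * x) :=
  DomMulAct.smul_Lp_ae_eq _ ξ

attribute [local instance] fact_two_ne_top in
theorem continuous_translationOp (ξ : L2 H) : Continuous fun h => translationOp h ξ := by
  have h1 : Continuous fun h : H => DomMulAct.mk h⁻¹ :=
    DomMulAct.continuous_mk.comp continuous_inv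
  exact h1.smul continuous_const

variable (H) in
/-- The regular representation of `H` on `L²(H)`. -/
def regularRep : H →* unitary (L2 H →L[ℂ] L2 H) :=
  unitaryRepOfIsometry translationOp
    (by
      ext1 ξ
      change DomMulAct.mk (1 : H)⁻¹ • ξ = ξ
      rw [inv_one]
      exact one_smul _ ξ)
    (fun κ κ' => by
      ext1 ξ
      change DomMulAct.mk (κ * κ')⁻¹ • ξ = DomMulAct.mk κ⁻¹ • DomMulAct.mk κ'⁻¹ • ξ
      rw [← mul_smul, ← DomMulAct.mk_mul, mul_inv, mul_comm])
    (fun κ ξ => DomMulAct.norm_smul_Lp _ ξ)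

theorem continuous_regularRep (ξ : L2 H) :
    Continuous fun h => (regularRep H h : L2 H →L[ℂ] L2 H) ξ :=
  continuous_translationOp ξ

theorem ae_translate {p : H → Prop} (hp : ∀ᵐ x ∂(Measure.haar : Measure H), p x) (h : H) :
    ∀ᵐ x ∂(Measure.haar : Measure H), p (h * x) :=
  (measurePreserving_mul_left Measure.haar h).quasiMeasurePreserving.ae hp

theorem regularRep_mul_mulRep (h : H) (a : C₀(H, ℂ)) :
    (regularRep H h : L2 H →L[ℂ] L2 H) * mulRep H a = mulRep H (translate h a) * regularRep H h := by
  ext ξ : 1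
  ext1
  filter_upwards [translationOp_ae h (mulRep H a ξ), mulRep_ae (translate h a) (translationOp h ξ),
    translationOp_ae h ξ, ae_translate (mulRep_ae a ξ) h⁻¹] with x h1 h2 h3 h4
  refine h1.trans (Eq.trans ?_ h2.symm)
  rw [h3, h4, translate_apply]

theorem inner_toL2_translationOp (f g : C_c(H, ℂ)) (h : H)
    (hfg : ∀ x, x ∈ tsupport g → h⁻¹ * x ∉ tsupport f) :
    inner ℂ (toL2 g) (translationOp h (toL2 f)) = 0 := by
  rw [L2.inner_def]
  refine integral_eq_zero_of_ae ?_
  filter_upwards [toL2_ae g, translationOp_ae h (toL2 f), ae_translate (toL2_ae f) h⁻¹]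
    with x h1 h2 h3
  rw [h2, h3, h1]
  by_cases hx : x ∈ tsupport g
  · simp [image_eq_zero_of_notMem_tsupport (hfg x hx)]
  · simp [image_eq_zero_of_notMem_tsupport hx]

end RegularRepresentation

/-! ### Pontryagin duality from the Weyl relation -/

section Pontryagin

variable {H : Type v} [TopologicalSpace H] [CommGroup H] [IsTopologicalGroup H]
  [LocallyCompactSpace H] [T2Space H]

variable (H) in
/-- The evaluation homomorphism of `H` into its double dual. -/
def doubleDual : H →ₜ* PontryaginDual (PontryaginDual H) :=
  dualTranspose (ContinuousMonoidHom.id (PontryaginDual H))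

@[simp]
theorem doubleDual_apply (h : H) (χ : PontryaginDual H) : doubleDual H h χ = χ h := rfl

theorem dualTranspose_doubleDual (χ : PontryaginDual H) : dualTranspose (doubleDual H) χ = χ :=
  PontryaginDual.ext fun _ => rfl

theorem dualTranspose_dualInv (h : H) : dualTranspose (dualInv H) h = doubleDual H h⁻¹ :=
  PontryaginDual.ext fun χ => (map_inv χ h).symm

section

variable [MeasurableSpace H] [BorelSpace H]

variable (H) in
/-- The representation of the functions on the dual group given by the regular representation. -/
def regularDualRep : C₀(PontryaginDual H, ℂ) →⋆ₙₐ[ℂ] (L2 H →L[ℂ] L2 H) :=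
  dualStarRep isDualPairing_dualInv (continuous_regularRep (H := H))

theorem nondegenerate_regularDualRep : Nondegenerate (regularDualRep H) :=
  nondegenerate_dualStarRep _ _

/-- The inverse on the right compensates for the pairing `dualInv`, through which the regular
representation acts on functions on the dual. -/
theorem multiplier_doubleDual (h : H) :
    multiplier (regularDualRep H) (doubleDual H h) = translationOp h⁻¹ := by
  have := dualRep_dualStarRep isDualPairing_dualInv (continuous_regularRep (H := H)) h⁻¹
  rwa [coe_dualRep, dualTranspose_dualInv, inv_inv] at this

theorem multiplier_mul_regularRep (χ : PontryaginDual H) (h : H) :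
    multiplier (mulRep H) χ * (regularRep H h : L2 H →L[ℂ] L2 H) =
      (dualInv H χ⁻¹ h : ℂ) • ((regularRep H h : L2 H →L[ℂ] L2 H) * multiplier (mulRep H) χ) := by
  have := mul_multiplier_of_translate nondegenerate_mulRep (regularRep_mul_mulRep h) χ
  rw [this, smul_smul, dualInv_apply, inv_inv, Complex.mul_conj', Circle.norm_coe]
  simp

/-- On `L²(H)`, the characters of `H` and of its dual satisfy the Weyl relation. -/
theorem multiplier_mul_multiplier_regularDualRep (χ : PontryaginDual H)
    (θ : PontryaginDual (PontryaginDual H)) :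
    multiplier (mulRep H) χ * multiplier (regularDualRep H) θ =
      (θ⁻¹ χ : ℂ) • (multiplier (regularDualRep H) θ * multiplier (mulRep H) χ) := by
  have h1 : ∀ b, multiplier (mulRep H) χ * regularDualRep H b =
      regularDualRep H (translate χ b) * multiplier (mulRep H) χ := fun b =>
    mul_dualStarRep_of_smul isDualPairing_dualInv (continuous_regularRep (H := H))
      (multiplier_mul_regularRep χ) b
  rw [mul_multiplier_of_translate nondegenerate_regularDualRep h1 θ, dual_inv_apply,
    Circle.coe_inv_eq_conj]

theorem exists_toL2_ne_zero (h : H) {s : Set H} (hs : s ∈ 𝓝 h) :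
    ∃ f : C_c(H, ℂ), f h = 1 ∧ toL2 f ≠ 0 ∧ ∀ x ∉ s, f x = 0 := by
  obtain ⟨b, hb, hbc, hb1, -, -, hbs⟩ := exists_bump h hs
  let f : C_c(H, ℂ) := ⟨⟨fun x => (b x : ℂ), Complex.continuous_ofReal.comp hb⟩,
    hbc.mono fun x hx h0 => hx (by simp [h0])⟩
  have hf : ∀ x, f x = b x := fun _ => rfl
  refine ⟨f, by simp [hf, hb1], fun h0 => ?_, fun x hx => by simp [hf, hbs x hx]⟩
  have h2 : (f : H → ℂ) =ᵐ[Measure.haar] fun _ => 0 := by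
    filter_upwards [toL2_ae f, Lp.coeFn_zero ℂ 2 (Measure.haar : Measure H)] with x h1 h2
    rw [← h1, h0]
    exact h2
  have h3 := congrFun ((Continuous.ae_eq_iff_eq _ f.continuous continuous_const).1 h2) h
  simp [hf, hb1] at h3

theorem translationOp_toL2 (h : H) (f : C_c(H, ℂ)) :
    translationOp h (toL2 f) = toL2 (leftTranslate h f) := by
  ext1
  filter_upwards [translationOp_ae h (toL2 f), toL2_ae (leftTranslate h f),
    ae_translate (toL2_ae f) h⁻¹] with x h1 h2 h3
  rw [h1, h2, h3, leftTranslate_apply]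

theorem toL2_injective : Function.Injective (toL2 (H := H)) := fun f g hfg => by
  have h2 : (f : H → ℂ) =ᵐ[Measure.haar] g := by
    filter_upwards [toL2_ae f, toL2_ae g] with x h1 h2
    rw [← h1, ← h2, hfg]
  exact DFunLike.coe_injective
    ((Continuous.ae_eq_iff_eq _ f.continuous g.continuous).1 h2)

end

/-- The characters of a locally compact abelian group separate its points. -/
theorem doubleDual_injective : Function.Injective (doubleDual H) := by
  borelize H
  refine (injective_iff_map_eq_one _).2 fun h hh => ?_
  by_contra hne
  obtain ⟨f, hf1, -, hf⟩ := exists_toL2_ne_zero (1 : H) (isOpen_ne.mem_nhds (Ne.symm hne))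
  -- If every character is trivial at h, translation by h⁻¹ is the multiplier of the trivial
  -- character, hence the identity; f, equal to 1 at 1 and 0 at h, contradicts this.
  have h1 : translationOp h⁻¹ (toL2 f) = toL2 f := by
    rw [← multiplier_doubleDual, hh, multiplier_one nondegenerate_regularDualRep]
    rfl
  rw [translationOp_toL2] at h1
  have h2 := DFunLike.congr_fun (toL2_injective h1) 1
  rw [leftTranslate_apply, inv_inv, mul_one, hf1, hf h (by simp)] at h2
  exact zero_ne_one h2

/-- If points h escaped to infinity while their images stayed in a compact set, then along an
ultrafilter the corresponding translations would converge strongly to a unitary. But translates of f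
leave every compact set, so they converge weakly to zero. -/
theorem tendsto_doubleDual : Tendsto (doubleDual H) (cocompact H)
    (cocompact (PontryaginDual (PontryaginDual H))) := by
  borelize H
  refine (hasBasis_cocompact.tendsto_right_iff).2 fun C hC => ?_
  by_contra hcon
  have hne : (cocompact H ⊓ 𝓟 {h | doubleDual H h ∈ C}).NeBot := by
    rw [← frequently_mem_iff_neBot]
    exact fun h => hcon h
  obtain ⟨F, hF⟩ := Ultrafilter.exists_le (cocompact H ⊓ 𝓟 {h | doubleDual H h ∈ C})
  obtain ⟨θ, -, hθ⟩ := isCompact_iff_ultrafilter_le_nhds.1 hC (F.map (doubleDual H)) (by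
    rw [le_principal_iff]
    exact (hF.trans inf_le_right) (mem_principal_self _))
  have hθ' : Tendsto (doubleDual H) F (𝓝 θ) := hθ
  obtain ⟨f, -, hf, -⟩ := exists_toL2_ne_zero (1 : H) univ_mem
  have hlim : Tendsto (fun h => multiplier (regularDualRep H) (doubleDual H h) (toL2 f)) F
      (𝓝 (multiplier (regularDualRep H) θ (toL2 f))) :=
    ((continuous_multiplier nondegenerate_regularDualRep (toL2 f)).tendsto θ).comp hθ'
  have horth : ∀ g : C_c(H, ℂ),
      inner ℂ (toL2 g) (multiplier (regularDualRep H) θ (toL2 f)) = 0 := fun g => by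
    have h1 : Tendsto (fun h => inner ℂ (toL2 g)
        (multiplier (regularDualRep H) (doubleDual H h) (toL2 f))) F
        (𝓝 (inner ℂ (toL2 g) (multiplier (regularDualRep H) θ (toL2 f)))) :=
      tendsto_const_nhds.inner hlim
    refine tendsto_nhds_unique h1 (tendsto_const_nhds.congr' ?_)
    have hK : IsCompact ((fun p : H × H => p.1 * p.2⁻¹) '' (tsupport f ×ˢ tsupport g)) :=
      (f.hasCompactSupport.isCompact.prod g.hasCompactSupport.isCompact).image (by fun_prop)
    filter_upwards [hF.trans inf_le_left hK.compl_mem_cocompact] with h hh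
    rw [multiplier_doubleDual, inner_toL2_translationOp]
    intro x hx hxf
    rw [inv_inv] at hxf
    exact hh ⟨(h * x, x), ⟨hxf, hx⟩, by simp⟩
  have hzero : multiplier (regularDualRep H) θ (toL2 f) = 0 := by
    refine ext_inner_left ℂ fun y => ?_
    rw [inner_zero_right]
    exact denseRange_toL2.induction_on
      (p := fun y => inner ℂ y (multiplier (regularDualRep H) θ (toL2 f)) = 0) y
      (isClosed_eq (by fun_prop) continuous_const) horth
  have hn := norm_unitary_apply (multiplierRep nondegenerate_regularDualRep θ) (toL2 f)
  rw [coe_multiplierRep, hzero, norm_zero] at hn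
  exact hf (norm_eq_zero.1 hn.symm)

/-- On L²(H), conjugation by the unitary of θ multiplies the operator of each χ by θ(χ). So the
transforms of k and kθ have equal norm as multiplication operators, hence in `C₀(H)` up to the bound
C, and the transform of kθ at 1 is the integral of kθ. -/
theorem norm_le_doubleDual (k : C_c(PontryaginDual H, ℂ)) (C : ℝ)
    (hk : ∀ h, ‖fourierFun (doubleDual H) k h‖ ≤ C) (θ : PontryaginDual (PontryaginDual H)) :
    ‖haarIntegral fun χ => k χ * (θ χ : ℂ)‖ ≤ C := by
  borelize H
  have hC : 0 ≤ C := (norm_nonneg _).trans (hk 1)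
  have ht := tendsto_doubleDual (H := H)
  let Θ := multiplierRep (nondegenerate_regularDualRep (H := H)) θ
  have hcomm : ∀ χ, (Θ : L2 H →L[ℂ] L2 H) * (dualRep (doubleDual H) nondegenerate_mulRep χ) =
      (θ χ : ℂ) • ((dualRep (doubleDual H) nondegenerate_mulRep χ : L2 H →L[ℂ] L2 H) * Θ) :=
    fun χ => by
      rw [coe_dualRep, dualTranspose_doubleDual, coe_multiplierRep,
        multiplier_mul_multiplier_regularDualRep, smul_smul, dual_inv_apply, ← Circle.coe_mul,
        mul_inv_cancel, Circle.coe_one, one_smul]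
  have h1 : (Θ : L2 H →L[ℂ] L2 H) * mulRep H (fourier ht k) =
      mulRep H (fourier ht (mulCharacter k θ)) * Θ := by
    rw [rep_fourier_eq ht nondegenerate_mulRep, rep_fourier_eq ht nondegenerate_mulRep]
    exact mul_unitaryIntegral_of_smul _ hcomm k
  have h2 : ‖fourier ht (mulCharacter k θ)‖ ≤ C := calc
    _ = ‖mulRep H (fourier ht (mulCharacter k θ))‖ :=
      (NonUnitalStarAlgHom.norm_map _ mulRep_injective _).symm
    _ = ‖(Θ : L2 H →L[ℂ] L2 H) * mulRep H (fourier ht k)‖ := by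
      rw [h1, CStarRing.norm_mul_coe_unitary]
    _ = ‖mulRep H (fourier ht k)‖ := CStarRing.norm_coe_unitary_mul _ _
    _ ≤ ‖fourier ht k‖ := norm_rep_le _ _
    _ ≤ C := (norm_le_iff hC _).2 hk
  refine le_trans (le_of_eq ?_) ((norm_apply_le _ (1 : H)).trans h2)
  simp [fourier_apply, fourierFun]

/-- Pontryagin duality. -/
theorem isDualPairing_doubleDual : IsDualPairing (doubleDual H) where
  injective := doubleDual_injective
  tendsto_cocompact := tendsto_doubleDual
  norm_le := norm_le_doubleDual

end Pontryagin

/-! ### L¹ approximation by elementary functions -/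

section Approximation

variable {G : Type*} [TopologicalSpace G] [CommGroup G] [IsTopologicalGroup G]
  [LocallyCompactSpace G] [T2Space G] {E : Type*} [NormedAddCommGroup E] [NormedSpace ℂ E]

/-- The function `g ↦ p(g) e`. -/
def smulConst (p : C_c(G, ℂ)) (e : E) : C_c(G, E) where
  toFun g := p g • e
  continuous_toFun := p.continuous.smul continuous_const
  hasCompactSupport' := hasCompactSupport_smul p _

@[simp]
theorem smulConst_apply (p : C_c(G, ℂ)) (e : E) (g : G) : smulConst p e g = p g • e := rfl

/-- The functions of the form `∑ pᵢ eᵢ`, with `eᵢ` in a dense set, are dense in `C_c(G, E)` for the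
`L¹`-norm. -/
theorem exists_haarIntegral_norm_sub_le {ι : Type*} {r : ι → E} (hr : DenseRange r)
    {S : Submodule ℂ C_c(G, E)} (hS : ∀ p i, smulConst p (r i) ∈ S) (x : C_c(G, E)) {ε : ℝ}
    (hε : 0 < ε) : ∃ y ∈ S, haarIntegral (fun g => ‖(x - y) g‖) ≤ ε := by
  obtain ⟨b, hb1, -, hbc, hb⟩ := exists_continuous_one_zero_of_isCompact
    x.hasCompactSupport.isCompact (isClosed_empty (X := G)) (Set.disjoint_empty _)
  set c := haarIntegral b with hc
  have hc0 : 0 ≤ c := haarIntegral_nonneg fun g => (hb g).1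
  set δ := ε / (2 * c + 1) with hδ
  have hδ0 : 0 < δ := by positivity
  choose k hk using fun g => hr.exists_dist_lt (x g) hδ0
  -- Requiring b > 1/2 on every piece turns the pointwise error δ into b · 2δ, whose integral 2cδ is
  -- at most ε whatever cover is chosen.
  let V : G → Set G := fun g => {g' | dist (x g') (r (k g)) < δ} ∩ {g' | 1 / 2 < b g'}
  have hV : ∀ g, IsOpen (V g) := fun g =>
    (isOpen_lt (by fun_prop) continuous_const).inter (isOpen_lt continuous_const b.continuous)
  obtain ⟨t, ht⟩ := x.hasCompactSupport.isCompact.elim_finite_subcover V hV fun g hg =>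
    Set.mem_iUnion.2 ⟨g, hk g, by
      have : b g = 1 := hb1 hg
      rw [Set.mem_ofPred_eq, this]
      norm_num⟩
  have ht : tsupport x ⊆ ⋃ i : t, V i := ht.trans fun g hg => by
    simpa using hg
  obtain ⟨f, hf, hfc⟩ := PartitionOfUnity.exists_isSubordinate_of_locallyFinite_t2space
    x.hasCompactSupport.isCompact (fun i : t => V i) (fun i => hV i)
    (locallyFinite_of_finite _) ht
  let p : t → C_c(G, ℂ) := fun i =>
    ⟨⟨fun g => (f i g : ℂ), Complex.continuous_ofReal.comp (f i).continuous⟩,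
      (hfc i).mono fun g hg h0 => hg (by simp [h0])⟩
  have hp : ∀ i g, p i g = f i g := fun _ _ => rfl
  have hsum1 : ∀ g, ∑ i, f i g ≤ 1 := fun g => by
    have := f.sum_le_one g
    rwa [finsum_eq_sum_of_fintype] at this
  have hsum : ∀ g, (∑ i, (f i g : ℂ)) • x g = x g := fun g => by
    by_cases hg : g ∈ tsupport x
    · have := f.sum_eq_one hg
      rw [finsum_eq_sum_of_fintype] at this
      rw [← Complex.ofReal_sum, this, Complex.ofReal_one, one_smul]
    · rw [image_eq_zero_of_notMem_tsupport hg, smul_zero]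
  refine ⟨∑ i, smulConst (p i) (r (k i)), S.sum_mem fun i _ => hS _ _, ?_⟩
  set y := ∑ i, smulConst (p i) (r (k i)) with hy
  have hxy : ∀ g, (x - y) g = ∑ i, (f i g : ℂ) • (x g - r (k i)) := fun g => by
    rw [CompactlySupportedContinuousMap.sub_apply]
    conv_lhs => rw [← hsum g, hy]
    simp only [CompactlySupportedContinuousMap.coe_sum, Finset.sum_apply, smulConst_apply, hp,
      smul_sub, Finset.sum_sub_distrib, Finset.sum_smul]
  have hle : ∀ g, ‖(x - y) g‖ ≤ b g * (2 * δ) := fun g => by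
    have h1 : ∀ i, f i g ≠ 0 → g ∈ V i := fun i hi => hf i (subset_tsupport _ hi)
    rw [hxy]
    by_cases hg : ∃ i, f i g ≠ 0
    · obtain ⟨i, hi⟩ := hg
      have hbg : 1 / 2 < b g := (h1 i hi).2
      calc ‖∑ i, (f i g : ℂ) • (x g - r (k i))‖ ≤ ∑ i, f i g * δ := by
            refine norm_sum_le_of_le _ fun i _ => ?_
            rw [norm_smul, Complex.norm_real, Real.norm_of_nonneg (f.nonneg i g)]
            by_cases h0 : f i g = 0
            · simp [h0]
            · refine mul_le_mul_of_nonneg_left ?_ (f.nonneg i g)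
              rw [← dist_eq_norm]
              exact (h1 i h0).1.le
        _ ≤ 1 * δ := by
            rw [← Finset.sum_mul]
            exact mul_le_mul_of_nonneg_right (hsum1 g) hδ0.le
        _ ≤ b g * (2 * δ) := by nlinarith
    · push Not at hg
      simp only [hg, Complex.ofReal_zero, zero_smul, Finset.sum_const_zero, norm_zero]
      have := (hb g).1
      positivity
  calc haarIntegral (fun g => ‖(x - y) g‖) ≤ haarIntegral fun g => b g * (2 * δ) :=
        haarIntegral_mono (x - y).continuous.norm (x - y).hasCompactSupport.norm (by fun_prop)
          (hbc.mul_right) hle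
    _ = c * (2 * δ) := haarIntegral_real_mul_const _ _
    _ ≤ ε := by
        rw [hδ, ← mul_assoc, mul_div_assoc', div_le_iff₀ (by positivity)]
        nlinarith

end Approximation

/-! ### Partial Fourier transforms -/

section PartialFourier

variable {A : Type*} [TopologicalSpace A]
  {K X : Type*} [TopologicalSpace K] [CommGroup K] [IsTopologicalGroup K]
  [LocallyCompactSpace K] [T2Space K] [T2Space A]
  [TopologicalSpace X] [CommGroup X] [IsTopologicalGroup X] [LocallyCompactSpace X]

/-- The function `κ ↦ f(a, κ)`. -/
def slice (f : C_c(A × K, ℂ)) (a : A) : C_c(K, ℂ) where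
  toFun κ := f (a, κ)
  continuous_toFun := f.continuous.comp (by fun_prop)
  hasCompactSupport' := HasCompactSupport.intro (f.hasCompactSupport.isCompact.image continuous_snd)
    fun κ hκ => image_eq_zero_of_notMem_tsupport fun h => hκ ⟨_, h, rfl⟩

@[simp]
theorem slice_apply (f : C_c(A × K, ℂ)) (a : A) (κ : K) : slice f a κ = f (a, κ) := rfl

variable {t : X →ₜ* PontryaginDual K}
  (ht : Tendsto t (cocompact X) (cocompact (PontryaginDual K)))

theorem continuous_fourier_slice (f : C_c(A × K, ℂ)) :
    Continuous fun a => fourier ht (slice f a) := by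
  refine continuous_iff_continuousAt.2 fun a => tendsto_iff_norm_sub_tendsto_zero.2 ?_
  have hf := f.continuous
  have h1 : Continuous fun a' => haarIntegral fun κ => ‖(slice f a' - slice f a) κ‖ := by
    refine continuous_haarIntegral ?_ fun p => ⟨Set.univ, univ_mem, _,
      f.hasCompactSupport.isCompact.image continuous_snd, fun q _ κ hκ => ?_⟩
    · exact ((hf.comp (by fun_prop : Continuous fun p : A × K => (p.1, p.2))).sub
        (hf.comp (by fun_prop : Continuous fun p : A × K => (a, p.2)))).norm
    · have h0 : ∀ a, f (a, κ) = 0 := fun a =>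
        image_eq_zero_of_notMem_tsupport fun h => hκ ⟨_, h, rfl⟩
      simp [h0]
  have h2 := h1.tendsto a
  simp only [sub_self, CompactlySupportedContinuousMap.zero_apply, norm_zero,
    haarIntegral_zero] at h2
  refine squeeze_zero (fun _ => norm_nonneg _) (fun a' => ?_) h2
  rw [← map_sub]
  exact norm_fourier_le ht _

/-- The Fourier transform in the second variable. -/
def partialFourier (f : C_c(A × K, ℂ)) : C_c(A, C₀(X, ℂ)) where
  toFun a := fourier ht (slice f a)
  continuous_toFun := continuous_fourier_slice ht f
  hasCompactSupport' := HasCompactSupport.intro (f.hasCompactSupport.isCompact.image continuous_fst)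
    fun a ha => by
      have : slice f a = 0 := by
        ext κ
        change f (a, κ) = 0
        exact image_eq_zero_of_notMem_tsupport fun h => ha ⟨(a, κ), h, rfl⟩
      rw [this, map_zero]

theorem partialFourier_apply (f : C_c(A × K, ℂ)) (a : A) :
    partialFourier ht f a = fourier ht (slice f a) := rfl

/-- The function `(a, κ) ↦ p(a) k(κ)`. -/
def tensor (p : C_c(A, ℂ)) (k : C_c(K, ℂ)) : C_c(A × K, ℂ) where
  toFun x := p x.1 * k x.2
  continuous_toFun := by
    have := p.continuous
    have := k.continuous
    fun_prop
  hasCompactSupport' := HasCompactSupport.intro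
    (p.hasCompactSupport.isCompact.prod k.hasCompactSupport.isCompact) fun x hx => by
      rw [Set.mem_prod, not_and_or] at hx
      rcases hx with hx | hx <;> simp [image_eq_zero_of_notMem_tsupport hx]

theorem slice_tensor (p : C_c(A, ℂ)) (k : C_c(K, ℂ)) (a : A) :
    slice (tensor p k) a = p a • k := rfl

end PartialFourier

/-! ### The universal representation -/

section UniversalForm

variable {G : Type u} {H : Type v}
  [TopologicalSpace G] [CommGroup G] [IsTopologicalGroup G] [LocallyCompactSpace G] [T2Space G]
  [TopologicalSpace H] [CommGroup H] [IsTopologicalGroup H] [LocallyCompactSpace H] [T2Space H]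
  {φ : G →ₜ* H}

theorem CovariantRep.nondegenerate' (ρ : CovariantRep φ) : Nondegenerate ρ.π := ρ.nondegenerate

theorem CovariantRep.hasCompactSupport_integrand (ρ : CovariantRep φ) (f : C_c(G, C₀(H, ℂ)))
    (x : ρ.E) : HasCompactSupport fun g : G => ρ.π (f g) ((ρ.U g : ρ.E →L[ℂ] ρ.E) x) :=
  f.hasCompactSupport.mono fun g hg h0 => hg (by simp [h0])

theorem CovariantRep.U_mul_π (ρ : CovariantRep φ) (g : G) (a : C₀(H, ℂ)) :
    (ρ.U g : ρ.E →L[ℂ] ρ.E) * ρ.π a = ρ.π (translate (φ g) a) * ρ.U g := by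
  rw [← ρ.covariant, mul_assoc, Unitary.coe_star_mul_self, mul_one]

theorem norm_repProduct_le (T : RepProduct φ) {C : ℝ} (hC : 0 ≤ C) (h : ∀ ρ, ‖T.component ρ‖ ≤ C) :
    ‖T‖ ≤ C :=
  lp.norm_le_of_forall_le hC h

theorem norm_component_le (T : RepProduct φ) (ρ : CovariantRep φ) : ‖T.component ρ‖ ≤ ‖T‖ :=
  lp.norm_apply_le_norm ENNReal.top_ne_zero _ ρ

/-- A bounded family of operators. -/
def RepProduct.mk (T : ∀ ρ : CovariantRep φ, ρ.E →L[ℂ] ρ.E) (C : ℝ) (h : ∀ ρ, ‖T ρ‖ ≤ C) :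
    RepProduct φ :=
  ⟨T, memℓp_infty ⟨C, by
    rintro _ ⟨ρ, rfl⟩
    exact h ρ⟩⟩

variable (φ) in
/-- The universal representation as a linear map. -/
def universalFormₗ : C_c(G, C₀(H, ℂ)) →ₗ[ℂ] RepProduct φ where
  toFun := universalForm φ
  map_add' f f' := RepProduct.ext fun ρ => ContinuousLinearMap.ext fun x => by
    refine Eq.trans ?_ (haarIntegral_add (ρ.continuous_integrand f x)
      (ρ.hasCompactSupport_integrand f x) (ρ.continuous_integrand f' x)
      (ρ.hasCompactSupport_integrand f' x))
    refine congrArg haarIntegral (funext fun g => ?_)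
    rw [CompactlySupportedContinuousMap.add_apply, map_add]
    rfl
  map_smul' c f := RepProduct.ext fun ρ => ContinuousLinearMap.ext fun x => by
    refine Eq.trans ?_ (haarIntegral_smul c _)
    refine congrArg haarIntegral (funext fun g => ?_)
    rw [CompactlySupportedContinuousMap.smul_apply, map_smul]
    rfl

theorem norm_universalForm_le (f : C_c(G, C₀(H, ℂ))) :
    ‖universalForm φ f‖ ≤ haarIntegral fun g : G => ‖f g‖ :=
  norm_repProduct_le _ (haarIntegral_nonneg fun _ => norm_nonneg _)
    fun ρ => ρ.norm_integratedForm_le f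

/-- The crossed product is generated by the images of any `L¹`-dense subspace of `C_c(G, C₀(H))`. -/
theorem universalForm_mem_closure {ι : Type*} {r : ι → C₀(H, ℂ)} (hr : DenseRange r)
    {S : Submodule ℂ (RepProduct φ)} (hS : ∀ p i, universalForm φ (smulConst p (r i)) ∈ S)
    (x : C_c(G, C₀(H, ℂ))) : universalForm φ x ∈ closure (S : Set (RepProduct φ)) := by
  refine Metric.mem_closure_iff.2 fun ε hε => ?_
  obtain ⟨y, hy, hxy⟩ := exists_haarIntegral_norm_sub_le hr (S := S.comap (universalFormₗ φ)) hS x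
    (half_pos hε)
  refine ⟨universalFormₗ φ y, hy, ?_⟩
  rw [dist_eq_norm]
  change ‖universalFormₗ φ x - _‖ < ε
  rw [← map_sub]
  exact ((norm_universalForm_le _).trans hxy).trans_lt (half_lt_self hε)

variable (φ) in
/-- The inclusion of the crossed product in the universal representation. -/
def CrossedProduct.incl : CrossedProduct φ →⋆ₙₐ[ℂ] RepProduct φ :=
  NonUnitalStarSubalgebraClass.subtype (crossedProductSubalgebra φ)

theorem CrossedProduct.incl_injective : Function.Injective (CrossedProduct.incl φ) :=
  Subtype.val_injective

theorem CrossedProduct.incl_mem (x : CrossedProduct φ) :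
    CrossedProduct.incl φ x ∈ crossedProductSubalgebra φ := x.2

end UniversalForm

/-- Strong continuity is joint continuity here because unitaries are isometric; joint continuity is
what Fubini requires. -/
theorem continuous_unitary_apply {A K E : Type*} [TopologicalSpace A] [TopologicalSpace K]
    [NormedAddCommGroup E] [InnerProductSpace ℂ E] [CompleteSpace E] {V : K → unitary (E →L[ℂ] E)}
    (hV : ∀ x : E, Continuous fun κ => (V κ : E →L[ℂ] E) x) {w : A → E} (hw : Continuous w) :
    Continuous fun p : A × K => (V p.2 : E →L[ℂ] E) (w p.1) := by
  refine continuous_iff_continuousAt.2 fun p => tendsto_iff_norm_sub_tendsto_zero.2 ?_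
  have h1 : Continuous fun q : A × K =>
      ‖w q.1 - w p.1‖ + ‖(V q.2 : E →L[ℂ] E) (w p.1) - (V p.2 : E →L[ℂ] E) (w p.1)‖ := by
    have := (hV (w p.1)).comp (continuous_snd (X := A))
    exact (by fun_prop : Continuous fun q : A × K => ‖w q.1 - w p.1‖).add
      (this.sub continuous_const).norm
  have h2 := h1.tendsto p
  simp only [sub_self, norm_zero, add_zero] at h2
  refine squeeze_zero (fun _ => norm_nonneg _) (fun q => ?_) h2
  rw [← norm_unitary_apply (V q.2) (w q.1 - w p.1), map_sub]
  exact norm_sub_le_norm_sub_add_norm_sub _ _ _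

/-! ### Fourier transformation of covariant representations -/

section FourierData

variable {K₁ X₁ : Type v} {K₂ X₂ : Type u}
  [TopologicalSpace K₁] [CommGroup K₁] [IsTopologicalGroup K₁] [LocallyCompactSpace K₁] [T2Space K₁]
  [TopologicalSpace X₁] [CommGroup X₁] [IsTopologicalGroup X₁] [LocallyCompactSpace X₁] [T2Space X₁]
  [TopologicalSpace K₂] [CommGroup K₂] [IsTopologicalGroup K₂] [LocallyCompactSpace K₂] [T2Space K₂]
  [TopologicalSpace X₂] [CommGroup X₂] [IsTopologicalGroup X₂] [LocallyCompactSpace X₂] [T2Space X₂]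

/-- Two homomorphisms which are, up to inversion, dual to each other for the given pairings. -/
structure IsFourierData (φ : K₂ →ₜ* X₁) (φ' : K₁ →ₜ* X₂) (t₁ : X₁ →ₜ* PontryaginDual K₁)
    (t₂ : X₂ →ₜ* PontryaginDual K₂) : Prop where
  pairing₁ : IsDualPairing t₁
  pairing₂ : IsDualPairing t₂
  apply_eq : ∀ κ₁ κ₂, t₂ (φ' κ₁) κ₂ = (t₁ (φ κ₂) κ₁)⁻¹

variable {φ : K₂ →ₜ* X₁} {φ' : K₁ →ₜ* X₂} {t₁ : X₁ →ₜ* PontryaginDual K₁}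
  {t₂ : X₂ →ₜ* PontryaginDual K₂}

theorem IsFourierData.symm (D : IsFourierData φ φ' t₁ t₂) : IsFourierData φ' φ t₂ t₁ :=
  ⟨D.pairing₂, D.pairing₁, fun κ₂ κ₁ => by rw [D.apply_eq, inv_inv]⟩

variable (D : IsFourierData φ φ' t₁ t₂)

include D in
theorem IsFourierData.dualRep_mul_U (ρ : CovariantRep φ) (κ₁ : K₁) (κ₂ : K₂) :
    (dualRep t₁ ρ.nondegenerate' κ₁ : ρ.E →L[ℂ] ρ.E) * ρ.U κ₂ =
      (t₁ (φ κ₂) κ₁ : ℂ) • ((ρ.U κ₂ : ρ.E →L[ℂ] ρ.E) * dualRep t₁ ρ.nondegenerate' κ₁) := by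
  rw [coe_dualRep, mul_multiplier_of_translate ρ.nondegenerate' (ρ.U_mul_π κ₂), smul_smul,
    dualTranspose_apply, Complex.mul_conj', Circle.norm_coe]
  simp

/-- The covariant representation of `φ'` obtained from one of `φ` by Fourier transformation. -/
def IsFourierData.transport (ρ : CovariantRep φ) : CovariantRep φ' where
  E := ρ.E
  π := dualStarRep D.pairing₂ ρ.continuous_U
  U := dualRep t₁ ρ.nondegenerate'
  nondegenerate := nondegenerate_dualStarRep _ _
  continuous_U := continuous_dualRep _
  covariant κ₁ a := by
    -- The Weyl relation lets the unitary of κ₁ commute with U up to the character of φ'(κ₁)⁻¹, so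
    -- it implements translation by φ'(κ₁); `apply_eq` supplies the inverse.
    rw [mul_dualStarRep_of_smul D.pairing₂ ρ.continuous_U (x := φ' κ₁) fun κ₂ => ?_, mul_assoc]
    · exact (congrArg _ (Unitary.coe_mul_star_self _)).trans (mul_one _)
    rw [D.dualRep_mul_U, map_inv, dual_inv_apply, D.apply_eq, inv_inv]

/-- The function `(κ₁, κ₂) ↦ f(κ₂, κ₁) t₁(φ(κ₂))(κ₁)`. -/
def twist (φ : K₂ →ₜ* X₁) (t₁ : X₁ →ₜ* PontryaginDual K₁) (f : C_c(K₂ × K₁, ℂ)) :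
    C_c(K₁ × K₂, ℂ) where
  toFun p := f p.swap * (t₁ (φ p.2) p.1 : ℂ)
  continuous_toFun := (f.continuous.comp continuous_swap).mul
    ((continuous_pairing t₁).comp
      (f := fun p : K₁ × K₂ => (φ p.2, p.1)) (by have := φ.continuous_toFun; fun_prop))
  hasCompactSupport' := (f.hasCompactSupport.comp_homeomorph (Homeomorph.prodComm K₁ K₂)).mul_right

theorem twist_apply (f : C_c(K₂ × K₁, ℂ)) (κ₁ : K₁) (κ₂ : K₂) :
    twist φ t₁ f (κ₁, κ₂) = f (κ₂, κ₁) * (t₁ (φ κ₂) κ₁ : ℂ) := rfl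

include D in
theorem IsFourierData.twist_twist (f : C_c(K₂ × K₁, ℂ)) : twist φ' t₂ (twist φ t₁ f) = f := by
  ext ⟨κ₂, κ₁⟩
  rw [twist_apply, twist_apply, D.apply_eq, mul_assoc, ← Circle.coe_mul, mul_inv_cancel,
    Circle.coe_one, mul_one]

/-- Both operators are the double integral of f(κ₂, κ₁) V(κ₁)U(κ₂): one integrates κ₁ first; the
other integrates κ₂ first and has the opposite operator order, and the factor in `twist` is exactly
the Weyl phase that restores it. -/
theorem IsFourierData.integratedForm_transport (ρ : CovariantRep φ) (f : C_c(K₂ × K₁, ℂ)) :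
    (D.transport ρ).integratedForm
        (partialFourier D.pairing₂.tendsto_cocompact (twist φ t₁ f)) =
      ρ.integratedForm (partialFourier D.pairing₁.tendsto_cocompact f) := by
  refine ContinuousLinearMap.ext fun (ξ : ρ.E) => ?_
  let V : K₁ → ρ.E →L[ℂ] ρ.E := fun κ₁ => dualRep t₁ ρ.nondegenerate' κ₁
  let W : K₂ → K₁ → ρ.E := fun κ₂ κ₁ => f (κ₂, κ₁) • V κ₁ ((ρ.U κ₂ : ρ.E →L[ℂ] ρ.E) ξ)
  have h1 : ρ.integratedForm (partialFourier D.pairing₁.tendsto_cocompact f) ξ =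
      haarIntegral fun κ₂ => haarIntegral fun κ₁ => W κ₂ κ₁ := by
    rw [CovariantRep.integratedForm_apply]
    congr 1
    ext1 κ₂
    rw [partialFourier_apply, rep_fourier_eq _ ρ.nondegenerate', unitaryIntegral_apply]
    rfl
  have h2 : (haarIntegral fun κ₁ => dualStarRep D.pairing₂ ρ.continuous_U
      (fourier D.pairing₂.tendsto_cocompact (slice (twist φ t₁ f) κ₁)) (V κ₁ ξ)) =
      haarIntegral fun κ₁ => haarIntegral fun κ₂ => W κ₂ κ₁ := by
    congr 1
    ext1 κ₁
    rw [dualStarRep_fourier, unitaryIntegral_apply]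
    congr 1
    ext1 κ₂
    have := DFunLike.congr_fun (D.dualRep_mul_U ρ κ₁ κ₂) ξ
    simp only [W, slice_apply, twist_apply]
    rw [mul_smul]
    exact congrArg _ this.symm
  have h3 : (haarIntegral fun κ₂ => haarIntegral fun κ₁ => W κ₂ κ₁) =
      haarIntegral fun κ₁ => haarIntegral fun κ₂ => W κ₂ κ₁ :=
    haarIntegral_swap
      (f.continuous.smul
        (continuous_unitary_apply (continuous_dualRep ρ.nondegenerate') (ρ.continuous_U ξ)))
      f.hasCompactSupport.smul_right
  exact h2.trans (h3.symm.trans h1.symm)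

theorem continuous_nonUnitalStarAlgHom {A B : Type*} [NonUnitalCStarAlgebra A]
    [NonUnitalCStarAlgebra B] (π : A →⋆ₙₐ[ℂ] B) : Continuous π :=
  AddMonoidHomClass.continuous_of_bound π 1
    (by simpa using fun x => NonUnitalStarAlgHom.norm_apply_le π x)

/-- The crossed product is generated by the partial Fourier transforms. -/
theorem crossedProductSubalgebra_le (h : IsDualPairing t₁)
    {A : NonUnitalStarSubalgebra ℂ (RepProduct φ)} (hA : IsClosed (A : Set (RepProduct φ)))
    (hmem : ∀ f, universalForm φ (partialFourier h.tendsto_cocompact f) ∈ A) :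
    crossedProductSubalgebra φ ≤ A := by
  refine NonUnitalStarSubalgebra.topologicalClosure_minimal _
    (NonUnitalStarAlgebra.adjoin_le ?_) hA
  rintro _ ⟨x, rfl⟩
  have := universalForm_mem_closure h.denseRange (S := A.toSubmodule) (φ := φ) (fun p k => ?_) x
  · exact hA.closure_eq.subset this
  · have h1 := hmem (tensor p k)
    have h2 : partialFourier h.tendsto_cocompact (tensor p k) =
        smulConst p (fourier h.tendsto_cocompact k) := by
      ext1 a
      rw [partialFourier_apply, slice_tensor, map_smul, smulConst_apply]
    rwa [h2] at h1

/-- Reindexing of families of operators along the Fourier transformation of representations. -/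
def IsFourierData.reindex : RepProduct φ' →⋆ₙₐ[ℂ] RepProduct φ where
  toFun T := RepProduct.mk (fun ρ => T.component (D.transport ρ)) ‖T‖
    fun ρ => norm_component_le T (D.transport ρ)
  map_smul' _ _ := rfl
  map_zero' := rfl
  map_add' _ _ := rfl
  map_mul' _ _ := rfl
  map_star' _ := rfl

theorem IsFourierData.reindex_universalForm (f : C_c(K₂ × K₁, ℂ)) :
    D.reindex (universalForm φ'
      (partialFourier D.pairing₂.tendsto_cocompact (twist φ t₁ f))) =
      universalForm φ (partialFourier D.pairing₁.tendsto_cocompact f) :=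
  RepProduct.ext fun ρ => D.integratedForm_transport ρ f

theorem IsFourierData.reindex_universalForm' (f : C_c(K₁ × K₂, ℂ)) :
    D.reindex (universalForm φ' (partialFourier D.pairing₂.tendsto_cocompact f)) =
      universalForm φ (partialFourier D.pairing₁.tendsto_cocompact (twist φ' t₂ f)) := by
  rw [← D.reindex_universalForm, D.symm.twist_twist]

theorem IsFourierData.reindex_mem {T : RepProduct φ'} (hT : T ∈ crossedProductSubalgebra φ') :
    D.reindex T ∈ crossedProductSubalgebra φ := by
  refine crossedProductSubalgebra_le D.pairing₂
    (A := (crossedProductSubalgebra φ).comap D.reindex) ?_ (fun f => ?_) hT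
  · exact IsClosed.preimage (continuous_nonUnitalStarAlgHom D.reindex)
      (NonUnitalStarSubalgebra.isClosed_topologicalClosure _)
  · rw [NonUnitalStarSubalgebra.mem_comap, D.reindex_universalForm']
    exact CrossedProduct.incl_mem (CrossedProduct.ofFunction φ _)

/-- It is enough to compare on the generating partial Fourier transforms, so the twice transported
representation need not be identified with the original one. -/
theorem IsFourierData.reindex_reindex {T : RepProduct φ} (hT : T ∈ crossedProductSubalgebra φ) :
    D.reindex (D.symm.reindex T) = T := by
  refine crossedProductSubalgebra_le D.pairing₁
    (A := NonUnitalStarAlgHom.equalizer (D.reindex.comp D.symm.reindex)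
      (NonUnitalStarAlgHom.id ℂ _)) ?_ (fun f => ?_) hT
  · exact isClosed_eq (continuous_nonUnitalStarAlgHom (D.reindex.comp D.symm.reindex))
      continuous_id
  · change D.reindex (D.symm.reindex _) = _
    rw [D.symm.reindex_universalForm', D.reindex_universalForm]
    rfl

/-- The isomorphism of crossed products given by the Fourier transformation. -/
def IsFourierData.equiv : CrossedProduct φ ≃⋆ₐ[ℂ] CrossedProduct φ' where
  toFun x := ⟨D.symm.reindex (CrossedProduct.incl φ x), D.symm.reindex_mem x.2⟩
  invFun y := ⟨D.reindex (CrossedProduct.incl φ' y), D.reindex_mem y.2⟩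
  left_inv x := CrossedProduct.incl_injective (D.reindex_reindex x.2)
  right_inv y := CrossedProduct.incl_injective (D.symm.reindex_reindex y.2)
  map_mul' x y := CrossedProduct.incl_injective (map_mul (D.symm.reindex.comp (CrossedProduct.incl φ)) x y)
  map_add' x y := CrossedProduct.incl_injective (map_add (D.symm.reindex.comp (CrossedProduct.incl φ)) x y)
  map_star' x := CrossedProduct.incl_injective (map_star (D.symm.reindex.comp (CrossedProduct.incl φ)) x)
  map_smul' c x := CrossedProduct.incl_injective (map_smul (D.symm.reindex.comp (CrossedProduct.incl φ)) c x)

theorem IsFourierData.equiv_ofFunction (f : C_c(K₂ × K₁, ℂ)) :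
    D.equiv (CrossedProduct.ofFunction φ (partialFourier D.pairing₁.tendsto_cocompact f)) =
      CrossedProduct.ofFunction φ'
        (partialFourier D.pairing₂.tendsto_cocompact (twist φ t₁ f)) :=
  CrossedProduct.incl_injective (D.symm.reindex_universalForm' f)

end FourierData

section Fourier

variable {G : Type u} {H : Type v}
  [TopologicalSpace G] [CommGroup G] [IsTopologicalGroup G] [LocallyCompactSpace G] [T2Space G]
  [TopologicalSpace H] [CommGroup H] [IsTopologicalGroup H] [LocallyCompactSpace H] [T2Space H]
  (φ : G →ₜ* H)

/-- Pairing G with its dual through inversion produces the conjugate of ψ in the transform, and the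
inverse required in `apply_eq`. -/
theorem isFourierData : IsFourierData φ (PontryaginDual.map φ) (doubleDual H) (dualInv G) where
  pairing₁ := isDualPairing_doubleDual
  pairing₂ := isDualPairing_dualInv
  apply_eq χ g := by
    rw [dualInv_apply, dual_inv_apply]
    rfl

theorem isFourierTransform_equiv : IsFourierTransform φ (isFourierData φ).equiv := fun f =>
  ⟨_, _, fun g h => rfl, fun χ ψ => by
    refine congrArg haarIntegral (funext fun g => ?_)
    rw [slice_apply, twist_apply, dualInv_apply, dual_inv_apply, Circle.coe_inv_eq_conj]
    rfl, (isFourierData φ).equiv_ofFunction f⟩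

end Fourier

/-! ### Discrete groups and means over compact groups -/

section Discrete

variable {G : Type*} [TopologicalSpace G] [Group G] [IsTopologicalGroup G] [LocallyCompactSpace G]
  [DiscreteTopology G]

variable (G) in
/-- The Haar measure of a point of a discrete group. -/
def haarMass : ℝ :=
  letI : MeasurableSpace G := borel G
  haveI : BorelSpace G := ⟨rfl⟩
  (Measure.haar : Measure G).real {1}

theorem haarMass_eq [MeasurableSpace G] [BorelSpace G] :
    haarMass G = (Measure.haar : Measure G).real {1} := by
  borelize G
  rfl

theorem haarMass_ne_zero : haarMass G ≠ 0 := by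
  borelize G
  rw [haarMass_eq]
  exact ENNReal.toReal_ne_zero.2 ⟨(isOpen_discrete _).measure_ne_zero _ (Set.singleton_nonempty _),
    (isCompact_singleton (x := (1 : G))).measure_ne_top⟩

theorem haarIntegral_eq_sum {E : Type*} [NormedAddCommGroup E] [NormedSpace ℝ E] [CompleteSpace E]
    {f : G → E} {s : Finset G} (hs : ∀ g ∉ s, f g = 0) :
    haarIntegral f = haarMass G • ∑ g ∈ s, f g := by
  borelize G
  rw [haarIntegral_eq, haarMass_eq, Finset.smul_sum,
    ← setIntegral_eq_integral_of_forall_compl_eq_zero (s := (s : Set G)) (by simpa using hs),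
    setIntegral_finset]
  · refine Finset.sum_congr rfl fun g _ => ?_
    congr 1
    have h := measure_preimage_mul (Measure.haar : Measure G) g⁻¹ {1}
    have h1 : (fun x => g⁻¹ * x) ⁻¹' {1} = {g} := by
      ext x
      simp [eq_comm]
    rw [h1] at h
    rw [measureReal_def, h, measureReal_def]
  · exact continuous_of_discreteTopology.continuousOn.integrableOn_compact
      s.finite_toSet.isCompact

end Discrete

section Mean

variable {K : Type*} [TopologicalSpace K] [CommGroup K] [IsTopologicalGroup K] [CompactSpace K]
  {E : Type*} [NormedAddCommGroup E] [NormedSpace ℂ E]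

/-- The mean of a function over a compact group. -/
def mean (f : K → E) : E := (haarIntegral fun _ : K => (1 : ℝ))⁻¹ • haarIntegral f

theorem hasCompactSupport_of_compactSpace {E : Type*} [Zero E] (f : K → E) : HasCompactSupport f :=
  HasCompactSupport.of_compactSpace f

theorem haarIntegral_one_pos : 0 < haarIntegral fun _ : K => (1 : ℝ) := by
  refine (haarIntegral_nonneg fun _ => zero_le_one).lt_of_ne fun h => ?_
  exact one_ne_zero (eq_zero_of_haarIntegral_eq_zero continuous_const
    (hasCompactSupport_of_compactSpace _) (fun _ => zero_le_one) h.symm (1 : K))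

theorem mean_add {f f' : K → E} (hf : Continuous f) (hf' : Continuous f') :
    mean (fun κ => f κ + f' κ) = mean f + mean f' := by
  rw [mean, haarIntegral_add hf (hasCompactSupport_of_compactSpace _) hf'
    (hasCompactSupport_of_compactSpace _), smul_add]
  rfl

theorem mean_smul (c : ℂ) (f : K → E) : mean (fun κ => c • f κ) = c • mean f := by
  rw [mean, haarIntegral_smul, smul_comm]
  rfl

theorem map_mean {F : Type*} [NormedAddCommGroup F] [NormedSpace ℂ F] [CompleteSpace E]
    [CompleteSpace F] (L : E →L[ℂ] F) {f : K → E} (hf : Continuous f) :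
    L (mean f) = mean fun κ => L (f κ) := by
  rw [mean, mean, L.haarIntegral_comp_comm hf (hasCompactSupport_of_compactSpace _)]
  exact (L.restrictScalars ℝ).map_smul _ _

theorem mean_const [CompleteSpace E] (e : E) : mean (fun _ : K => e) = e := by
  borelize K
  have h := haarIntegral_one_pos (K := K)
  rw [mean]
  simp only [haarIntegral_eq, integral_const, smul_eq_mul, mul_one] at h ⊢
  rw [smul_smul, inv_mul_cancel₀ h.ne', one_smul]

theorem mean_mul_left (f : K → E) (κ : K) : mean (fun x => f (κ * x)) = mean f := by
  rw [mean, haarIntegral_mul_left]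
  rfl

theorem norm_mean_le {f : K → E} (hf : Continuous f) {C : ℝ} (h : ∀ κ, ‖f κ‖ ≤ C) :
    ‖mean f‖ ≤ C := by
  have h1 := haarIntegral_one_pos (K := K)
  rw [mean, norm_smul, norm_inv, Real.norm_of_nonneg h1.le, inv_mul_le_iff₀ h1]
  calc _ ≤ haarIntegral fun κ => ‖f κ‖ := norm_haarIntegral_le _
    _ ≤ haarIntegral fun _ : K => 1 * C := haarIntegral_mono hf.norm
        (hasCompactSupport_of_compactSpace _) continuous_const (hasCompactSupport_of_compactSpace _)
        (by simpa using h)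
    _ = _ := haarIntegral_real_mul_const _ _

theorem mean_ofReal (f : K → ℝ) : mean (fun κ => (f κ : ℂ)) =
    (((haarIntegral fun _ : K => (1 : ℝ))⁻¹ * haarIntegral f : ℝ) : ℂ) := by
  rw [mean, haarIntegral_ofReal, Complex.ofReal_mul]
  rfl

theorem mean_ofReal_nonneg {f : K → ℝ} (h : ∀ κ, 0 ≤ f κ) :
    0 ≤ (mean fun κ => (f κ : ℂ)).re := by
  rw [mean_ofReal, Complex.ofReal_re]
  exact mul_nonneg (inv_nonneg.2 haarIntegral_one_pos.le) (haarIntegral_nonneg h)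

theorem eq_zero_of_mean_eq_zero {f : K → ℝ} (hf : Continuous f) (h : ∀ κ, 0 ≤ f κ)
    (h0 : mean (fun κ => (f κ : ℂ)) = 0) (κ : K) : f κ = 0 := by
  rw [mean_ofReal, Complex.ofReal_eq_zero, mul_eq_zero, inv_eq_zero,
    or_iff_right haarIntegral_one_pos.ne'] at h0
  exact eq_zero_of_haarIntegral_eq_zero hf (hasCompactSupport_of_compactSpace _) h h0 κ

/-- The mean of a nontrivial character vanishes. -/
theorem mean_character {θ : PontryaginDual K} (hθ : θ ≠ 1) : mean (fun κ => (θ κ : ℂ)) = 0 := by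
  obtain ⟨κ, hκ⟩ : ∃ κ, θ κ ≠ 1 := by
    by_contra! h
    exact hθ (PontryaginDual.ext h)
  have h1 := mean_mul_left (fun κ => (θ κ : ℂ)) κ
  simp only [map_mul, Circle.coe_mul] at h1
  have h2 := mean_smul (θ κ : ℂ) fun κ => (θ κ : ℂ)
  simp only [smul_eq_mul] at h2
  rw [h2] at h1
  have h3 : ((θ κ : ℂ) - 1) * mean (fun κ => (θ κ : ℂ)) = 0 := by rw [sub_mul, h1, one_mul, sub_self]
  refine (mul_eq_zero.1 h3).resolve_left fun h => hκ ?_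
  exact Circle.ext (by simpa using sub_eq_zero.1 h)

end Mean

section ComposeZero

variable {X : Type*} [TopologicalSpace X]

/-- Composition of a function vanishing at infinity with a function vanishing at zero. -/
def compZero (f : ℂ → ℂ) (hf : Continuous f) (h0 : f 0 = 0) (a : C₀(X, ℂ)) : C₀(X, ℂ) where
  toFun x := f (a x)
  continuous_toFun := hf.comp a.continuous
  zero_at_infty' := (hf.tendsto' 0 0 h0).comp a.zero_at_infty'

@[simp]
theorem compZero_apply (f : ℂ → ℂ) (hf : Continuous f) (h0 : f 0 = 0) (a : C₀(X, ℂ)) (x : X) :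
    compZero f hf h0 a x = f (a x) := rfl

/-- The square root of the positive part of the real part. -/
def sqrtRe : C₀(X, ℂ) → C₀(X, ℂ) :=
  compZero (fun z => (√z.re : ℂ)) (by fun_prop) (by simp)

theorem sqrtRe_apply (a : C₀(X, ℂ)) (x : X) : sqrtRe a x = (√(a x).re : ℂ) := rfl

theorem star_sqrtRe_mul_sqrtRe {a : C₀(X, ℂ)} (h : ∀ x, 0 ≤ (a x).re ∧ (a x).im = 0) :
    star (sqrtRe a) * sqrtRe a = a := by
  ext x
  rw [ZeroAtInftyContinuousMap.mul_apply, ZeroAtInftyContinuousMap.star_apply, sqrtRe_apply,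
    Complex.star_def, Complex.conj_ofReal, ← Complex.ofReal_mul, Real.mul_self_sqrt (h x).1]
  exact Complex.ext rfl (h x).2.symm

end ComposeZero

/-! ### A covariant representation faithful on `C₀(H)` -/

section FaithfulRepresentation

theorem Nondegenerate.conj {X : Type*} [TopologicalSpace X] {E E' : Type*} [NormedAddCommGroup E]
    [InnerProductSpace ℂ E] [CompleteSpace E] [NormedAddCommGroup E'] [InnerProductSpace ℂ E']
    [CompleteSpace E'] {π : C₀(X, ℂ) →⋆ₙₐ[ℂ] (E →L[ℂ] E)} (hπ : Nondegenerate π) (e : E ≃ₗᵢ[ℂ] E') :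
    Nondegenerate ((e.conjStarAlgEquiv : (E →L[ℂ] E) →⋆ₙₐ[ℂ] (E' →L[ℂ] E')).comp π) := by
  rw [Nondegenerate, ← Submodule.dense_iff_topologicalClosure_eq_top] at hπ ⊢
  have h := e.surjective.denseRange.dense_image e.continuous hπ
  refine h.mono ?_
  rintro _ ⟨y, hy, rfl⟩
  refine Submodule.span_induction (p := fun y _ => e y ∈ Submodule.span ℂ _) ?_ ?_ ?_ ?_ hy
  · rintro _ ⟨a, x, rfl⟩
    refine Submodule.subset_span ⟨a, e x, ?_⟩
    change _ = e (π a (e.symm (e x)))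
    rw [e.symm_apply_apply]
  · rw [map_zero]
    exact Submodule.zero_mem _
  · intro x y _ _ hx hy
    rw [map_add]
    exact Submodule.add_mem _ hx hy
  · intro c x _ hx
    rw [map_smul]
    exact Submodule.smul_mem _ c hx

/-- A Hilbert space as an `ℓ²`-sum with a single summand, in a larger universe. -/
def liftIsometry (E : Type v) [NormedAddCommGroup E] [InnerProductSpace ℂ E] :
    E ≃ₗᵢ[ℂ] PiLp 2 fun _ : PUnit.{u + 1} => E where
  toFun x := WithLp.toLp 2 fun _ => x
  invFun x := x PUnit.unit
  left_inv _ := rfl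
  right_inv _ := rfl
  map_add' _ _ := rfl
  map_smul' _ _ := rfl
  norm_map' x := by
    rw [PiLp.norm_eq_of_L2]
    exact (congrArg Real.sqrt (Finset.sum_singleton _ _)).trans (Real.sqrt_sq (norm_nonneg x))

variable {G : Type u} {H : Type v}
  [TopologicalSpace G] [CommGroup G] [IsTopologicalGroup G] [LocallyCompactSpace G] [T2Space G]
  [TopologicalSpace H] [CommGroup H] [IsTopologicalGroup H] [LocallyCompactSpace H] [T2Space H]

/-- A covariant representation which is faithful on `C₀(H)`. -/
theorem exists_covariantRep_injective (φ : G →ₜ* H) :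
    ∃ ρ : CovariantRep φ, Function.Injective ρ.π := by
  borelize H
  -- `CovariantRep` asks for a space in the larger universe, so L²(H) is replaced by an isometric
  -- copy there.
  let e : L2 H ≃ₗᵢ[ℂ] _ := liftIsometry.{u} (L2 H)
  refine ⟨{
    E := PiLp 2 fun _ : PUnit.{u + 1} => L2 H
    π := (e.conjStarAlgEquiv : _ →⋆ₙₐ[ℂ] _).comp (mulRep H)
    U := unitaryRepOfIsometry (fun g => e.conjStarAlgEquiv (regularRep H (φ g) : L2 H →L[ℂ] L2 H))
      (by simp) (fun g g' => by simp) (fun g x => by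
        change ‖e ((regularRep H (φ g) : L2 H →L[ℂ] L2 H) (e.symm x))‖ = _
        rw [e.norm_map, norm_unitary_apply, e.symm.norm_map])
    nondegenerate := nondegenerate_mulRep.conj e
    continuous_U := fun x => e.continuous.comp
      ((continuous_regularRep (e.symm x)).comp φ.continuous_toFun)
    covariant := fun g a => ?_ }, ?_⟩
  · change e.conjStarAlgEquiv _ * e.conjStarAlgEquiv (mulRep H a) * star (e.conjStarAlgEquiv _) =
      e.conjStarAlgEquiv (mulRep H (translate (φ g) a))
    rw [← map_star, ← map_mul, ← map_mul, regularRep_mul_mulRep, mul_assoc]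
    exact congrArg e.conjStarAlgEquiv
      ((congrArg _ (Unitary.coe_mul_star_self _)).trans (mul_one _))
  · exact e.conjStarAlgEquiv.injective.comp mulRep_injective

end FaithfulRepresentation

section Reps

variable {G : Type u} {H : Type v}
  [TopologicalSpace G] [CommGroup G] [IsTopologicalGroup G] [LocallyCompactSpace G] [T2Space G]
  [TopologicalSpace H] [CommGroup H] [IsTopologicalGroup H] [LocallyCompactSpace H] [T2Space H]
  {φ : G →ₜ* H}

/-- The representation of the crossed product given by a covariant representation. -/
def CrossedProduct.rep (ρ : CovariantRep φ) : CrossedProduct φ →⋆ₙₐ[ℂ] (ρ.E →L[ℂ] ρ.E) where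
  toFun x := (CrossedProduct.incl φ x).component ρ
  map_smul' _ _ := rfl
  map_zero' := rfl
  map_add' _ _ := rfl
  map_mul' _ _ := rfl
  map_star' _ := rfl

theorem CrossedProduct.rep_ext {x y : CrossedProduct φ}
    (h : ∀ ρ, CrossedProduct.rep ρ x = CrossedProduct.rep ρ y) : x = y :=
  CrossedProduct.incl_injective (RepProduct.ext h)

theorem CovariantRep.star_U (ρ : CovariantRep φ) (g : G) :
    star (ρ.U g : ρ.E →L[ℂ] ρ.E) = ρ.U g⁻¹ := by
  rw [map_inv]
  rfl

/-- The product of a covariant representation and a character. -/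
def CovariantRep.twist (ρ : CovariantRep φ) (ψ : PontryaginDual G) : CovariantRep φ where
  E := ρ.E
  π := ρ.π
  U := unitaryRepOfIsometry (fun g => (ψ g : ℂ) • (ρ.U g : ρ.E →L[ℂ] ρ.E)) (by simp)
    (fun g g' => by
      rw [map_mul, map_mul, Circle.coe_mul, Submonoid.coe_mul, smul_mul_smul_comm])
    (fun g x => by
      rw [smul_apply, norm_smul, Circle.norm_coe, one_mul, norm_unitary_apply])
  nondegenerate := ρ.nondegenerate
  continuous_U x := (continuous_circle_coe.comp ψ.continuous_toFun).smul (ρ.continuous_U x)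
  covariant g a := by
    change ((ψ g : ℂ) • (ρ.U g : ρ.E →L[ℂ] ρ.E)) * ρ.π a *
      star ((ψ g : ℂ) • (ρ.U g : ρ.E →L[ℂ] ρ.E)) = ρ.π (translate (φ g) a)
    rw [star_smul, smul_mul_assoc, smul_mul_smul_comm, ρ.covariant, Complex.star_def,
      Complex.mul_conj', Circle.norm_coe]
    simp

end Reps

/-! ### Crossed products by discrete groups -/

section DiscreteCrossedProduct

variable {G : Type u} {H : Type v}
  [TopologicalSpace G] [CommGroup G] [IsTopologicalGroup G] [LocallyCompactSpace G] [T2Space G]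
  [DiscreteTopology G]
  [TopologicalSpace H] [CommGroup H] [IsTopologicalGroup H] [LocallyCompactSpace H] [T2Space H]
  {φ : G →ₜ* H}

open Classical in
/-- The function with value `1` at `g` and `0` elsewhere. -/
def pointMass (g : G) : C_c(G, ℂ) where
  toFun g' := if g' = g then 1 else 0
  continuous_toFun := continuous_of_discreteTopology
  hasCompactSupport' := HasCompactSupport.intro (isCompact_singleton (x := g)) fun _ h => if_neg h

theorem CovariantRep.integratedForm_eq_sum (ρ : CovariantRep φ) (f : C_c(G, C₀(H, ℂ)))
    {s : Finset G} (hs : ∀ g ∉ s, f g = 0) :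
    ρ.integratedForm f = haarMass G • ∑ g ∈ s, ρ.π (f g) * ρ.U g := by
  ext x
  rw [CovariantRep.integratedForm_apply, haarIntegral_eq_sum (s := s) fun g hg => by simp [hs g hg],
    smul_apply, sum_apply]
  rfl

theorem norm_π_mul_U_le (ρ : CovariantRep φ) (g : G) (a : C₀(H, ℂ)) :
    ‖ρ.π a * (ρ.U g : ρ.E →L[ℂ] ρ.E)‖ ≤ ‖a‖ := by
  rw [CStarRing.norm_mul_coe_unitary]
  exact ρ.norm_π_le a

variable (φ) in
/-- The element `a u_g` of the crossed product. -/
def monomial (g : G) : C₀(H, ℂ) →ₗ[ℂ] CrossedProduct φ where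
  toFun a := ⟨RepProduct.mk (fun ρ => ρ.π a * ρ.U g) ‖a‖ fun ρ => norm_π_mul_U_le ρ g a, by
    -- The integrated form of a point mass carries the Haar mass of a point as a factor, since Haar
    -- measure need not be counting measure.
    have h : RepProduct.mk (fun ρ : CovariantRep φ => ρ.π a * (ρ.U g : ρ.E →L[ℂ] ρ.E)) ‖a‖
        (fun ρ => norm_π_mul_U_le ρ g a) =
        ((haarMass G)⁻¹ : ℂ) • universalForm φ (smulConst (pointMass g) a) := by
      refine RepProduct.ext fun ρ => ?_
      change ρ.π a * (ρ.U g : ρ.E →L[ℂ] ρ.E) =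
        ((haarMass G)⁻¹ : ℂ) • ρ.integratedForm (smulConst (pointMass g) a)
      rw [ρ.integratedForm_eq_sum _ (s := {g}) fun g' hg' => by
        simp [pointMass, Finset.mem_singleton.not.1 hg'], Finset.sum_singleton,
        ← Complex.coe_smul, smul_smul,
        inv_mul_cancel₀ (Complex.ofReal_ne_zero.2 haarMass_ne_zero), one_smul]
      simp [pointMass]
    rw [h]
    exact SMulMemClass.smul_mem _ (CrossedProduct.ofFunction φ _).2⟩
  map_add' a b := CrossedProduct.rep_ext fun ρ => by
    change ρ.π (a + b) * _ = ρ.π a * _ + ρ.π b * _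
    rw [map_add, add_mul]
  map_smul' c a := CrossedProduct.rep_ext fun ρ => by
    change ρ.π (c • a) * _ = c • (ρ.π a * _)
    rw [map_smul, smul_mul_assoc]

@[simp]
theorem rep_monomial (ρ : CovariantRep φ) (g : G) (a : C₀(H, ℂ)) :
    CrossedProduct.rep ρ (monomial φ g a) = ρ.π a * ρ.U g := rfl

@[simp]
theorem rep_coeffHom (ρ : CovariantRep φ) (a : C₀(H, ℂ)) :
    CrossedProduct.rep ρ (coeffHom φ a) = ρ.π a := rfl

theorem coeffHom_eq_monomial (a : C₀(H, ℂ)) : coeffHom φ a = monomial φ 1 a :=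
  CrossedProduct.rep_ext fun ρ => by
    rw [rep_coeffHom, rep_monomial, map_one, Submonoid.coe_one, mul_one]

theorem monomial_mul_monomial (g g' : G) (a b : C₀(H, ℂ)) :
    monomial φ g a * monomial φ g' b = monomial φ (g * g') (a * translate (φ g) b) :=
  CrossedProduct.rep_ext fun ρ => by
    rw [map_mul, rep_monomial, rep_monomial, rep_monomial, map_mul, map_mul, Submonoid.coe_mul,
      mul_assoc, ← mul_assoc _ (ρ.π b), ρ.U_mul_π, mul_assoc, mul_assoc]

theorem star_monomial (g : G) (a : C₀(H, ℂ)) :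
    star (monomial φ g a) = monomial φ g⁻¹ (translate (φ g)⁻¹ (star a)) :=
  CrossedProduct.rep_ext fun ρ => by
    rw [map_star, rep_monomial, rep_monomial, star_mul, ρ.star_U, ← map_star, ρ.U_mul_π, map_inv]

theorem coeffHom_mul_monomial (g : G) (a b : C₀(H, ℂ)) :
    coeffHom φ b * monomial φ g a = monomial φ g (b * a) := by
  refine CrossedProduct.rep_ext fun ρ => ?_
  rw [map_mul, rep_coeffHom, rep_monomial, rep_monomial, map_mul, mul_assoc]

theorem monomial_mul_coeffHom (g : G) (a b : C₀(H, ℂ)) :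
    monomial φ g a * coeffHom φ b = monomial φ g (a * translate (φ g) b) := by
  rw [coeffHom_eq_monomial, monomial_mul_monomial, mul_one]

theorem translate_inv_translate (x : H) (a : C₀(H, ℂ)) : translate x (translate x⁻¹ a) = a := by
  ext h
  simp [translate_apply]

theorem monomial_mul_star_monomial (g : G) (a : C₀(H, ℂ)) :
    monomial φ g a * star (monomial φ g a) = coeffHom φ (a * star a) := by
  rw [star_monomial, monomial_mul_monomial, translate_inv_translate, mul_inv_cancel,
    coeffHom_eq_monomial]

theorem star_monomial_mul_monomial (g : G) (a : C₀(H, ℂ)) :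
    star (monomial φ g a) * monomial φ g a = coeffHom φ (translate (φ g)⁻¹ (star a * a)) := by
  rw [star_monomial, monomial_mul_monomial, inv_mul_cancel, coeffHom_eq_monomial, map_inv]
  rfl

variable (φ) in
theorem coeffHom_injective : Function.Injective (coeffHom φ) := by
  obtain ⟨ρ, hρ⟩ := exists_covariantRep_injective φ
  intro a b hab
  exact hρ (by rw [← rep_coeffHom, hab, rep_coeffHom])

theorem norm_coeffHom (a : C₀(H, ℂ)) : ‖coeffHom φ a‖ = ‖a‖ :=
  NonUnitalStarAlgHom.norm_map _ (coeffHom_injective φ) a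

/-- The C*-identity reduces this to the coefficient algebra, because (a u_g)(a u_g)* = a a*. -/
theorem norm_monomial (g : G) (a : C₀(H, ℂ)) : ‖monomial φ g a‖ = ‖a‖ := by
  have h : ‖monomial φ g a‖ * ‖monomial φ g a‖ = ‖a‖ * ‖a‖ := by
    rw [← CStarRing.norm_self_mul_star, monomial_mul_star_monomial, norm_coeffHom,
      CStarRing.norm_self_mul_star]
  exact (mul_self_inj (norm_nonneg _) (norm_nonneg _)).1 h

theorem isometry_monomial (g : G) : Isometry (monomial φ g) :=
  AddMonoidHomClass.isometry_of_norm _ (norm_monomial g)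

variable (φ) in
/-- The linear combinations of the elements `a u_g`. -/
def monomialSubalgebra : NonUnitalStarSubalgebra ℂ (CrossedProduct φ) where
  __ := Submodule.span ℂ {x | ∃ g a, x = monomial φ g a}
  mul_mem' {x y} hx hy := by
    refine Submodule.span_induction₂ (p := fun x y _ _ => x * y ∈ Submodule.span ℂ _)
      ?_ ?_ ?_ ?_ ?_ ?_ ?_ hx hy
    · rintro _ _ ⟨g, a, rfl⟩ ⟨g', b, rfl⟩
      rw [monomial_mul_monomial]
      exact Submodule.subset_span ⟨_, _, rfl⟩
    · intro y _
      rw [zero_mul]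
      exact Submodule.zero_mem _
    · intro x _
      rw [mul_zero]
      exact Submodule.zero_mem _
    · intro x y z _ _ _ h1 h2
      rw [add_mul]
      exact Submodule.add_mem _ h1 h2
    · intro x y z _ _ _ h1 h2
      rw [mul_add]
      exact Submodule.add_mem _ h1 h2
    · intro c x y _ _ h
      rw [smul_mul_assoc]
      exact Submodule.smul_mem _ c h
    · intro c x y _ _ h
      rw [mul_smul_comm]
      exact Submodule.smul_mem _ c h
  star_mem' {x} hx := by
    refine Submodule.span_induction (p := fun x _ => star x ∈ Submodule.span ℂ _) ?_ ?_ ?_ ?_ hx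
    · rintro _ ⟨g, a, rfl⟩
      rw [star_monomial]
      exact Submodule.subset_span ⟨_, _, rfl⟩
    · rw [star_zero]
      exact Submodule.zero_mem _
    · intro x y _ _ h1 h2
      rw [star_add]
      exact Submodule.add_mem _ h1 h2
    · intro c x _ h
      rw [star_smul]
      exact Submodule.smul_mem _ _ h

theorem monomial_mem (g : G) (a : C₀(H, ℂ)) : monomial φ g a ∈ monomialSubalgebra φ :=
  Submodule.subset_span ⟨g, a, rfl⟩

theorem ofFunction_mem (f : C_c(G, C₀(H, ℂ))) :
    CrossedProduct.ofFunction φ f ∈ monomialSubalgebra φ := by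
  have hf : (tsupport f).Finite := f.hasCompactSupport.isCompact.finite_of_discrete
  have h : CrossedProduct.ofFunction φ f =
      (haarMass G : ℂ) • ∑ g ∈ hf.toFinset, monomial φ g (f g) := by
    refine CrossedProduct.rep_ext fun ρ => ?_
    rw [map_smul, map_sum]
    exact ρ.integratedForm_eq_sum f (s := hf.toFinset) fun g hg =>
      image_eq_zero_of_notMem_tsupport (by simpa using hg)
  rw [h]
  exact SMulMemClass.smul_mem _ (sum_mem fun g _ => monomial_mem g _)

theorem isInducing_incl : IsInducing (CrossedProduct.incl φ) := IsInducing.subtypeVal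

variable (φ) in
theorem dense_monomialSubalgebra : Dense (monomialSubalgebra φ : Set (CrossedProduct φ)) := by
  intro x
  rw [isInducing_incl.closure_eq_preimage_closure_image]
  have h : crossedProductSubalgebra φ ≤
      ((monomialSubalgebra φ).map (CrossedProduct.incl φ)).topologicalClosure := by
    refine NonUnitalStarSubalgebra.topologicalClosure_mono (NonUnitalStarAlgebra.adjoin_le ?_)
    rintro _ ⟨f, rfl⟩
    exact ⟨_, ofFunction_mem f, rfl⟩
  exact h (CrossedProduct.incl_mem x)

/-- To prove a closed condition for all elements of the crossed product, it suffices to prove it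
for the elements `a u_g` and for sums. -/
theorem CrossedProduct.induction {p : CrossedProduct φ → Prop} (hp : IsClosed {x | p x})
    (hmono : ∀ g a, p (monomial φ g a)) (hadd : ∀ x y, p x → p y → p (x + y))
    (x : CrossedProduct φ) : p x := by
  refine hp.closure_subset_iff.2 (fun y hy => ?_) (dense_monomialSubalgebra φ x)
  have h : ∀ c : ℂ, p (c • y) := by
    refine Submodule.span_induction (p := fun y _ => ∀ c : ℂ, p (c • y)) ?_ ?_ ?_ ?_ hy
    · rintro _ ⟨g, a, rfl⟩ c
      rw [← map_smul]
      exact hmono _ _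
    · intro c
      rw [smul_zero, ← map_zero (monomial φ 1)]
      exact hmono _ _
    · intro x y _ _ hx hy c
      rw [smul_add]
      exact hadd _ _ (hx c) (hy c)
    · intro c x _ hx c'
      rw [smul_smul]
      exact hx _
  simpa using h 1

end DiscreteCrossedProduct

/-! ### Dual action, coefficients and the conditional expectation -/

section DualAction

variable {G : Type u} {H : Type v}
  [TopologicalSpace G] [CommGroup G] [IsTopologicalGroup G] [LocallyCompactSpace G] [T2Space G]
  [DiscreteTopology G]
  [TopologicalSpace H] [CommGroup H] [IsTopologicalGroup H] [LocallyCompactSpace H] [T2Space H]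
  {φ : G →ₜ* H}

variable (φ) in
/-- Reindexing of families of operators along multiplication of representations by a character. -/
def twistHom (ψ : PontryaginDual G) : RepProduct φ →⋆ₙₐ[ℂ] RepProduct φ where
  toFun T := RepProduct.mk (fun ρ => T.component (ρ.twist ψ)) ‖T‖
    fun ρ => norm_component_le T (ρ.twist ψ)
  map_smul' _ _ := rfl
  map_zero' := rfl
  map_add' _ _ := rfl
  map_mul' _ _ := rfl
  map_star' _ := rfl

theorem twistHom_monomial (ψ : PontryaginDual G) (g : G) (a : C₀(H, ℂ)) :
    twistHom φ ψ (CrossedProduct.incl φ (monomial φ g a)) =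
      CrossedProduct.incl φ ((ψ g : ℂ) • monomial φ g a) :=
  RepProduct.ext fun ρ => by
    change ρ.π a * ((ψ g : ℂ) • (ρ.U g : ρ.E →L[ℂ] ρ.E)) = (ψ g : ℂ) • (ρ.π a * ρ.U g)
    rw [mul_smul_comm]

theorem twistHom_mem (ψ : PontryaginDual G) (x : CrossedProduct φ) :
    twistHom φ ψ (CrossedProduct.incl φ x) ∈ crossedProductSubalgebra φ := by
  refine CrossedProduct.induction
    (p := fun x => twistHom φ ψ (CrossedProduct.incl φ x) ∈ crossedProductSubalgebra φ)
    ?_ (fun g a => ?_) (fun x y hx hy => ?_) x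
  · exact (NonUnitalStarSubalgebra.isClosed_topologicalClosure _).preimage
      (continuous_nonUnitalStarAlgHom ((twistHom φ ψ).comp (CrossedProduct.incl φ)))
  · rw [twistHom_monomial]
    exact CrossedProduct.incl_mem _
  · rw [map_add, map_add]
    exact add_mem hx hy

variable (φ) in
/-- The dual action on the crossed product. -/
def dualAction (ψ : PontryaginDual G) : CrossedProduct φ →⋆ₙₐ[ℂ] CrossedProduct φ where
  toFun x := ⟨twistHom φ ψ (CrossedProduct.incl φ x), twistHom_mem ψ x⟩
  map_smul' _ _ := rfl
  map_zero' := rfl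
  map_add' _ _ := rfl
  map_mul' _ _ := rfl
  map_star' _ := rfl

@[simp]
theorem dualAction_monomial (ψ : PontryaginDual G) (g : G) (a : C₀(H, ℂ)) :
    dualAction φ ψ (monomial φ g a) = (ψ g : ℂ) • monomial φ g a :=
  CrossedProduct.incl_injective (twistHom_monomial ψ g a)

theorem dualAction_coeffHom (ψ : PontryaginDual G) (a : C₀(H, ℂ)) :
    dualAction φ ψ (coeffHom φ a) = coeffHom φ a := by
  rw [coeffHom_eq_monomial, dualAction_monomial, map_one, Circle.coe_one, one_smul]

theorem norm_dualAction_le (ψ : PontryaginDual G) (x : CrossedProduct φ) :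
    ‖dualAction φ ψ x‖ ≤ ‖x‖ :=
  NonUnitalStarAlgHom.norm_apply_le _ x

theorem dualAction_one (x : CrossedProduct φ) : dualAction φ 1 x = x := by
  refine CrossedProduct.induction (p := fun x => dualAction φ 1 x = x)
    (isClosed_eq (continuous_nonUnitalStarAlgHom _) continuous_id) (fun g a => ?_)
    (fun x y hx hy => ?_) x
  · rw [dualAction_monomial, PontryaginDual.one_apply, Circle.coe_one, one_smul]
  · rw [map_add, hx, hy]

theorem continuous_apply_character (g : G) : Continuous fun ψ : PontryaginDual G => (ψ g : ℂ) :=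
  continuous_circle_coe.comp
    (continuous_dual_eval.comp (f := fun ψ : PontryaginDual G => (ψ, g)) (by fun_prop))

/-- Elements with continuous orbit form a closed set, the dual action being contractive; on a u_g
the orbit is ψ ↦ ψ(g) a u_g. -/
theorem continuous_dualAction (x : CrossedProduct φ) :
    Continuous fun ψ => dualAction φ ψ x := by
  refine CrossedProduct.induction (p := fun x => Continuous fun ψ => dualAction φ ψ x)
    ?_ (fun g a => ?_) (fun x y hx hy => ?_) x
  · refine isClosed_of_closure_subset fun x hx => ?_
    refine continuous_of_uniform_approx_of_continuous fun s hs => ?_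
    obtain ⟨ε, hε, hs⟩ := Metric.mem_uniformity_dist.1 hs
    obtain ⟨y, hy, hxy⟩ := Metric.mem_closure_iff.1 hx ε hε
    refine ⟨_, hy, fun ψ => hs ?_⟩
    rw [dist_eq_norm, ← map_sub]
    exact (norm_dualAction_le ψ _).trans_lt (by rwa [← dist_eq_norm])
  · simp only [dualAction_monomial]
    exact ((continuous_apply_character g).smul continuous_const)
  · simp only [map_add]
    exact hx.add hy

theorem continuous_conj_smul_dualAction (g : G) (x : CrossedProduct φ) :
    Continuous fun ψ : PontryaginDual G => conj (ψ g : ℂ) • dualAction φ ψ x :=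
  (Complex.continuous_conj.comp (continuous_apply_character g)).smul (continuous_dualAction x)

variable (φ) in
/-- The spectral component of an element of the crossed product at `g`. -/
def spectral (g : G) : CrossedProduct φ →L[ℂ] CrossedProduct φ :=
  LinearMap.mkContinuous
    { toFun := fun x => mean fun ψ : PontryaginDual G => conj (ψ g : ℂ) • dualAction φ ψ x
      map_add' := fun x y => by
        simp only [map_add, smul_add]
        exact mean_add (continuous_conj_smul_dualAction g x) (continuous_conj_smul_dualAction g y)
      map_smul' := fun c x => by
        simp only [map_smul, smul_comm _ c, RingHom.id_apply]
        exact mean_smul c _ } 1 fun x => by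
    rw [one_mul]
    refine norm_mean_le (continuous_conj_smul_dualAction g x) fun ψ => ?_
    rw [norm_smul, RCLike.norm_conj, Circle.norm_coe, one_mul]
    exact norm_dualAction_le ψ x

theorem spectral_apply (g : G) (x : CrossedProduct φ) :
    spectral φ g x = mean fun ψ : PontryaginDual G => conj (ψ g : ℂ) • dualAction φ ψ x := rfl

theorem norm_spectral_apply_le (g : G) (x : CrossedProduct φ) : ‖spectral φ g x‖ ≤ ‖x‖ := by
  rw [spectral_apply]
  refine norm_mean_le (continuous_conj_smul_dualAction g x) fun ψ => ?_
  rw [norm_smul, RCLike.norm_conj, Circle.norm_coe, one_mul]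
  exact norm_dualAction_le ψ x

theorem spectral_monomial_self (g : G) (a : C₀(H, ℂ)) :
    spectral φ g (monomial φ g a) = monomial φ g a := by
  rw [spectral_apply]
  simp only [dualAction_monomial, smul_smul, Complex.conj_mul', Circle.norm_coe, Complex.ofReal_one,
    one_pow, one_smul]
  exact mean_const _

/-- Orthogonality of characters on the compact dual: since characters separate points of G,
evaluation at g⁻¹g' is a nontrivial character of the dual, with mean zero. -/
theorem spectral_monomial_of_ne {g g' : G} (h : g ≠ g') (a : C₀(H, ℂ)) :
    spectral φ g (monomial φ g' a) = 0 := by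
  have h1 : doubleDual G (g⁻¹ * g') ≠ 1 := fun h1 =>
    h (inv_mul_eq_one.1 (doubleDual_injective (h1.trans (map_one _).symm)))
  have h2 := map_mean (ContinuousLinearMap.toSpanSingleton ℂ (monomial φ g' a))
    (f := fun ψ : PontryaginDual G => (doubleDual G (g⁻¹ * g') ψ : ℂ)) (continuous_apply_character _)
  rw [mean_character h1, map_zero] at h2
  rw [spectral_apply, h2]
  congr 1
  ext1 ψ
  rw [dualAction_monomial, smul_smul, ContinuousLinearMap.toSpanSingleton_apply, doubleDual_apply,
    map_mul, map_inv, Circle.coe_mul, Circle.coe_inv_eq_conj]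

theorem spectral_mem (g : G) (x : CrossedProduct φ) : ∃ a, spectral φ g x = monomial φ g a := by
  have hcl : IsClosed (Set.range (monomial φ g)) :=
    (isometry_monomial g).isClosedEmbedding.isClosed_range
  have h : spectral φ g x ∈ Set.range (monomial φ g) := by
    refine CrossedProduct.induction (p := fun x => spectral φ g x ∈ Set.range (monomial φ g))
      (hcl.preimage (spectral φ g).continuous) (fun g' a => ?_) (fun x y hx hy => ?_) x
    · by_cases h : g = g'
      · subst h
        exact ⟨a, (spectral_monomial_self g a).symm⟩
      · exact ⟨0, by rw [spectral_monomial_of_ne h, map_zero]⟩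
    · obtain ⟨a, ha⟩ := hx
      obtain ⟨b, hb⟩ := hy
      exact ⟨a + b, by rw [map_add, map_add, ha, hb]⟩
  obtain ⟨a, ha⟩ := h
  exact ⟨a, ha.symm⟩

theorem spectral_one_mem (x : CrossedProduct φ) : ∃ a, spectral φ 1 x = coeffHom φ a := by
  obtain ⟨a, ha⟩ := spectral_mem 1 x
  exact ⟨a, by rw [ha, coeffHom_eq_monomial]⟩

theorem spectral_one_apply (x : CrossedProduct φ) :
    spectral φ 1 x = mean fun ψ : PontryaginDual G => dualAction φ ψ x := by
  rw [spectral_apply]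
  simp

theorem spectral_one_coeffHom (a : C₀(H, ℂ)) : spectral φ 1 (coeffHom φ a) = coeffHom φ a := by
  rw [coeffHom_eq_monomial, spectral_monomial_self]

theorem spectral_coeffHom_mul (g : G) (a : C₀(H, ℂ)) (x : CrossedProduct φ) :
    spectral φ g (coeffHom φ a * x) = coeffHom φ a * spectral φ g x := by
  have h := map_mean (ContinuousLinearMap.mul ℂ (CrossedProduct φ) (coeffHom φ a))
    (continuous_conj_smul_dualAction g x)
  rw [spectral_apply, spectral_apply]
  refine Eq.trans (congrArg mean (funext fun ψ => ?_)) h.symm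
  rw [map_mul, dualAction_coeffHom, ContinuousLinearMap.mul_apply', mul_smul_comm]

theorem spectral_mul_coeffHom (g : G) (a : C₀(H, ℂ)) (x : CrossedProduct φ) :
    spectral φ g (x * coeffHom φ a) = spectral φ g x * coeffHom φ a := by
  have h := map_mean ((ContinuousLinearMap.mul ℂ (CrossedProduct φ)).flip (coeffHom φ a))
    (continuous_conj_smul_dualAction g x)
  rw [spectral_apply, spectral_apply]
  refine Eq.trans (congrArg mean (funext fun ψ => ?_)) h.symm
  rw [map_mul, dualAction_coeffHom, ContinuousLinearMap.flip_apply, ContinuousLinearMap.mul_apply',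
    smul_mul_assoc]

/-- The dual action multiplies a u_g by ψ(g), which shifts the coefficient to be extracted from x to
g⁻¹. -/
theorem spectral_one_monomial_mul (g : G) (a : C₀(H, ℂ)) (x : CrossedProduct φ) :
    spectral φ 1 (monomial φ g a * x) = monomial φ g a * spectral φ g⁻¹ x := by
  have h := map_mean (ContinuousLinearMap.mul ℂ (CrossedProduct φ) (monomial φ g a))
    (continuous_conj_smul_dualAction g⁻¹ x)
  rw [spectral_one_apply, spectral_apply]
  refine Eq.trans (congrArg mean (funext fun ψ => ?_)) h.symm
  rw [map_mul, dualAction_monomial, ContinuousLinearMap.mul_apply', mul_smul_comm, map_inv,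
    Circle.coe_inv_eq_conj, Complex.conj_conj, smul_mul_assoc]

theorem spectral_one_star (x : CrossedProduct φ) :
    spectral φ 1 (star x) = star (spectral φ 1 x) := by
  refine CrossedProduct.induction (p := fun x => spectral φ 1 (star x) = star (spectral φ 1 x))
    ?_ (fun g a => ?_) (fun x y hx hy => ?_) x
  · exact isClosed_eq ((spectral φ 1).continuous.comp continuous_star)
      (spectral φ 1).continuous.star
  · rw [star_monomial]
    by_cases h : 1 = g
    · subst h
      rw [inv_one, spectral_monomial_self, spectral_monomial_self, star_monomial, inv_one]
    · rw [spectral_monomial_of_ne h, spectral_monomial_of_ne fun h1 => h (inv_eq_one.1 h1.symm).symm,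
        star_zero]
  · rw [star_add, map_add, map_add, hx, hy, star_add]

/-- The expectation is a mean over the dual action, and each term is the square of a norm;
positivity and faithfulness of the expectation both come from this formula. -/
theorem inner_rep_spectral (ρ : CovariantRep φ) (x : CrossedProduct φ) (ξ : ρ.E) :
    inner ℂ ξ (CrossedProduct.rep ρ (spectral φ 1 (star x * x)) ξ) =
      mean fun ψ : PontryaginDual G =>
        ((‖CrossedProduct.rep ρ (dualAction φ ψ x) ξ‖ ^ 2 : ℝ) : ℂ) := by
  let L : CrossedProduct φ →L[ℂ] ℂ := (innerSL ℂ ξ).comp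
    ((ContinuousLinearMap.apply ℂ ρ.E ξ).comp
      ⟨(CrossedProduct.rep ρ : CrossedProduct φ →ₗ[ℂ] _), continuous_nonUnitalStarAlgHom _⟩)
  have h := map_mean L (continuous_dualAction (star x * x))
  rw [← spectral_one_apply] at h
  refine h.trans (congrArg mean (funext fun ψ => ?_))
  change inner ℂ ξ (CrossedProduct.rep ρ (dualAction φ ψ (star x * x)) ξ) = _
  rw [map_mul, map_star, map_mul, map_star, mul_apply_eq_comp, ContinuousLinearMap.star_eq_adjoint,
    ContinuousLinearMap.adjoint_inner_right, inner_self_eq_norm_sq_to_K]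
  norm_cast

theorem continuous_norm_rep_dualAction (ρ : CovariantRep φ) (x : CrossedProduct φ) (ξ : ρ.E) :
    Continuous fun ψ => ‖CrossedProduct.rep ρ (dualAction φ ψ x) ξ‖ ^ 2 :=
  ((((continuous_nonUnitalStarAlgHom (CrossedProduct.rep ρ)).comp
    (continuous_dualAction x)).clm_apply continuous_const).norm).pow 2

/-- A continuous nonnegative function with mean zero vanishes, in particular at the trivial
character, where the dual action is the identity. -/
theorem eq_zero_of_spectral_one_eq_zero {x : CrossedProduct φ}
    (hx : spectral φ 1 (star x * x) = 0) : x = 0 := by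
  refine CrossedProduct.rep_ext fun ρ => ContinuousLinearMap.ext fun ξ => ?_
  have h := inner_rep_spectral ρ x ξ
  rw [hx, map_zero, zero_apply, inner_zero_right] at h
  have h1 := eq_zero_of_mean_eq_zero (continuous_norm_rep_dualAction ρ x ξ)
    (fun ψ => sq_nonneg _) h.symm 1
  rw [dualAction_one, sq_eq_zero_iff, norm_eq_zero] at h1
  rw [h1, map_zero]
  rfl

/-- The expectation of zx vanishes when z is some a u_g, being a u_g times a coefficient of x, hence
by density for z = x*; faithfulness concludes. -/
theorem eq_zero_of_forall_spectral_eq_zero {x : CrossedProduct φ} (hx : ∀ g, spectral φ g x = 0) :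
    x = 0 := by
  refine eq_zero_of_spectral_one_eq_zero (CrossedProduct.induction
    (p := fun z => spectral φ 1 (z * x) = 0) ?_ (fun g a => ?_) (fun y z hy hz => ?_) (star x))
  · exact isClosed_eq ((spectral φ 1).continuous.comp (continuous_mul_const x)) continuous_const
  · rw [spectral_one_monomial_mul, hx, mul_zero]
  · rw [add_mul, map_add, hy, hz, add_zero]

/-- The conditional expectation is positive. -/
theorem nonneg_of_coeffHom_eq_spectral {x : CrossedProduct φ} {b : C₀(H, ℂ)}
    (hb : coeffHom φ b = spectral φ 1 (star x * x)) (h : H) : 0 ≤ (b h).re ∧ (b h).im = 0 := by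
  have hpos : ∀ (y : CrossedProduct φ) (ρ : CovariantRep φ) (ξ : ρ.E),
      0 ≤ (inner ℂ ξ (CrossedProduct.rep ρ (spectral φ 1 (star y * y)) ξ)).re := fun y ρ ξ => by
    rw [inner_rep_spectral]
    exact mean_ofReal_nonneg fun ψ => sq_nonneg _
  have hstar : star b = b := by
    refine coeffHom_injective φ ?_
    rw [map_star, hb, ← spectral_one_star, star_mul, star_star]
  have him : ∀ y, (b y).im = 0 := fun y => Complex.conj_eq_iff_im.1 (DFunLike.congr_fun hstar y)
  refine ⟨?_, him h⟩
  -- Here e is the negative part of b and d its square root. Replacing x by xd turns the expectation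
  -- into d*bd = −e*e, and positivity of its diagonal matrix coefficients forces e = 0.
  let e : C₀(H, ℂ) := compZero (fun z => ((max (-z.re) 0 : ℝ) : ℂ)) (by fun_prop) (by simp) b
  let d := sqrtRe e
  have hd : star d * d = e := star_sqrtRe_mul_sqrtRe fun y =>
    ⟨le_max_right _ _, Complex.ofReal_im _⟩
  have hdb : star d * (b * d) = - (star e * e) := by
    have : star d * (b * d) = (star d * d) * b := by rw [mul_left_comm, mul_comm]
    rw [this, hd]
    ext y
    have hby : b y = ((b y).re : ℂ) := Complex.ext rfl (him y)
    change ((max (-(b y).re) 0 : ℝ) : ℂ) * b y =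
      -(conj ((max (-(b y).re) 0 : ℝ) : ℂ) * ((max (-(b y).re) 0 : ℝ) : ℂ))
    rw [hby, Complex.conj_ofReal]
    norm_cast
    rcases le_total (b y).re 0 with h0 | h0
    · rw [max_eq_left (by linarith)]
      ring
    · rw [max_eq_right (by linarith)]
      ring
  have he : coeffHom φ e = 0 := by
    refine CrossedProduct.rep_ext fun ρ => ContinuousLinearMap.ext fun ξ => ?_
    have h1 := hpos (x * coeffHom φ d) ρ ξ
    have h2 : spectral φ 1 (star (x * coeffHom φ d) * (x * coeffHom φ d)) =
        - (star (coeffHom φ e) * coeffHom φ e) := by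
      rw [star_mul, mul_assoc, ← mul_assoc (star x), ← map_star, spectral_coeffHom_mul,
        spectral_mul_coeffHom, ← hb, ← map_mul, ← map_mul, hdb, map_neg, map_mul, map_star]
    rw [h2, map_neg, map_mul, map_star, neg_apply, inner_neg_right, mul_apply_eq_comp,
      ContinuousLinearMap.star_eq_adjoint, ContinuousLinearMap.adjoint_inner_right,
      inner_self_eq_norm_sq_to_K] at h1
    have h3 : ‖CrossedProduct.rep ρ (coeffHom φ e) ξ‖ ^ 2 ≤ 0 := by
      rw [Complex.neg_re] at h1
      norm_cast at h1
      exact neg_nonneg.1 h1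
    have h4 := norm_eq_zero.1 (pow_eq_zero_iff (two_ne_zero)|>.1 (le_antisymm h3 (sq_nonneg _)))
    rw [h4, map_zero]
    rfl
  have h0 := DFunLike.congr_fun (coeffHom_injective φ (he.trans (map_zero _).symm)) h
  have h1 : max (-(b h).re) 0 = 0 := Complex.ofReal_eq_zero.1 h0
  have := le_max_left (-(b h).re) 0
  linarith

end DualAction

/-! ### Cartan subalgebras from free actions -/

section Cartan

variable {G : Type u} {H : Type v}
  [TopologicalSpace G] [CommGroup G] [IsTopologicalGroup G] [LocallyCompactSpace G] [T2Space G]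
  [DiscreteTopology G]
  [TopologicalSpace H] [CommGroup H] [IsTopologicalGroup H] [LocallyCompactSpace H] [T2Space H]
  {φ : G →ₜ* H}

theorem isClosed_coeffSubalgebra : IsClosed (coeffSubalgebra φ : Set (CrossedProduct φ)) := by
  have h : Isometry (coeffHom φ) := AddMonoidHomClass.isometry_of_norm _ norm_coeffHom
  exact h.isClosedEmbedding.isClosed_range

theorem isFaithfulConditionalExpectation_spectral :
    IsFaithfulConditionalExpectation (coeffSubalgebra φ) (spectral φ 1) where
  mem x := by
    obtain ⟨a, ha⟩ := spectral_one_mem x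
    exact ⟨a, ha.symm⟩
  apply_of_mem := by
    rintro _ ⟨a, rfl⟩
    exact spectral_one_coeffHom a
  norm_le := norm_spectral_apply_le 1
  positive x := by
    obtain ⟨b, hb⟩ := spectral_one_mem (star x * x)
    refine ⟨coeffHom φ (sqrtRe b), ?_⟩
    rw [hb, ← map_star, ← map_mul, star_sqrtRe_mul_sqrtRe (nonneg_of_coeffHom_eq_spectral hb.symm)]
  map_mul_left := by
    rintro _ ⟨a, rfl⟩ x
    exact spectral_coeffHom_mul 1 a x
  map_mul_right := by
    rintro _ ⟨a, rfl⟩ x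
    exact spectral_mul_coeffHom 1 a x
  faithful _ := eq_zero_of_spectral_one_eq_zero

theorem isRegularSubalgebra_coeffSubalgebra : IsRegularSubalgebra (coeffSubalgebra φ) := by
  refine top_unique fun x _ => ?_
  have h : monomialSubalgebra φ ≤ NonUnitalStarAlgebra.adjoin ℂ (normalizerSet (coeffSubalgebra φ)) := by
    refine Submodule.span_le (p := (NonUnitalStarAlgebra.adjoin ℂ
      (normalizerSet (coeffSubalgebra φ))).toSubmodule).2 ?_
    rintro _ ⟨g, a, rfl⟩
    refine NonUnitalStarAlgebra.subset_adjoin ℂ _ ?_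
    rintro _ ⟨b, rfl⟩
    change monomial φ g a * coeffHom φ b * star (monomial φ g a) ∈ _ ∧
      star (monomial φ g a) * coeffHom φ b * monomial φ g a ∈ _
    constructor
    · rw [star_monomial, monomial_mul_coeffHom, monomial_mul_monomial, mul_inv_cancel]
      exact ⟨_, coeffHom_eq_monomial _⟩
    · rw [star_monomial, monomial_mul_coeffHom, monomial_mul_monomial, inv_mul_cancel]
      exact ⟨_, coeffHom_eq_monomial _⟩
  exact closure_mono h (dense_monomialSubalgebra φ x)

theorem tendsto_mul_of_closure {A : Type*} [NonUnitalNormedRing A] {l : Filter A}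
    (hl : ∀ᶠ e in l, ‖e‖ ≤ 1) {S : Set A} (hS : ∀ x ∈ S, Tendsto (fun e => e * x) l (𝓝 x)) {x : A}
    (hx : x ∈ closure S) : Tendsto (fun e => e * x) l (𝓝 x) := by
  rw [Metric.tendsto_nhds]
  intro ε hε
  obtain ⟨y, hy, hxy⟩ := Metric.mem_closure_iff.1 hx (ε / 3) (by positivity)
  filter_upwards [hl, Metric.tendsto_nhds.1 (hS y hy) (ε / 3) (by positivity)] with e he hey
  have h1 : dist (e * x) (e * y) < ε / 3 := by
    rw [dist_eq_norm, ← mul_sub]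
    refine (norm_mul_le _ _).trans_lt ?_
    rw [← dist_eq_norm]
    exact (mul_le_of_le_one_left dist_nonneg he).trans_lt hxy
  have h2 := dist_triangle4 (e * x) (e * y) y x
  rw [dist_comm y x] at h2
  linarith

/-- An approximate unit of `C₀(H)` works on the left of every a u_g, and boundedness extends this to
the closure. The right side follows by taking adjoints, its elements being self-adjoint. -/
theorem containsApproximateUnit_coeffSubalgebra :
    ContainsApproximateUnit (coeffSubalgebra φ) := by
  obtain ⟨l, hl, hl1⟩ := exists_approximateUnit C₀(H, ℂ)
  have hev : ∀ᶠ e in l.map (coeffHom φ),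
      e ∈ coeffSubalgebra φ ∧ ‖e‖ ≤ 1 ∧ ∃ c, e = star c * c := by
    refine eventually_map.2 ?_
    filter_upwards [hl1] with e he
    obtain ⟨h1, c, rfl⟩ := he
    exact ⟨⟨_, rfl⟩, by rwa [norm_coeffHom], coeffHom φ c, by rw [map_mul, map_star]⟩
  have hleft : ∀ x : CrossedProduct φ, Tendsto (fun e => e * x) (l.map (coeffHom φ)) (𝓝 x) := by
    intro x
    refine tendsto_mul_of_closure (hev.mono fun e he => he.2.1) (fun y hy => ?_)
      (dense_monomialSubalgebra φ x)
    refine Submodule.span_induction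
      (p := fun y _ => Tendsto (fun e => e * y) (l.map (coeffHom φ)) (𝓝 y)) ?_ ?_ ?_ ?_ hy
    · rintro _ ⟨g, a, rfl⟩
      rw [tendsto_map'_iff]
      refine Tendsto.congr (fun e => (coeffHom_mul_monomial g a e).symm) ?_
      exact ((isometry_monomial g).continuous.tendsto a).comp (hl.tendsto_mul_right a)
    · simp only [mul_zero]
      exact tendsto_const_nhds
    · intro y z _ _ hy hz
      simp only [mul_add]
      exact hy.add hz
    · intro c y _ hy
      simp only [mul_smul_comm]
      exact hy.const_smul c
  refine ⟨_, { tendsto_mul_left := fun x => ?_, tendsto_mul_right := hleft,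
               neBot := hl.neBot.map _ }, hev⟩
  have h := (continuous_star.tendsto _).comp (hleft (star x))
  rw [star_star] at h
  refine h.congr' (hev.mono fun e he => ?_)
  obtain ⟨-, -, c, rfl⟩ := he
  simp [star_mul]

theorem commute_coeffSubalgebra :
    ∀ x ∈ coeffSubalgebra φ, ∀ y ∈ coeffSubalgebra φ, x * y = y * x := by
  rintro _ ⟨a, rfl⟩ _ ⟨b, rfl⟩
  change coeffHom φ a * coeffHom φ b = coeffHom φ b * coeffHom φ a
  rw [← map_mul, mul_comm, map_mul]

/-- Commutation forces the coefficient a at g to satisfy ba = a · (b translated by φ(g)) for all b.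
When g ≠ 1, freeness gives a bump b equal to 1 at h and 0 at φ(g)⁻¹h, hence a(h) = 0. -/
theorem mem_coeffSubalgebra_of_commute (hφ : Function.Injective φ) {x : CrossedProduct φ}
    (hx : ∀ b, coeffHom φ b * x = x * coeffHom φ b) : x ∈ coeffSubalgebra φ := by
  have h0 : ∀ g, g ≠ 1 → spectral φ g x = 0 := by
    intro g hg
    obtain ⟨a, ha⟩ := spectral_mem g x
    have hab : ∀ b : C₀(H, ℂ), b * a = a * translate (φ g) b := fun b => by
      refine (isometry_monomial (φ := φ) g).injective ?_
      rw [← coeffHom_mul_monomial, ← monomial_mul_coeffHom, ← ha, ← spectral_coeffHom_mul, hx,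
        spectral_mul_coeffHom]
    have ha0 : a = 0 := by
      ext h
      have hne : (φ g)⁻¹ * h ≠ h := fun h1 => hg (hφ (by
        rw [map_one]
        exact inv_eq_one.1 (mul_eq_right.1 h1)))
      obtain ⟨b, hb, hbc, hb1, -, -, hbs⟩ := exists_bump h (isOpen_ne.mem_nhds hne.symm)
      have h2 := DFunLike.congr_fun (hab (zeroAtInftyOfCompact (fun x => (b x : ℂ))
        (Complex.continuous_ofReal.comp hb) (hbc.mono fun x hx h0 => hx (by simp [h0])))) h
      rw [ZeroAtInftyContinuousMap.mul_apply, ZeroAtInftyContinuousMap.mul_apply, translate_apply,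
        zeroAtInftyOfCompact_apply, zeroAtInftyOfCompact_apply, hb1, hbs _ (by simp)] at h2
      simpa using h2
    rw [ha, ha0, map_zero]
  obtain ⟨a, ha⟩ := spectral_one_mem x
  refine ⟨a, (sub_eq_zero.1 (eq_zero_of_forall_spectral_eq_zero (φ := φ) fun g => ?_)).symm⟩
  change spectral φ g (x - coeffHom φ a) = 0
  rw [map_sub]
  by_cases hg : g = 1
  · rw [hg, ha, spectral_one_coeffHom, sub_self]
  · rw [h0 g hg, coeffHom_eq_monomial, spectral_monomial_of_ne hg, sub_self]

theorem isCartanSubalgebra_coeffSubalgebra (hφ : Function.Injective φ) :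
    IsCartanSubalgebra (coeffSubalgebra φ) where
  isClosed := isClosed_coeffSubalgebra
  approximateUnit := containsApproximateUnit_coeffSubalgebra
  maximalAbelian := ⟨commute_coeffSubalgebra, fun _ hC hcomm =>
    le_antisymm (fun x hx => mem_coeffSubalgebra_of_commute hφ fun b =>
      hcomm _ (hC ⟨b, rfl⟩) x hx) hC⟩
  regular := isRegularSubalgebra_coeffSubalgebra
  expectation := ⟨_, isFaithfulConditionalExpectation_spectral⟩

end Cartan

/-! ### Positive functionals and pure states -/

section PositiveFunctionals

variable {A : Type*} [NonUnitalCStarAlgebra A]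

/-- Positivity of a functional on a C*-algebra. -/
def IsPositiveFunctional (ω : A →L[ℂ] ℂ) : Prop :=
  ∀ a : A, 0 ≤ (ω (star a * a)).re ∧ (ω (star a * a)).im = 0

variable {ω : A →L[ℂ] ℂ}

/-- Polarisation: reality of ω on the squares of x + y and x + iy fixes the imaginary and the real
part respectively. -/
theorem IsPositiveFunctional.conj_symm (hω : IsPositiveFunctional ω) (x y : A) :
    conj (ω (star y * x)) = ω (star x * y) := by
  have h1 := (hω (x + y)).2
  have h2 := (hω (x + Complex.I • y)).2
  have h3 := (hω x).2
  have h4 := (hω y).2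
  simp only [star_add, star_smul, add_mul, mul_add, smul_mul_assoc, mul_smul_comm, map_add, map_smul,
    smul_eq_mul, Complex.add_im, Complex.star_def, Complex.conj_I, Complex.mul_im, Complex.I_re,
    Complex.I_im, Complex.neg_re, Complex.neg_im, Complex.mul_re] at h1 h2
  refine Complex.ext ?_ ?_
  · rw [Complex.conj_re]
    linarith
  · rw [Complex.conj_im]
    linarith

/-- The Cauchy–Schwarz inequality. -/
theorem IsPositiveFunctional.norm_sq_le (hω : IsPositiveFunctional ω) (x y : A) :
    ‖ω (star x * y)‖ ^ 2 ≤ (ω (star x * x)).re * (ω (star y * y)).re := by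
  let core : PreInnerProductSpace.Core ℂ A :=
    { inner := fun x y => ω (star x * y)
      conj_inner_symm := fun x y => hω.conj_symm x y
      re_inner_nonneg := fun x => (hω x).1
      add_left := fun x y z => by
        change ω (star (x + y) * z) = ω (star x * z) + ω (star y * z)
        rw [star_add, add_mul, map_add]
      smul_left := fun x y r => by
        change ω (star (r • x) * y) = conj r * ω (star x * y)
        rw [star_smul, smul_mul_assoc, map_smul]
        rfl }
  have h := @InnerProductSpace.Core.inner_mul_inner_self_le ℂ A _ _ _ core x y
  change ‖ω (star x * y)‖ * ‖ω (star y * x)‖ ≤ _ at h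
  rw [← hω.conj_symm y x, RCLike.norm_conj, ← sq] at h
  exact h

/-- Cauchy–Schwarz gives ω(ex) = 0 for each e in an approximate unit, and one passes to the limit.
-/
theorem IsPositiveFunctional.apply_eq_zero (hω : IsPositiveFunctional ω) {x : A}
    (hx : ω (star x * x) = 0) : ω x = 0 := by
  obtain ⟨l, hl, he⟩ := exists_approximateUnit A
  have := hl.neBot
  refine tendsto_nhds_unique ((ω.continuous.tendsto x).comp (hl.tendsto_mul_right x))
    (tendsto_const_nhds.congr' (he.mono fun e he => ?_))
  obtain ⟨-, c, rfl⟩ := he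
  have h := hω.norm_sq_le (star c * c) x
  rw [hx, Complex.zero_re, mul_zero, star_mul, star_star] at h
  exact (norm_eq_zero.1 (pow_eq_zero_iff two_ne_zero |>.1 (le_antisymm h (sq_nonneg _)))).symm

theorem IsPositiveFunctional.apply_star (hω : IsPositiveFunctional ω) (x : A) :
    ω (star x) = conj (ω x) := by
  obtain ⟨l, hl, he⟩ := exists_approximateUnit A
  have := hl.neBot
  have h1 := (ω.continuous.tendsto (star x)).comp (hl.tendsto_mul_left (star x))
  have h2 := (Complex.continuous_conj.tendsto _).comp
    ((ω.continuous.tendsto x).comp (hl.tendsto_mul_right x))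
  refine tendsto_nhds_unique h1 (h2.congr' (he.mono fun e he => ?_))
  obtain ⟨-, c, rfl⟩ := he
  have := hω.conj_symm x (star c * c)
  rwa [star_mul, star_star] at this

theorem IsPositiveFunctional.apply_eq_zero' (hω : IsPositiveFunctional ω) {x : A}
    (hx : ω (x * star x) = 0) : ω x = 0 := by
  have h := hω.apply_star x
  rw [hω.apply_eq_zero (x := star x) (by rwa [star_star])] at h
  exact (map_eq_zero (starRingEnd ℂ)).1 h.symm

/-- The norm of a positive functional is its limit along an approximate unit. -/
theorem IsPositiveFunctional.tendsto_norm (hω : IsPositiveFunctional ω) {l : Filter A}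
    (hl : l.IsApproximateUnit) (he : ∀ᶠ e in l, ‖e‖ ≤ 1 ∧ ∃ c, e = star c * c) :
    Tendsto (fun e => (ω (star e * e)).re) l (𝓝 ‖ω‖) := by
  rw [tendsto_order]
  constructor
  · intro s hs
    rcases lt_or_ge s 0 with h0 | h0
    · exact Eventually.of_forall fun e => h0.trans_le (hω e).1
    have hpos : 0 < ‖ω‖ := h0.trans_lt hs
    -- For x in the unit ball with |ω(x)| above this number, Cauchy–Schwarz applied to ω(ex) yields
    -- s‖ω‖ < ω(e*e)‖ω‖ eventually.
    have hr : √(s * ‖ω‖) < ‖ω‖ := by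
      rw [Real.sqrt_lt' hpos, sq]
      exact mul_lt_mul_of_pos_right hs hpos
    obtain ⟨x, hx1, hx⟩ := ω.exists_lt_apply_of_lt_opNorm hr
    have h1 := ((ω.continuous.norm.tendsto x).comp (hl.tendsto_mul_right x)).eventually
      (lt_mem_nhds hx)
    filter_upwards [h1, he] with e h2 h3
    obtain ⟨-, c, rfl⟩ := h3
    have h4 := hω.norm_sq_le (star c * c) x
    have h5 : (ω (star x * x)).re ≤ ‖ω‖ := by
      refine (Complex.re_le_norm _).trans ((ω.le_opNorm _).trans ?_)
      refine mul_le_of_le_one_right hpos.le ?_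
      rw [CStarRing.norm_star_mul_self]
      nlinarith [norm_nonneg x]
    have h6 : s * ‖ω‖ < ‖ω (star c * c * x)‖ ^ 2 := Real.lt_sq_of_sqrt_lt h2
    have h7 : star (star c * c) = star c * c := by rw [star_mul, star_star]
    rw [h7] at h4 ⊢
    have h8 := (hω (star c * c)).1
    rw [h7] at h8
    have h9 := h6.trans_le (h4.trans (mul_le_mul_of_nonneg_left h5 h8))
    exact lt_of_mul_lt_mul_right h9 hpos.le
  · intro s hs
    filter_upwards [he] with e he
    refine ((Complex.re_le_norm _).trans ((ω.le_opNorm _).trans ?_)).trans_lt hs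
    refine mul_le_of_le_one_right (norm_nonneg _) ?_
    rw [CStarRing.norm_star_mul_self]
    nlinarith [norm_nonneg e, he.1]

/-- Both norms are limits along the same approximate unit. Additivity makes the weights of a
decomposition of a state sum to one. -/
theorem IsPositiveFunctional.norm_add {ω' : A →L[ℂ] ℂ} (hω : IsPositiveFunctional ω)
    (hω' : IsPositiveFunctional ω') (h : IsPositiveFunctional (ω + ω')) :
    ‖ω + ω'‖ = ‖ω‖ + ‖ω'‖ := by
  obtain ⟨l, hl, he⟩ := exists_approximateUnit A
  have := hl.neBot
  exact tendsto_nhds_unique (h.tendsto_norm hl he)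
    ((hω.tendsto_norm hl he).add (hω'.tendsto_norm hl he))

theorem IsPositiveFunctional.smul (hω : IsPositiveFunctional ω) {c : ℝ} (hc : 0 ≤ c) :
    IsPositiveFunctional (c • ω) := fun a => by
  have h := hω a
  rw [smul_apply, Complex.smul_re, Complex.smul_im, h.2, smul_zero]
  exact ⟨mul_nonneg hc h.1, rfl⟩

/-- A positive functional dominated by a pure state is a multiple of it. -/
theorem IsPureState.eq_smul_of_le (hω : IsPureState ω) {τ : A →L[ℂ] ℂ}
    (hτ : IsPositiveFunctional τ) (hτ' : IsPositiveFunctional (ω - τ)) : τ = ‖τ‖ • ω := by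
  have hsum : ‖τ‖ + ‖ω - τ‖ = 1 := by
    have hst : IsState ω := hω.1
    have hpos : IsPositiveFunctional ω := hst.1
    rw [← hτ.norm_add hτ' (by rwa [add_sub_cancel]), add_sub_cancel]
    exact hst.2
  rcases (norm_nonneg τ).eq_or_lt with h0 | h0
  · rw [norm_eq_zero.1 h0.symm, norm_zero]
    exact (zero_smul ℝ ω).symm
  rcases (norm_nonneg (ω - τ)).eq_or_lt with h1 | h1
  · have h2 : ω = τ := sub_eq_zero.1 (norm_eq_zero.1 h1.symm)
    rw [← h1, add_zero] at hsum
    rw [hsum, one_smul, h2]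
  have hstate : ∀ σ : A →L[ℂ] ℂ, IsPositiveFunctional σ → 0 < ‖σ‖ →
      IsState (‖σ‖⁻¹ • σ) := fun σ hσ h => ⟨hσ.smul (inv_nonneg.2 h.le), by
    rw [norm_smul, norm_inv, norm_norm, inv_mul_cancel₀ h.ne']⟩
  have h2 := hω.2 (hstate τ hτ h0) (hstate _ hτ' h1) ⟨‖τ‖, ‖ω - τ‖, h0, h1, hsum, by
    rw [smul_smul, smul_smul, mul_inv_cancel₀ h0.ne', mul_inv_cancel₀ h1.ne', one_smul, one_smul,
      add_sub_cancel]⟩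
  rw [← h2, smul_smul, mul_inv_cancel₀ h0.ne', one_smul]

end PositiveFunctionals

/-! ### Pure states of `C₀(X)` -/

section PureStates

variable {X : Type*} [TopologicalSpace X]

/-- The product of a function vanishing at infinity and a bounded continuous function. -/
def boundedMul (k : X → ℂ) (hk : Continuous k) (C : ℝ) (hC : ∀ x, ‖k x‖ ≤ C) (a : C₀(X, ℂ)) :
    C₀(X, ℂ) where
  toFun x := k x * a x
  continuous_toFun := hk.mul a.continuous
  zero_at_infty' := by
    have h := a.zero_at_infty'.norm.const_mul C
    rw [norm_zero, mul_zero] at h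
    refine squeeze_zero_norm (fun x => ?_) h
    rw [norm_mul]
    exact mul_le_mul_of_nonneg_right (hC x) (norm_nonneg _)

@[simp]
theorem boundedMul_apply (k : X → ℂ) (hk : Continuous k) (C : ℝ) (hC : ∀ x, ‖k x‖ ≤ C)
    (a : C₀(X, ℂ)) (x : X) : boundedMul k hk C hC a x = k x * a x := rfl

/-- Since |s|² ≤ 1, the functional x ↦ ω(s*s x) is positive and dominated by ω, so purity makes it a
multiple of ω. -/
theorem IsPureState.exists_apply_mul_eq {ω : C₀(X, ℂ) →L[ℂ] ℂ} (hω : IsPureState ω) {s : C₀(X, ℂ)}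
    (hs : ‖s‖ ≤ 1) : ∃ t : ℝ, ∀ x, ω (star s * s * x) = t • ω x := by
  have hpos : IsPositiveFunctional ω := hω.1.1
  let τ : C₀(X, ℂ) →L[ℂ] ℂ := ω.comp (ContinuousLinearMap.mul ℂ C₀(X, ℂ) (star s * s))
  have hτ : ∀ x, τ x = ω (star s * s * x) := fun _ => rfl
  refine ⟨‖τ‖, fun x => ?_⟩
  rw [← hτ]
  refine DFunLike.congr_fun (hω.eq_smul_of_le (τ := τ) (fun a => ?_) fun a => ?_) x
  · have h : star s * s * (star a * a) = star (s * a) * (s * a) := by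
      rw [star_mul, mul_mul_mul_comm, mul_comm (star s)]
    rw [hτ, h]
    exact hpos _
  · have h := star_sqrtRe_mul_sqrtRe (a := star a * a - star s * s * (star a * a)) fun x => by
      have h1 : (star a * a - star s * s * (star a * a)) x =
          (((1 - ‖s x‖ ^ 2) * ‖a x‖ ^ 2 : ℝ) : ℂ) := by
        have h2 : ∀ z : ℂ, star z * z = ((‖z‖ ^ 2 : ℝ) : ℂ) := fun z => by
          rw [Complex.star_def, Complex.conj_mul']
          norm_cast
        rw [ZeroAtInftyContinuousMap.sub_apply]
        simp only [ZeroAtInftyContinuousMap.mul_apply, ZeroAtInftyContinuousMap.star_apply, h2]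
        push_cast
        ring
      have h3 : ‖s x‖ ^ 2 ≤ 1 := pow_le_one₀ (norm_nonneg _) ((norm_apply_le s x).trans hs)
      rw [h1, Complex.ofReal_re, Complex.ofReal_im]
      exact ⟨mul_nonneg (by linarith) (sq_nonneg _), rfl⟩
    have h4 : (ω - τ) (star a * a) = ω (star a * a - star s * s * (star a * a)) := by
      rw [map_sub]
      rfl
    rw [h4, ← h]
    exact hpos _

variable [LocallyCompactSpace X] [T2Space X]

/-- The point h lies in the support of ω. If there were none, compactness would give finitely many s
with ω(s*s ·) = 0 and no common zero on a compact set off which x is small; dividing by the sum of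
|s|² would then make ω(x) arbitrarily small. -/
theorem IsState.exists_point {ω : C₀(X, ℂ) →L[ℂ] ℂ} (hω : IsState ω) :
    ∃ h : X, ∀ s : C₀(X, ℂ), ‖s‖ ≤ 1 → s h ≠ 0 → ∃ x, ω (star s * s * x) ≠ 0 := by
  by_contra! hcon
  choose s hs1 hs hsω using hcon
  have hzero : ω = 0 := by
    ext x
    refine norm_le_zero_iff.1 (le_of_forall_pos_le_add fun ε hε => ?_)
    rw [zero_add]
    obtain ⟨K, hK, hxK⟩ := tendsto_cocompact_zero_iff.1 x.zero_at_infty' ε hε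
    obtain ⟨t, ht⟩ := hK.elim_finite_subcover (fun h => {y | s h y ≠ 0})
      (fun h => isOpen_ne_fun (s h).continuous continuous_const)
      fun y _ => Set.mem_iUnion.2 ⟨y, hs y⟩
    let S : X → ℝ := fun y => ∑ h ∈ t, ‖s h y‖ ^ 2
    have hScont : Continuous S := continuous_finsetSum _ fun h _ => (s h).continuous.norm.pow 2
    have hS0 : ∀ y, 0 ≤ S y := fun y => Finset.sum_nonneg fun h _ => sq_nonneg _
    obtain ⟨c, hc, hcS⟩ : ∃ c > 0, ∀ y ∈ K, c ≤ S y := by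
      rcases K.eq_empty_or_nonempty with rfl | hne
      · exact ⟨1, one_pos, fun y hy => hy.elim⟩
      obtain ⟨y, hy, hmin⟩ := hK.exists_isMinOn hne hScont.continuousOn
      refine ⟨S y, ?_, fun z hz => hmin hz⟩
      obtain ⟨h, hht, hhy⟩ := Set.mem_iUnion₂.1 (ht hy)
      exact Finset.sum_pos' (fun _ _ => sq_nonneg _) ⟨h, hht, by
        have := norm_pos_iff.2 hhy
        positivity⟩
    -- With v = x/(S + δ), x = Sv + δv and ω kills Sv. This δ makes |δv| ≤ ε on K, where S ≥ c; off
    -- K already |x| < ε and δ/(S + δ) ≤ 1.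
    set δ := ε * c / (‖x‖ + 1) with hδ
    have hδ0 : 0 < δ := by positivity
    have hk : Continuous fun y => (((S y + δ)⁻¹ : ℝ) : ℂ) :=
      Complex.continuous_ofReal.comp ((hScont.add continuous_const).inv₀ fun y =>
        (add_pos_of_nonneg_of_pos (hS0 y) hδ0).ne')
    have hkb : ∀ y, ‖(((S y + δ)⁻¹ : ℝ) : ℂ)‖ ≤ δ⁻¹ := fun y => by
      rw [Complex.norm_real, Real.norm_of_nonneg (inv_nonneg.2 (add_nonneg (hS0 y) hδ0.le))]
      exact inv_anti₀ hδ0 (by linarith [hS0 y])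
    let v := boundedMul _ hk _ hkb x
    have hv : ∑ h ∈ t, star (s h) * s h * v = x - (δ : ℂ) • v := by
      rw [← Finset.sum_mul]
      ext y
      have h1 : (∑ h ∈ t, star (s h) * s h) y = (S y : ℂ) := by
        have h2 : ∀ r : Finset X, (∑ h ∈ r, star (s h) * s h) y =
            ((∑ h ∈ r, ‖s h y‖ ^ 2 : ℝ) : ℂ) := fun r => by
          classical
          induction r using Finset.induction_on with
          | empty => simp
          | insert a r ha ih =>
            rw [Finset.sum_insert ha, Finset.sum_insert ha, ZeroAtInftyContinuousMap.add_apply, ih,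
              ZeroAtInftyContinuousMap.mul_apply, ZeroAtInftyContinuousMap.star_apply,
              Complex.star_def, Complex.conj_mul']
            push_cast
            rfl
        exact h2 t
      have h2 : ((S y : ℂ) + δ) ≠ 0 := by
        exact_mod_cast (add_pos_of_nonneg_of_pos (hS0 y) hδ0).ne'
      rw [ZeroAtInftyContinuousMap.mul_apply, h1, ZeroAtInftyContinuousMap.sub_apply,
        ZeroAtInftyContinuousMap.smul_apply, boundedMul_apply, smul_eq_mul]
      push_cast
      field_simp
      ring
    have hωx : ω x = ω ((δ : ℂ) • v) := by
      have h1 : ω (∑ h ∈ t, star (s h) * s h * v) = 0 := by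
        rw [map_sum]
        exact Finset.sum_eq_zero fun h _ => hsω h v
      rw [hv, map_sub, sub_eq_zero] at h1
      exact h1
    rw [hωx]
    refine (ω.le_opNorm _).trans ?_
    rw [hω.2, one_mul, norm_le_iff hε.le]
    intro y
    have hy0 := add_pos_of_nonneg_of_pos (hS0 y) hδ0
    rw [ZeroAtInftyContinuousMap.smul_apply, boundedMul_apply, smul_eq_mul, norm_mul, norm_mul,
      Complex.norm_real, Complex.norm_real, Real.norm_of_nonneg hδ0.le,
      Real.norm_of_nonneg (inv_nonneg.2 hy0.le)]
    by_cases hy : y ∈ K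
    · have h1 : (S y + δ)⁻¹ ≤ c⁻¹ := inv_anti₀ hc (by linarith [hcS y hy])
      calc δ * ((S y + δ)⁻¹ * ‖x y‖) ≤ δ * (c⁻¹ * (‖x‖ + 1)) := by
            gcongr
            exact (norm_apply_le x y).trans (by linarith)
        _ = ε := by
            rw [hδ]
            field_simp
    · have h1 : δ * (S y + δ)⁻¹ ≤ 1 := by
        rw [← div_eq_mul_inv, div_le_one hy0]
        linarith [hS0 y]
      rw [← mul_assoc]
      exact (mul_le_of_le_one_left (norm_nonneg _) h1).trans (hxK y hy).le
  have := hω.2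
  rw [hzero, norm_zero] at this
  exact zero_ne_one this

/-- The pure states of `C₀(X)` are the evaluations at the points of `X`. -/
theorem IsPureState.exists_eq_eval {ω : C₀(X, ℂ) →L[ℂ] ℂ} (hω : IsPureState ω) :
    ∃ h : X, ∀ a, ω a = a h := by
  have hst : IsState ω := hω.1
  obtain ⟨h, hh⟩ := hst.exists_point
  have hbump : ∀ V ∈ 𝓝 h, ∃ s : C₀(X, ℂ), ‖s‖ ≤ 1 ∧ s h = 1 ∧ (∀ y ∉ V, s y = 0) ∧
      ∀ y, ∃ r : ℝ, s y = r ∧ 0 ≤ r := fun V hV => by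
    obtain ⟨b, hb, hbc, hb1, hb0, hble, hbs⟩ := exists_bump h hV
    refine ⟨zeroAtInftyOfCompact (fun x => (b x : ℂ)) (Complex.continuous_ofReal.comp hb)
      (hbc.mono fun x hx h0 => hx (by simp [h0])), (norm_le_iff zero_le_one _).2 fun y => ?_,
      ?_, fun y hy => ?_, fun y => ⟨b y, rfl, hb0 y⟩⟩
    · rw [zeroAtInftyOfCompact_apply, Complex.norm_real, Real.norm_of_nonneg (hb0 y)]
      exact hble y
    · rw [zeroAtInftyOfCompact_apply, hb1, Complex.ofReal_one]
    · rw [zeroAtInftyOfCompact_apply, hbs y hy, Complex.ofReal_zero]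
  -- For a bump s at h supported in V, ω(s*s ·) is a nonzero multiple of ω, yet s*s x = 0.
  have hlocal : ∀ x : C₀(X, ℂ), ∀ V ∈ 𝓝 h, (∀ y ∈ V, x y = 0) → ω x = 0 := by
    intro x V hV hx
    obtain ⟨s, hs, hs1, hsV, -⟩ := hbump V hV
    obtain ⟨t, ht⟩ := hω.exists_apply_mul_eq hs
    obtain ⟨x', hx'⟩ := hh s hs (by rw [hs1]; exact one_ne_zero)
    have ht0 : t ≠ 0 := fun h0 => hx' (by rw [ht, h0, zero_smul])
    have h1 : star s * s * x = 0 := by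
      ext y
      by_cases hy : y ∈ V
      · simp [hx y hy]
      · simp [hsV y hy]
    have h2 := ht x
    rw [h1, map_zero] at h2
    exact (smul_eq_zero.1 h2.symm).resolve_left ht0
  have hzero : ∀ x : C₀(X, ℂ), x h = 0 → ω x = 0 := by
    intro x hx
    refine norm_le_zero_iff.1 (le_of_forall_pos_le_add fun ε hε => ?_)
    rw [zero_add]
    have hV : {y | ‖x y‖ < ε} ∈ 𝓝 h :=
      (isOpen_lt x.continuous.norm continuous_const).mem_nhds (by simpa [hx] using hε)
    obtain ⟨b, hb, -, hb1, hb0, -, hbs⟩ := exists_bump h hV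
    -- This cutoff equals 1 near h, not just at h, so x minus its product with the cutoff vanishes
    -- on a neighbourhood of h, while the product has modulus at most ε.
    have hk : Continuous fun y => ((min 1 (2 * b y) : ℝ) : ℂ) := by fun_prop
    have hk1 : ∀ y, ‖((min 1 (2 * b y) : ℝ) : ℂ)‖ ≤ 1 := fun y => by
      rw [Complex.norm_real, Real.norm_of_nonneg (le_min zero_le_one (by linarith [hb0 y]))]
      exact min_le_left _ _
    have h1 : ω (x - boundedMul _ hk 1 hk1 x) = 0 := by
      refine hlocal _ {y | 1 / 2 < b y} ((isOpen_lt continuous_const hb).mem_nhds ?_) fun y hy => ?_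
      · rw [Set.mem_ofPred_eq, hb1]
        norm_num
      · have : 1 ≤ 2 * b y := by
          have : 1 / 2 < b y := hy
          linarith
        rw [ZeroAtInftyContinuousMap.sub_apply, boundedMul_apply, min_eq_left this]
        simp
    rw [map_sub, sub_eq_zero] at h1
    rw [h1]
    refine (ω.le_opNorm _).trans ?_
    rw [hst.2, one_mul, norm_le_iff hε.le]
    intro y
    rw [boundedMul_apply, norm_mul]
    by_cases hy : y ∈ {y | ‖x y‖ < ε}
    · exact (mul_le_of_le_one_left (norm_nonneg _) (hk1 y)).trans (le_of_lt hy)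
    · rw [hbs y hy]
      simpa using hε.le
  obtain ⟨u, hu, hu1, -, -⟩ := hbump Set.univ univ_mem
  have hval : ∀ a, ω a = a h * ω u := fun a => by
    have := hzero (a - a h • u) (by simp [hu1])
    rwa [map_sub, map_smul, sub_eq_zero] at this
  have hpos := hst.1 u
  rw [hval, ZeroAtInftyContinuousMap.mul_apply, ZeroAtInftyContinuousMap.star_apply, hu1, star_one,
    mul_one, one_mul] at hpos
  -- So far ω is evaluation at h times the scalar ω(u); norm one and positivity force that scalar to
  -- be 1.
  have hge : 1 ≤ ‖ω u‖ := by
    rw [← hst.2]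
    refine ω.opNorm_le_bound (norm_nonneg _) fun a => ?_
    rw [hval, norm_mul, mul_comm]
    exact mul_le_mul_of_nonneg_left (norm_apply_le a h) (norm_nonneg _)
  have hle : ‖ω u‖ ≤ 1 := by
    refine (ω.le_opNorm u).trans ?_
    rw [hst.2, one_mul]
    exact hu
  have hu' : ω u = ((ω u).re : ℂ) := Complex.ext rfl hpos.2
  have hre : (ω u).re = 1 := by
    have := le_antisymm hle hge
    rwa [hu', Complex.norm_real, Real.norm_of_nonneg hpos.1] at this
  refine ⟨h, fun a => ?_⟩
  rw [hval, hu', hre, Complex.ofReal_one, mul_one]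

end PureStates

section Transport

variable {A B : Type*} [NonUnitalNormedRing A] [StarRing A] [NormedSpace ℂ A]
  [NonUnitalNormedRing B] [StarRing B] [NormedSpace ℂ B]

theorem IsState.comp_isometryEquiv {ω : B →L[ℂ] ℂ} (hω : IsState ω) (e : A ≃ₗᵢ[ℂ] B)
    (he : ∀ x, e (star x * x) = star (e x) * e x) :
    IsState (ω.comp (e : A →L[ℂ] B)) := by
  refine ⟨fun a => ?_, (ω.opNorm_comp_linearIsometryEquiv e).trans hω.2⟩
  change 0 ≤ (ω (e _)).re ∧ (ω (e _)).im = 0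
  rw [he]
  exact hω.1 _

theorem IsPureState.comp_isometryEquiv {ω : B →L[ℂ] ℂ} (hω : IsPureState ω) (e : A ≃ₗᵢ[ℂ] B)
    (he : ∀ x, e (star x * x) = star (e x) * e x) :
    IsPureState (ω.comp (e : A →L[ℂ] B)) := by
  refine ⟨hω.1.comp_isometryEquiv e he, fun ω₁ h₁ ω₂ h₂ h => ?_⟩
  have he' : ∀ y, e.symm (star y * y) = star (e.symm y) * e.symm y := fun y => by
    apply e.injective
    rw [he, e.apply_symm_apply, e.apply_symm_apply]
  obtain ⟨a, b, ha, hb, hab, hsum⟩ := h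
  have h3 := hω.2 (IsState.comp_isometryEquiv h₁ e.symm he')
    (IsState.comp_isometryEquiv h₂ e.symm he') ⟨a, b, ha, hb, hab, by
      ext y
      have := DFunLike.congr_fun hsum (e.symm y)
      change a • ω₁ (e.symm y) + b • ω₂ (e.symm y) = ω (e (e.symm y)) at this
      rwa [e.apply_symm_apply] at this⟩
  rw [← h3]
  ext x
  change ω₁ x = ω₁ (e.symm (e x))
  rw [e.symm_apply_apply]

end Transport

/-! ### Unique extension of pure states -/

section UniqueExtension

variable {G : Type u} {H : Type v}
  [TopologicalSpace G] [CommGroup G] [IsTopologicalGroup G] [LocallyCompactSpace G] [T2Space G]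
  [DiscreteTopology G]
  [TopologicalSpace H] [CommGroup H] [IsTopologicalGroup H] [LocallyCompactSpace H] [T2Space H]
  {φ : G →ₜ* H}

variable (φ) in
/-- `C₀(H)` is isomorphic to its image in the crossed product. -/
def coeffEquiv : C₀(H, ℂ) ≃⋆ₐ[ℂ] coeffSubalgebra φ :=
  StarAlgEquiv.ofInjective' (coeffHom φ) (coeffHom_injective φ)

variable (φ) in
/-- `C₀(H)` is isometric to its image in the crossed product. -/
def coeffIsometryEquiv : C₀(H, ℂ) ≃ₗᵢ[ℂ] coeffSubalgebra φ where
  toFun := coeffEquiv φ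
  invFun := (coeffEquiv φ).symm
  left_inv := (coeffEquiv φ).left_inv
  right_inv := (coeffEquiv φ).right_inv
  map_add' := map_add _
  map_smul' := map_smul _
  norm_map' a := norm_coeffHom a

/-- Split a with a bump k equal to 1 at h and 0 at φ(g)h ≠ h. The part (1 − k)a vanishes at h and is
killed through (a u_g)(a u_g)*; the part ka vanishes at φ(g)h and is killed through (a u_g)*(a u_g).
-/
theorem IsState.apply_monomial_eq_zero (hφ : Function.Injective φ) {ω : CrossedProduct φ →L[ℂ] ℂ}
    (hω : IsState ω) {h : H} (hh : ∀ a, ω (coeffHom φ a) = a h) {g : G} (hg : g ≠ 1)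
    (a : C₀(H, ℂ)) : ω (monomial φ g a) = 0 := by
  have hpos : IsPositiveFunctional ω := hω.1
  have hne : φ g * h ≠ h := fun h1 => hg (hφ (by
    rw [map_one]
    exact mul_eq_right.1 h1))
  obtain ⟨b, hb, hbc, hb1, -, -, hbs⟩ := exists_bump h (isOpen_ne.mem_nhds hne.symm)
  let k : C₀(H, ℂ) := zeroAtInftyOfCompact (fun x => (b x : ℂ))
    (Complex.continuous_ofReal.comp hb) (hbc.mono fun x hx h0 => hx (by simp [h0]))
  have hk1 : k h = 1 := by
    rw [zeroAtInftyOfCompact_apply, hb1, Complex.ofReal_one]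
  have hk0 : k (φ g * h) = 0 := by
    rw [zeroAtInftyOfCompact_apply, hbs _ (by simp), Complex.ofReal_zero]
  have h1 : ω (monomial φ g (a - k * a)) = 0 := by
    refine hpos.apply_eq_zero' ?_
    rw [monomial_mul_star_monomial, hh]
    simp [hk1]
  have h2 : ω (monomial φ g (k * a)) = 0 := by
    refine hpos.apply_eq_zero ?_
    rw [star_monomial_mul_monomial, hh, translate_apply, inv_inv]
    simp [hk0]
  rw [map_sub, map_sub, h2, sub_zero] at h1
  exact h1

theorem IsState.eq_of_coeffHom (hφ : Function.Injective φ) {ω ω' : CrossedProduct φ →L[ℂ] ℂ}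
    (hω : IsState ω) (hω' : IsState ω') {h : H} (hh : ∀ a, ω (coeffHom φ a) = a h)
    (hh' : ∀ a, ω' (coeffHom φ a) = a h) : ω = ω' := by
  ext x
  refine CrossedProduct.induction (p := fun x => ω x = ω' x)
    (isClosed_eq ω.continuous ω'.continuous) (fun g a => ?_) (fun x y hx hy => ?_) x
  · by_cases hg : g = 1
    · rw [hg, ← coeffHom_eq_monomial, hh, hh']
    · rw [hω.apply_monomial_eq_zero hφ hh hg, hω'.apply_monomial_eq_zero hφ hh' hg]
  · rw [map_add, map_add, hx, hy]

/-- The composition of a functional on `C₀(H)` with the conditional expectation. -/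
def extendFunctional (ω : coeffSubalgebra φ →L[ℂ] ℂ) : CrossedProduct φ →L[ℂ] ℂ :=
  LinearMap.mkContinuous
    { toFun := fun x => ω ⟨spectral φ 1 x, isFaithfulConditionalExpectation_spectral.mem x⟩
      map_add' := fun x y => by
        rw [← map_add]
        congr 1
        exact Subtype.ext (map_add (spectral φ 1) x y)
      map_smul' := fun c x => by
        rw [RingHom.id_apply, ← map_smul]
        congr 1
        exact Subtype.ext (map_smul (spectral φ 1) c x) } ‖ω‖ fun x =>
    (ω.le_opNorm _).trans
      (mul_le_mul_of_nonneg_left (norm_spectral_apply_le 1 x) (norm_nonneg ω))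

theorem extendFunctional_apply (ω : coeffSubalgebra φ →L[ℂ] ℂ) (x : CrossedProduct φ) :
    extendFunctional ω x =
      ω ⟨spectral φ 1 x, isFaithfulConditionalExpectation_spectral.mem x⟩ := rfl

theorem extendFunctional_coe (ω : coeffSubalgebra φ →L[ℂ] ℂ) (b : coeffSubalgebra φ) :
    extendFunctional ω b = ω b := by
  rw [extendFunctional_apply]
  congr 1
  exact Subtype.ext (isFaithfulConditionalExpectation_spectral.apply_of_mem _ b.2)

theorem isState_extendFunctional {ω : coeffSubalgebra φ →L[ℂ] ℂ} (hω : IsState ω) {h : H}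
    (hh : ∀ a, ω (coeffEquiv φ a) = a h) : IsState (extendFunctional ω) := by
  refine ⟨fun x => ?_, le_antisymm ?_ ?_⟩
  · obtain ⟨b, hb⟩ := spectral_one_mem (star x * x)
    have h1 : (⟨_, isFaithfulConditionalExpectation_spectral.mem (star x * x)⟩ :
        coeffSubalgebra φ) = coeffEquiv φ b := Subtype.ext hb
    rw [extendFunctional_apply, h1, hh]
    exact nonneg_of_coeffHom_eq_spectral hb.symm h
  · exact (LinearMap.mkContinuous_norm_le _ (norm_nonneg ω) _).trans_eq hω.2
  · rw [← hω.2]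
    refine ω.opNorm_le_bound (norm_nonneg _) fun b => ?_
    rw [← extendFunctional_coe]
    exact (extendFunctional ω).le_opNorm b

variable (φ) in
/-- The inclusion of `C₀(H)` in the crossed product. -/
def coeffSubalgebraL : coeffSubalgebra φ →L[ℂ] CrossedProduct φ where
  toFun b := b
  map_add' _ _ := rfl
  map_smul' _ _ := rfl
  cont := continuous_subtype_val

theorem norm_comp_coeffSubalgebraL_le (ω : CrossedProduct φ →L[ℂ] ℂ) :
    ‖ω.comp (coeffSubalgebraL φ)‖ ≤ ‖ω‖ :=
  ContinuousLinearMap.opNorm_le_bound _ (norm_nonneg _) fun b => ω.le_opNorm b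

/-- The extension is unique even among all states. This also gives its purity: components of a
convex decomposition restrict to ω by purity of ω, and therefore coincide with the extension. -/
theorem hasUniqueExtensionProperty_coeffSubalgebra (hφ : Function.Injective φ) :
    HasUniqueExtensionProperty (coeffSubalgebra φ) := by
  intro ω hω
  have hpure := hω.comp_isometryEquiv (coeffIsometryEquiv φ) fun x => by
    change coeffEquiv φ (star x * x) = star (coeffEquiv φ x) * coeffEquiv φ x
    rw [map_mul, map_star]
  obtain ⟨h, hh⟩ := hpure.exists_eq_eval
  have hh : ∀ a, ω (coeffEquiv φ a) = a h := hh
  have hst : IsState ω := hω.1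
  have hext := isState_extendFunctional hst hh
  have huniq : ∀ ω' : CrossedProduct φ →L[ℂ] ℂ, IsState ω' →
      (∀ b : coeffSubalgebra φ, ω' b = ω b) → ω' = extendFunctional ω := fun ω' hω' hb =>
    hω'.eq_of_coeffHom hφ hext
      (fun a => (hb (coeffEquiv φ a)).trans (hh a))
      (fun a => (extendFunctional_coe ω (coeffEquiv φ a)).trans (hh a))
  refine ⟨extendFunctional ω, ⟨⟨hext, fun ω₁ h₁ ω₂ h₂ h => ?_⟩, extendFunctional_coe ω⟩,
    fun ω' hω' => huniq ω' hω'.1.1 hω'.2⟩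
  obtain ⟨a, b, ha, hb, hab, hsum⟩ := h
  have h₁ : IsState ω₁ := h₁
  have h₂ : IsState ω₂ := h₂
  let r₁ := ω₁.comp (coeffSubalgebraL φ)
  let r₂ := ω₂.comp (coeffSubalgebraL φ)
  have hr : a • r₁ + b • r₂ = ω := by
    ext x
    have := DFunLike.congr_fun hsum (x : CrossedProduct φ)
    rw [extendFunctional_coe] at this
    exact this
  have hn1 : ‖r₁‖ ≤ 1 := (norm_comp_coeffSubalgebraL_le ω₁).trans_eq h₁.2
  have hn2 : ‖r₂‖ ≤ 1 := (norm_comp_coeffSubalgebraL_le ω₂).trans_eq h₂.2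
  -- As a + b = 1 with a, b > 0 and both norms are at most 1, this forces the restrictions to have
  -- norm exactly 1.
  have hn : 1 ≤ a * ‖r₁‖ + b * ‖r₂‖ := by
    rw [← hst.2, ← hr]
    refine (norm_add_le _ _).trans_eq ?_
    rw [norm_smul, norm_smul, Real.norm_of_nonneg ha.le, Real.norm_of_nonneg hb.le]
  have hr1 : IsState r₁ := ⟨fun x => h₁.1 x, by nlinarith⟩
  have hr2 : IsState r₂ := ⟨fun x => h₂.1 x, by nlinarith⟩
  have heq : r₁ = ω := hω.2 hr1 hr2 ⟨a, b, ha, hb, hab, hr⟩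
  exact huniq ω₁ h₁ fun x => DFunLike.congr_fun heq x

theorem isDiagonal_coeffSubalgebra (hφ : Function.Injective φ) :
    IsDiagonal (coeffSubalgebra φ) :=
  ⟨isCartanSubalgebra_coeffSubalgebra hφ, hasUniqueExtensionProperty_coeffSubalgebra hφ⟩

end UniqueExtension

/-! ### Transport of diagonals along isomorphisms -/

section TransportDiagonal

variable {A A' : Type*} [NonUnitalCStarAlgebra A] [NonUnitalCStarAlgebra A']

/-- Star isomorphisms of C*-algebras are isometric. -/
def StarAlgEquiv.toIsometryEquiv (e : A ≃⋆ₐ[ℂ] A') : A ≃ₗᵢ[ℂ] A' where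
  toFun := e
  invFun := e.symm
  left_inv := e.left_inv
  right_inv := e.right_inv
  map_add' := map_add e
  map_smul' := map_smul e
  norm_map' a := NonUnitalStarAlgHom.norm_map (e : A →⋆ₙₐ[ℂ] A') e.injective a

theorem mem_map_iff {e : A ≃⋆ₐ[ℂ] A'} {B : NonUnitalStarSubalgebra ℂ A} {y : A'} :
    y ∈ B.map e ↔ e.symm y ∈ B := by
  rw [NonUnitalStarSubalgebra.mem_map]
  constructor
  · rintro ⟨x, hx, rfl⟩
    rwa [StarAlgEquiv.symm_apply_apply]
  · exact fun h => ⟨_, h, e.apply_symm_apply y⟩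

variable {B : NonUnitalStarSubalgebra ℂ A} (e : A ≃⋆ₐ[ℂ] A')

theorem ContainsApproximateUnit.map (h : ContainsApproximateUnit B) :
    ContainsApproximateUnit (B.map e) := by
  obtain ⟨l, hl, he⟩ := h
  have hc : Continuous e := (StarAlgEquiv.toIsometryEquiv e).continuous
  refine ⟨l.map e, { tendsto_mul_left := fun y => ?_, tendsto_mul_right := fun y => ?_,
                     neBot := hl.neBot.map _ }, eventually_map.2 (he.mono fun x hx => ?_)⟩
  · have := (hc.tendsto _).comp (hl.tendsto_mul_left (e.symm y))
    rw [StarAlgEquiv.apply_symm_apply] at this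
    refine tendsto_map'_iff.2 (this.congr fun x => ?_)
    simp
  · have := (hc.tendsto _).comp (hl.tendsto_mul_right (e.symm y))
    rw [StarAlgEquiv.apply_symm_apply] at this
    refine tendsto_map'_iff.2 (this.congr fun x => ?_)
    simp
  · obtain ⟨h1, h2, c, rfl⟩ := hx
    exact ⟨⟨_, h1, rfl⟩, ((StarAlgEquiv.toIsometryEquiv e).norm_map _).trans_le h2, e c, by
      rw [map_mul, map_star]⟩

theorem IsMaximalAbelian.map (h : IsMaximalAbelian B) : IsMaximalAbelian (B.map e) := by
  constructor
  · rintro _ ⟨x, hx, rfl⟩ _ ⟨y, hy, rfl⟩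
    change e x * e y = e y * e x
    rw [← map_mul, h.1 x hx y hy, map_mul]
  · intro C hC hcomm
    have h1 := h.2 (C.comap e) (fun x hx => hC ⟨x, hx, rfl⟩) fun x hx y hy => e.injective (by
      rw [map_mul, map_mul]
      exact hcomm _ hx _ hy)
    refine le_antisymm (fun y hy => mem_map_iff.2 ?_) hC
    rw [← h1, NonUnitalStarSubalgebra.mem_comap, StarAlgEquiv.apply_symm_apply]
    exact hy

theorem IsRegularSubalgebra.map (h : IsRegularSubalgebra B) : IsRegularSubalgebra (B.map e) := by
  have hc : Continuous e := (StarAlgEquiv.toIsometryEquiv e).continuous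
  refine top_unique fun y _ => ?_
  have h1 : (NonUnitalStarAlgebra.adjoin ℂ (normalizerSet B)).topologicalClosure ≤
      ((NonUnitalStarAlgebra.adjoin ℂ (normalizerSet (B.map e))).topologicalClosure).comap e := by
    refine NonUnitalStarSubalgebra.topologicalClosure_minimal _
      (NonUnitalStarAlgebra.adjoin_le fun n hn => ?_)
      ((NonUnitalStarSubalgebra.isClosed_topologicalClosure _).preimage hc)
    refine NonUnitalStarSubalgebra.le_topologicalClosure _
      (NonUnitalStarAlgebra.subset_adjoin ℂ _ ?_)
    rintro _ ⟨b, hb, rfl⟩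
    obtain ⟨h1, h2⟩ := hn b hb
    change e n * e b * star (e n) ∈ _ ∧ star (e n) * e b * e n ∈ _
    rw [← map_star, ← map_mul, ← map_mul, ← map_mul, ← map_mul]
    exact ⟨⟨_, h1, rfl⟩, ⟨_, h2, rfl⟩⟩
  have h2 : e.symm y ∈ (NonUnitalStarAlgebra.adjoin ℂ (normalizerSet B)).topologicalClosure := by
    rw [show _ = ⊤ from h]
    trivial
  have h3 := h1 h2
  rwa [NonUnitalStarSubalgebra.mem_comap, StarAlgEquiv.apply_symm_apply] at h3

theorem IsFaithfulConditionalExpectation.map {P : A →L[ℂ] A}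
    (h : IsFaithfulConditionalExpectation B P) :
    ∃ P', IsFaithfulConditionalExpectation (B.map e) P' := by
  let i := StarAlgEquiv.toIsometryEquiv e
  let P' : A' →L[ℂ] A' := (i : A →L[ℂ] A').comp (P.comp (i.symm : A' →L[ℂ] A))
  have hP : ∀ y, P' y = e (P (e.symm y)) := fun _ => rfl
  have hn : ∀ x, ‖e x‖ = ‖x‖ := i.norm_map
  have hn' : ∀ x, ‖e.symm x‖ = ‖x‖ := i.symm.norm_map
  refine ⟨P', ⟨fun a => ⟨_, h.mem _, rfl⟩, ?_, fun a => ?_, fun a => ?_, ?_, ?_, fun a ha => ?_⟩⟩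
  · rintro _ ⟨b, hb, rfl⟩
    change e (P (e.symm (e b))) = e b
    rw [StarAlgEquiv.symm_apply_apply, h.apply_of_mem b hb]
  · rw [hP, hn, ← hn' a]
    exact h.norm_le _
  · obtain ⟨c, hc⟩ := h.positive (e.symm a)
    exact ⟨e c, by rw [hP, map_mul, map_star, hc, map_mul, map_star]⟩
  · rintro _ ⟨b, hb, rfl⟩ a
    change e (P (e.symm (e b * a))) = e b * e (P (e.symm a))
    rw [map_mul, StarAlgEquiv.symm_apply_apply, h.map_mul_left b hb, map_mul]
  · rintro _ ⟨b, hb, rfl⟩ a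
    change e (P (e.symm (a * e b))) = e (P (e.symm a)) * e b
    rw [map_mul, StarAlgEquiv.symm_apply_apply, h.map_mul_right b hb, map_mul]
  · rw [hP, map_mul, map_star] at ha
    have h1 := h.faithful (e.symm a) (e.injective (ha.trans (map_zero e).symm))
    rw [← e.apply_symm_apply a, h1, map_zero]

/-- The restriction of an isomorphism to a subalgebra. -/
def mapIsometryEquiv (B : NonUnitalStarSubalgebra ℂ A) : B ≃ₗᵢ[ℂ] B.map e where
  toFun b := ⟨e b, b, b.2, rfl⟩
  invFun y := ⟨e.symm y, mem_map_iff.1 y.2⟩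
  left_inv _ := Subtype.ext (e.symm_apply_apply _)
  right_inv _ := Subtype.ext (e.apply_symm_apply _)
  map_add' _ _ := Subtype.ext (map_add e _ _)
  map_smul' c _ := Subtype.ext (map_smul e c _)
  norm_map' b := (StarAlgEquiv.toIsometryEquiv e).norm_map b

theorem HasUniqueExtensionProperty.map (h : HasUniqueExtensionProperty B) :
    HasUniqueExtensionProperty (B.map e) := by
  intro ω hω
  let i := StarAlgEquiv.toIsometryEquiv e
  have hi : ∀ x, i (star x * x) = star (i x) * i x := fun x => by
    change e _ = star (e x) * e x
    rw [map_mul, map_star]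
  have hi' : ∀ x, i.symm (star x * x) = star (i.symm x) * i.symm x := fun x => by
    change e.symm _ = star (e.symm x) * e.symm x
    rw [map_mul, map_star]
  obtain ⟨ω', ⟨h1, h2⟩, h3⟩ := h _ (hω.comp_isometryEquiv (mapIsometryEquiv e B) fun x =>
    Subtype.ext (hi x))
  refine ⟨ω'.comp (i.symm : A' →L[ℂ] A), ⟨h1.comp_isometryEquiv i.symm hi', fun b => ?_⟩,
    fun σ hσ => ?_⟩
  · have := h2 ((mapIsometryEquiv e B).symm b)
    refine this.trans ?_
    change ω ((mapIsometryEquiv e B) ((mapIsometryEquiv e B).symm b)) = ω b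
    rw [LinearIsometryEquiv.apply_symm_apply]
  · have h4 := h3 (σ.comp (i : A →L[ℂ] A')) ⟨hσ.1.comp_isometryEquiv i hi, fun b =>
      hσ.2 (mapIsometryEquiv e B b)⟩
    rw [← h4]
    ext y
    change σ y = σ (i (i.symm y))
    rw [LinearIsometryEquiv.apply_symm_apply]

theorem IsDiagonal.map (h : IsDiagonal B) : IsDiagonal (B.map e) where
  cartan :=
    { isClosed := by
        have : (B.map e : Set A') = e.symm ⁻¹' (B : Set A) := by
          ext y
          exact mem_map_iff
        rw [this]
        exact h.cartan.isClosed.preimage (StarAlgEquiv.toIsometryEquiv e).symm.continuous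
      approximateUnit := h.cartan.approximateUnit.map e
      maximalAbelian := h.cartan.maximalAbelian.map e
      regular := h.cartan.regular.map e
      expectation := by
        obtain ⟨P, hP⟩ := h.cartan.expectation
        exact hP.map e }
  uniqueExtension := h.uniqueExtension.map e

end TransportDiagonal

section Dual

variable {G : Type u} {H : Type v}
  [TopologicalSpace G] [CommGroup G] [IsTopologicalGroup G] [LocallyCompactSpace G] [T2Space G]
  [TopologicalSpace H] [CommGroup H] [IsTopologicalGroup H] [LocallyCompactSpace H] [T2Space H]
  {φ : G →ₜ* H}

/-- The result for discrete groups applies to the dual homomorphism itself, and any *-isomorphism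
carries diagonals to diagonals. -/
theorem isDiagonal_dualCoeffSubalgebra [DiscreteTopology (PontryaginDual H)]
    (hφ : Function.Injective (PontryaginDual.map φ))
    (F : CrossedProduct φ ≃⋆ₐ[ℂ] DualCrossedProduct φ) : IsDiagonal (dualCoeffSubalgebra F) :=
  (isDiagonal_coeffSubalgebra hφ).map F.symm

theorem injective_map_of_denseRange (hφ : DenseRange φ) :
    Function.Injective (PontryaginDual.map φ) := fun χ χ' h => by
  refine DFunLike.coe_injective (hφ.equalizer (map_continuous χ) (map_continuous χ') ?_)
  exact funext fun g => DFunLike.congr_fun h g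

end Dual

/-! ### Algebras of continuous functions on compact spaces -/

section ContinuousFunctions

variable {X Y : Type*} [TopologicalSpace X] [TopologicalSpace Y] [CompactSpace X] [CompactSpace Y]

variable (X) in
/-- On a compact space all continuous functions vanish at infinity. -/
def zeroAtInftyEquiv : C₀(X, ℂ) ≃⋆ₐ[ℂ] C(X, ℂ) where
  toFun f := f
  invFun f := ZeroAtInftyContinuousMap.ContinuousMap.liftZeroAtInfty f
  left_inv _ := rfl
  right_inv _ := rfl
  map_mul' _ _ := rfl
  map_add' _ _ := rfl
  map_star' _ := rfl
  map_smul' _ _ := rfl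

/-- Isomorphisms of complex algebras of continuous functions are induced by maps of the spaces. -/
theorem exists_continuousMap_of_linearEquiv [T2Space X] [T2Space Y] (e : C(X, ℂ) ≃ₗ[ℂ] C(Y, ℂ))
    (he : ∀ f g, e (f * g) = e f * e g) : ∃ s : C(Y, X), Function.Injective s := by
  -- `e` is only assumed linear and multiplicative, but a surjective multiplicative map preserves
  -- the identity.
  have h1 : e 1 = 1 := by
    have := he 1 (e.symm 1)
    rwa [one_mul, LinearEquiv.apply_symm_apply, mul_one, eq_comm] at this
  let a : C(X, ℂ) ≃ₐ[ℂ] C(Y, ℂ) := AlgEquiv.ofLinearEquiv e h1 he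
  let κ : Y → WeakDual.characterSpace ℂ C(X, ℂ) := fun y =>
    WeakDual.CharacterSpace.equivAlgHom.symm
      ((ContinuousMap.evalAlgHom ℂ ℂ y).comp (a : C(X, ℂ) →ₐ[ℂ] C(Y, ℂ)))
  have hκ : ∀ y f, κ y f = e f y := fun _ _ => rfl
  have hc : Continuous κ :=
    Continuous.subtype_mk (WeakDual.continuous_of_continuous_eval fun f => (e f).continuous) _
  let i := WeakDual.CharacterSpace.homeoEval X ℂ
  refine ⟨⟨fun y => i.symm (κ y), i.symm.continuous.comp hc⟩, fun y y' h => ?_⟩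
  have h2 : κ y = κ y' := i.symm.injective h
  -- Every function on `Y` is some `e f`, so two points with the same image in `X` give the same
  -- evaluation and are equal.
  refine (WeakDual.CharacterSpace.continuousMapEval_bijective (X := Y) (𝕜 := ℂ)).1 ?_
  refine DFunLike.ext _ _ fun g => ?_
  have h3 := DFunLike.congr_fun h2 (e.symm g)
  rwa [hκ, hκ, LinearEquiv.apply_symm_apply] at h3

theorem exists_continuousMap_of_starAlgEquiv [T2Space X] [T2Space Y] {R S : Type*}
    [NonUnitalNonAssocSemiring R] [Module ℂ R] [Star R]
    [NonUnitalNonAssocSemiring S] [Module ℂ S] [Star S]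
    (a : R ≃⋆ₐ[ℂ] C(X, ℂ)) (b : S ≃⋆ₐ[ℂ] C(Y, ℂ)) (e : R ≃ₗ[ℂ] S)
    (he : ∀ x y, e (x * y) = e x * e y) : ∃ s : C(Y, X), Function.Injective s := by
  refine exists_continuousMap_of_linearEquiv
    { toFun := fun f => b (e (a.symm f))
      invFun := fun g => a (e.symm (b.symm g))
      left_inv := fun f => by
        beta_reduce
        rw [StarAlgEquiv.symm_apply_apply, LinearEquiv.symm_apply_apply,
          StarAlgEquiv.apply_symm_apply]
      right_inv := fun g => by
        beta_reduce
        rw [StarAlgEquiv.symm_apply_apply, LinearEquiv.apply_symm_apply,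
          StarAlgEquiv.apply_symm_apply]
      map_add' := fun f g => by rw [map_add, map_add, map_add]
      map_smul' := fun c f => by rw [map_smul, map_smul, map_smul, RingHom.id_apply] }
    fun f g => ?_
  change b (e (a.symm (f * g))) = b (e (a.symm f)) * b (e (a.symm g))
  rw [map_mul, he, map_mul]

end ContinuousFunctions

/-! ### The torus does not embed in the circle -/

section Circle

theorem exp_pi_ne_one : Circle.exp Real.pi ≠ 1 := fun h => by
  have h1 := Circle.arg_exp (x := Real.pi) (by linarith [Real.pi_pos]) le_rfl
  rw [h] at h1
  simp [Real.pi_ne_zero.symm] at h1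

theorem exp_pi_mul_exp_pi : Circle.exp Real.pi * Circle.exp Real.pi = 1 := by
  rw [← Circle.exp_add, ← two_mul, Circle.exp_two_pi]

theorem not_injective_of_continuous_circle {f : Circle → ℝ} (hf : Continuous f) :
    ¬ Function.Injective f := fun h => by
  -- This compares f at antipodal points. It changes sign between 0 and π, so f agrees at some
  -- antipodal pair.
  let g : ℝ → ℝ := fun t => f (Circle.exp t) - f (Circle.exp Real.pi * Circle.exp t)
  have hg : Continuous g := by fun_prop
  have h0 : g Real.pi = - g 0 := by
    simp only [g, exp_pi_mul_exp_pi, Circle.exp_zero, mul_one, neg_sub]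
  have hz : (0 : ℝ) ∈ Set.range g := by
    rcases le_total (g 0) 0 with h1 | h1
    · exact mem_range_of_exists_le_of_exists_ge hg ⟨0, h1⟩ ⟨Real.pi, by rw [h0]; linarith⟩
    · exact mem_range_of_exists_le_of_exists_ge hg ⟨Real.pi, by rw [h0]; linarith⟩ ⟨0, h1⟩
  obtain ⟨t, ht⟩ := hz
  exact exp_pi_ne_one (mul_eq_right.1 (h (sub_eq_zero.1 ht)).symm)

/-- The torus does not embed in the circle. -/
theorem not_injective_torus_circle (s : C(Circle × Circle, Circle)) :
    ¬ Function.Injective s := fun hs => by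
  let c := Circle.exp Real.pi
  -- The subcircle z ↦ (z, 1) misses (1, c), so its image misses a point. After rotating that point
  -- to c = exp(iπ), the argument is continuous on the image and embeds the circle in the line.
  let w : Circle → Circle := fun z => c * (s (z, 1) / s (1, c))
  have hw : Continuous w := by fun_prop
  have hwc : ∀ z, w z ≠ c := fun z h => by
    have h1 := hs (div_eq_one.1 (mul_eq_left.1 h))
    exact exp_pi_ne_one (Prod.ext_iff.1 h1).2.symm
  have hcarg : Complex.arg c = Real.pi :=
    Circle.arg_exp (by linarith [Real.pi_pos]) le_rfl
  refine not_injective_of_continuous_circle (f := fun z => Complex.arg (w z)) ?_ ?_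
  · refine continuous_iff_continuousAt.2 fun z => ?_
    refine ContinuousAt.comp (g := Complex.arg) (f := fun z => (w z : ℂ))
      (Complex.continuousAt_arg ?_) (continuous_subtype_val.comp hw).continuousAt
    refine Complex.mem_slitPlane_iff_arg.2 ⟨fun h => ?_, (w z).coe_ne_zero⟩
    exact hwc z (Circle.injective_arg (h.trans hcarg.symm))
  · intro z z' h
    have h1 : w z = w z' := Circle.injective_arg h
    exact (Prod.ext_iff.1 (hs (div_left_injective (mul_right_injective c h1)))).1

end Circle

/-! ### The irrational rotation example -/

section TorusDual

theorem continuous_eval_character {X : Type*} [TopologicalSpace X] [CommGroup X]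
    [IsTopologicalGroup X] [LocallyCompactSpace X] (x : X) : Continuous fun ψ : PontryaginDual X => ψ x :=
  continuous_dual_eval.comp (f := fun ψ : PontryaginDual X => (ψ, x)) (by fun_prop)

/-- The characters of `ℤ²` are the points of the torus. -/
def torusDualHomeomorph :
    PontryaginDual (Multiplicative (ℤ × ℤ)) ≃ₜ Circle × Circle :=
  -- The dual of a discrete group is compact, so a continuous bijection onto the Hausdorff torus
  -- suffices.
  Continuous.homeoOfEquivCompactToT2
    (f := Equiv.ofBijective
      (fun ψ : PontryaginDual (Multiplicative (ℤ × ℤ)) =>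
        (ψ (Multiplicative.ofAdd (1, 0)), ψ (Multiplicative.ofAdd (0, 1)))) (by
      constructor
      · intro ψ ψ' h
        obtain ⟨h1, h2⟩ := Prod.ext_iff.1 h
        refine DFunLike.ext _ _ fun p => ?_
        have hp : p = Multiplicative.ofAdd ((1, 0) : ℤ × ℤ) ^ (Multiplicative.toAdd p).1 *
            Multiplicative.ofAdd ((0, 1) : ℤ × ℤ) ^ (Multiplicative.toAdd p).2 := by
          refine Multiplicative.toAdd.injective (Prod.ext ?_ ?_) <;> simp
        rw [hp, map_mul, map_mul, map_zpow, map_zpow, map_zpow, map_zpow]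
        exact congrArg₂ (fun z w : Circle => z ^ _ * w ^ _) h1 h2
      · rintro ⟨z, w⟩
        let ψ : Multiplicative (ℤ × ℤ) →* Circle :=
          { toFun := fun p => z ^ (Multiplicative.toAdd p).1 * w ^ (Multiplicative.toAdd p).2
            map_one' := by simp
            map_mul' := fun p q => by
              rw [toAdd_mul, Prod.fst_add, Prod.snd_add, zpow_add, zpow_add, mul_mul_mul_comm] }
        refine ⟨(⟨ψ, continuous_of_discreteTopology⟩ : Multiplicative (ℤ × ℤ) →ₜ* Circle), ?_⟩
        refine Prod.ext ?_ ?_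
        · change z ^ (1 : ℤ) * w ^ (0 : ℤ) = z
          simp
        · change z ^ (0 : ℤ) * w ^ (1 : ℤ) = w
          simp))
    ((continuous_eval_character _).prodMk (continuous_eval_character _))

end TorusDual

section Rotation

variable {α β : ℝ}

theorem rotationHom_apply (p : Multiplicative (ℤ × ℤ)) :
    rotationHom α β p = Multiplicative.ofAdd
      ((α * (Multiplicative.toAdd p).1 + β * (Multiplicative.toAdd p).2 : ℝ) :
        UnitAddCircle) := rfl

theorem eq_zero_of_linearIndependent (h : LinearIndependent ℚ ![1, α, β]) {k m n : ℤ}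
    (hk : k + m * α + n * β = 0) : k = 0 ∧ m = 0 ∧ n = 0 := by
  have h1 := Fintype.linearIndependent_iff.1 h ![(k : ℚ), m, n] (by
    simp [Fin.sum_univ_three, Rat.smul_def, hk])
  exact ⟨by simpa using h1 0, by simpa using h1 1, by simpa using h1 2⟩

theorem rotationHom_injective (h : LinearIndependent ℚ ![1, α, β]) :
    Function.Injective (rotationHom α β) := by
  refine (injective_iff_map_eq_one _).2 fun p hp => ?_
  rw [rotationHom_apply] at hp
  obtain ⟨k, hk⟩ := (AddCircle.coe_eq_zero_iff 1).1 (Multiplicative.ofAdd.injective hp)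
  obtain ⟨-, hm, hn⟩ := eq_zero_of_linearIndependent h (k := -k)
    (m := (Multiplicative.toAdd p).1) (n := (Multiplicative.toAdd p).2) (by
      rw [zsmul_one] at hk
      push_cast
      linarith)
  exact Multiplicative.toAdd.injective (Prod.ext hm hn)

/-- The multiples of α alone are dense modulo 1, because independence makes α irrational. -/
theorem denseRange_rotationHom (h : LinearIndependent ℚ ![1, α, β]) :
    DenseRange (rotationHom α β) := by
  have hα : Irrational (α / 1) := by
    rw [div_one]
    rintro ⟨q, hq⟩
    have hd : (q.den : ℝ) ≠ 0 := by exact_mod_cast q.den_nz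
    obtain ⟨-, hm, -⟩ := eq_zero_of_linearIndependent h (k := -q.num) (m := q.den) (n := 0) (by
      rw [← hq, Rat.cast_def]
      push_cast
      field_simp
      ring)
    exact q.den_nz (by exact_mod_cast hm)
  have h1 : Dense (Set.range ((· • (α : UnitAddCircle)) : ℤ → UnitAddCircle)) :=
    AddCircle.denseRange_zsmul_coe_iff.2 hα
  refine Dense.mono (s₁ := (Set.range ((· • (α : UnitAddCircle)) : ℤ → UnitAddCircle))) ?_ h1
  rintro _ ⟨m, rfl⟩
  refine ⟨Multiplicative.ofAdd (m, 0), ?_⟩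
  rw [rotationHom_apply]
  change ((α * m + β * (0 : ℤ) : ℝ) : UnitAddCircle) = m • (α : UnitAddCircle)
  rw [← AddCircle.coe_zsmul, zsmul_eq_mul, Int.cast_zero, mul_zero, add_zero, mul_comm]

variable (α β) in
/-- For the irrational rotations, `C₀(H)` is `C(𝕋)`. -/
def coeffRotationEquiv : coeffSubalgebra (rotationHom α β) ≃⋆ₐ[ℂ] C(Circle, ℂ) :=
  ((coeffEquiv (rotationHom α β)).symm.trans
    (zeroAtInftyEquiv (Multiplicative UnitAddCircle))).trans
    (Homeomorph.compStarAlgEquiv' ℂ ℂ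
      (show Circle ≃ₜ Multiplicative UnitAddCircle from
        (AddCircle.homeomorphCircle one_ne_zero).symm))

/-- The restriction of a star isomorphism to a subalgebra. -/
def mapStarAlgEquiv {A A' : Type*} [NonUnitalCStarAlgebra A] [NonUnitalCStarAlgebra A']
    (e : A ≃⋆ₐ[ℂ] A') (B : NonUnitalStarSubalgebra ℂ A) : B ≃⋆ₐ[ℂ] B.map e where
  toFun b := ⟨e b, b, b.2, rfl⟩
  invFun y := ⟨e.symm y, mem_map_iff.1 y.2⟩
  left_inv _ := Subtype.ext (e.symm_apply_apply _)
  right_inv _ := Subtype.ext (e.apply_symm_apply _)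
  map_add' _ _ := Subtype.ext (map_add e _ _)
  map_mul' _ _ := Subtype.ext (map_mul e _ _)
  map_star' _ := Subtype.ext (map_star e _)
  map_smul' c _ := Subtype.ext (map_smul e c _)

/-- For the irrational rotations, `C₀(Ĝ)` is `C(𝕋²)`. -/
def dualCoeffRotationEquiv
    (F : CrossedProduct (rotationHom α β) ≃⋆ₐ[ℂ] DualCrossedProduct (rotationHom α β)) :
    dualCoeffSubalgebra F ≃⋆ₐ[ℂ] C(Circle × Circle, ℂ) :=
  ((mapStarAlgEquiv F.symm (coeffSubalgebra (PontryaginDual.map (rotationHom α β)))).symm.trans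
    ((coeffEquiv (PontryaginDual.map (rotationHom α β))).symm.trans
      (zeroAtInftyEquiv (PontryaginDual (Multiplicative (ℤ × ℤ)))))).trans
    (Homeomorph.compStarAlgEquiv' ℂ ℂ torusDualHomeomorph.symm)

/-- An algebra isomorphism from C(𝕋) onto C(𝕋²) induces a continuous injection in the opposite
direction, from the torus to the circle. -/
theorem not_exists_linearEquiv_rotation
    (F : CrossedProduct (rotationHom α β) ≃⋆ₐ[ℂ] DualCrossedProduct (rotationHom α β)) :
    ¬ ∃ e : coeffSubalgebra (rotationHom α β) ≃ₗ[ℂ] dualCoeffSubalgebra F,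
      ∀ x y, e (x * y) = e x * e y := by
  rintro ⟨e, he⟩
  obtain ⟨s, hs⟩ := exists_continuousMap_of_starAlgEquiv (coeffRotationEquiv α β)
    (dualCoeffRotationEquiv F) e he
  exact not_injective_torus_circle s hs

end Rotation

end CartanExamples

end

/-! ### The main theorem -/

theorem mainTheorem4 :
    (∀ (G : Type u) (H : Type v)
      [TopologicalSpace G] [CommGroup G] [IsTopologicalGroup G] [LocallyCompactSpace G] [T2Space G]
      [TopologicalSpace H] [CommGroup H] [IsTopologicalGroup H] [LocallyCompactSpace H] [T2Space H]
      (φ : G →ₜ* H),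
      ∃ F : CartanExamples.CrossedProduct φ ≃⋆ₐ[ℂ] CartanExamples.DualCrossedProduct φ,
        CartanExamples.IsFourierTransform φ F ∧
        (∀ [DiscreteTopology G], Function.Injective φ →
          Function.Injective (CartanExamples.coeffHom φ) ∧
          CartanExamples.IsDiagonal (CartanExamples.coeffSubalgebra φ)) ∧
        (∀ [DiscreteTopology (PontryaginDual H)], Function.Injective (PontryaginDual.map φ) →
          Function.Injective (CartanExamples.coeffHom (PontryaginDual.map φ)) ∧
          CartanExamples.IsDiagonal (CartanExamples.dualCoeffSubalgebra F)) ∧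
        (∀ [DiscreteTopology G] [CompactSpace H], Function.Injective φ → DenseRange φ →
          Function.Injective (PontryaginDual.map φ) ∧
          Function.Injective (CartanExamples.coeffHom φ) ∧
          CartanExamples.IsDiagonal (CartanExamples.coeffSubalgebra φ) ∧
          Function.Injective (CartanExamples.coeffHom (PontryaginDual.map φ)) ∧
          CartanExamples.IsDiagonal (CartanExamples.dualCoeffSubalgebra F))) ∧
    (∀ α β : ℝ, LinearIndependent ℚ ![1, α, β] →
      ∃ F : CartanExamples.CrossedProduct (CartanExamples.rotationHom α β) ≃⋆ₐ[ℂ]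
          CartanExamples.DualCrossedProduct (CartanExamples.rotationHom α β),
        CartanExamples.IsFourierTransform (CartanExamples.rotationHom α β) F ∧
        CartanExamples.IsDiagonal
          (CartanExamples.coeffSubalgebra (CartanExamples.rotationHom α β)) ∧
        CartanExamples.IsDiagonal (CartanExamples.dualCoeffSubalgebra F) ∧
        Nonempty (CartanExamples.coeffSubalgebra (CartanExamples.rotationHom α β) ≃⋆ₐ[ℂ]
          C(Circle, ℂ)) ∧
        Nonempty (CartanExamples.dualCoeffSubalgebra F ≃⋆ₐ[ℂ] C(Circle × Circle, ℂ)) ∧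
        ¬ ∃ e : CartanExamples.coeffSubalgebra (CartanExamples.rotationHom α β) ≃ₗ[ℂ]
            CartanExamples.dualCoeffSubalgebra F,
          ∀ x y, e (x * y) = e x * e y) := by
  refine ⟨fun G H _ _ _ _ _ _ _ _ _ _ φ =>
    ⟨(CartanExamples.isFourierData φ).equiv, CartanExamples.isFourierTransform_equiv φ,
      fun hφ => ⟨CartanExamples.coeffHom_injective φ,
        CartanExamples.isDiagonal_coeffSubalgebra hφ⟩,
      fun hφ => ⟨CartanExamples.coeffHom_injective _,
        CartanExamples.isDiagonal_dualCoeffSubalgebra hφ _⟩,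
      fun hφ hd => ?_⟩, fun α β h => ?_⟩
  -- Dense range makes restriction of characters along φ injective, and compactness of H makes its
  -- dual discrete; so this case combines the two preceding ones.
  · have hd' := CartanExamples.injective_map_of_denseRange hd
    exact ⟨hd', CartanExamples.coeffHom_injective φ, CartanExamples.isDiagonal_coeffSubalgebra hφ,
      CartanExamples.coeffHom_injective _, CartanExamples.isDiagonal_dualCoeffSubalgebra hd' _⟩
  · let φ := CartanExamples.rotationHom α β
    exact ⟨(CartanExamples.isFourierData φ).equiv, CartanExamples.isFourierTransform_equiv φ,
      CartanExamples.isDiagonal_coeffSubalgebra (CartanExamples.rotationHom_injective h),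
      CartanExamples.isDiagonal_dualCoeffSubalgebra
        (CartanExamples.injective_map_of_denseRange (CartanExamples.denseRange_rotationHom h)) _,
      ⟨CartanExamples.coeffRotationEquiv α β⟩, ⟨CartanExamples.dualCoeffRotationEquiv _⟩,
      CartanExamples.not_exists_linearEquiv_rotation _⟩
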